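/- Let $N\ge 2$, let $\Omega\subset\mathbb{R}^N$ be a bounded domain (a nonempty, bounded, connected open set), and let $W_0^{1,N}(\Omega)$ be the closure of $C_c^\infty(\Omega)$ in $W^{1,N}(\Omega)$. Put $$\lambda_1(\Omega)=\inf\left\{\frac{\int_\Omega|\nabla u|^N\,dx}{\int_\Omega|u|^N\,dx}:\ u\in W_0^{1,N}(\Omega)\setminus\{0\}\right\}.$$ Let $f:\Omega\times\mathbb{R}\to\mathbb{R}$, and write $F(x,u)=\int_0^u f(x,t)\,dt$ and $H(x,u)=u f(x,u)-N F(x,u)$. Assume: (SCE) for every $\alpha>0$, $\displaystyle\lim_{u\to+\infty}\frac{|f(x,u)|}{\exp(\alpha|u|^{N/(N-1)})}=0$ uniformly in $x\in\Omega$; (L1) $f$ is continuous on $\Omega\times\mathbb{R}$, $f(x,u)\ge 0$ for all $x\in\Omega$, $u\ge 0$, and $f(x,u)=0$ for all $x\in\Omega$, $u\le 0$; (L2) $\displaystyle\lim_{u\to+\infty}\frac{F(x,u)}{u^N}=+\infty$ uniformly in $x\in\Omega$; (L3) there are constants $C_*\ge 0$ and $\theta\ge 1$ such that $H(x,t)\le\theta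 H(x,s)+C_*$ for all $0<t<s$ and all $x\in\Omega$; (L4) $\displaystyle\limsup_{u\to 0+}\frac{N F(x,u)}{|u|^N}<\lambda_1(\Omega)$ uniformly in $x\in\Omega$, that is, there are $c<\lambda_1(\Omega)$ and $\delta>0$ with $N F(x,u)\le c\,u^N$ for all $x\in\Omega$ and $0<u<\delta$. Then there is a function $u\in W_0^{1,N}(\Omega)$, $u\ne 0$, $u\ge 0$ almost everywhere in $\Omega$, that is a weak solution of $-\Delta_N u=-\operatorname{div}(|\nabla u|^{N-2}\nabla u)=f(x,u)$ in $\Omega$: for every $v\in W_0^{1,N}(\Omega)$ the function $f(x,u)v$ is integrable on $\Omega$ and $$\int_\Omega|\nabla u|^{N-2}\nabla u\cdot\nabla v\,dx=\int_\Omega f(x,u)\,v\,dx.$$ -/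

import Mathlib

open MeasureTheory Filter Topology Set
open scoped ContDiff ENNReal

/-- `φ ∈ C_c^∞(Ω)`. -/
structure IsTestFunction {N : ℕ} (Ω : Set (EuclideanSpace ℝ (Fin N)))
    (φ : EuclideanSpace ℝ (Fin N) → ℝ) : Prop where
  contDiff : ContDiff ℝ ∞ φ
  hasCompactSupport : HasCompactSupport φ
  tsupport_subset : tsupport φ ⊆ Ω

/-- `G` is the weak (distributional) gradient of `u` on `Ω`. -/
structure HasWeakGradient {N : ℕ} (Ω : Set (EuclideanSpace ℝ (Fin N)))
    (u : EuclideanSpace ℝ (Fin N) → ℝ)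
    (G : EuclideanSpace ℝ (Fin N) → EuclideanSpace ℝ (Fin N)) : Prop where
  locallyIntegrableOn : LocallyIntegrableOn u Ω
  locallyIntegrableOn_grad : LocallyIntegrableOn G Ω
  integral_eq : ∀ φ, IsTestFunction Ω φ →
    ∫ x in Ω, u x • gradient φ x = -∫ x in Ω, φ x • G x

/-- `u ∈ W^{1,p}(Ω)` with weak gradient `G`; the functions are only relevant up to
almost everywhere equality on `Ω`. -/
structure MemSobolevOne {N : ℕ} (Ω : Set (EuclideanSpace ℝ (Fin N))) (p : ℝ≥0∞)
    (u : EuclideanSpace ℝ (Fin N) → ℝ)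
    (G : EuclideanSpace ℝ (Fin N) → EuclideanSpace ℝ (Fin N)) : Prop where
  memLp : MemLp u p (volume.restrict Ω)
  memLp_grad : MemLp G p (volume.restrict Ω)
  hasWeakGradient : HasWeakGradient Ω u G

/-- `u ∈ W_0^{1,p}(Ω)` with weak gradient `G`: `u` belongs to the closure of `C_c^∞(Ω)` in
`W^{1,p}(Ω)`. -/
structure MemSobolevOneZero {N : ℕ} (Ω : Set (EuclideanSpace ℝ (Fin N))) (p : ℝ≥0∞)
    (u : EuclideanSpace ℝ (Fin N) → ℝ)
    (G : EuclideanSpace ℝ (Fin N) → EuclideanSpace ℝ (Fin N)) : Prop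
    extends MemSobolevOne Ω p u G where
  exists_approx : ∃ φ : ℕ → EuclideanSpace ℝ (Fin N) → ℝ,
    (∀ n, IsTestFunction Ω (φ n)) ∧
    Tendsto (fun n => eLpNorm (fun x => φ n x - u x) p (volume.restrict Ω)) atTop (𝓝 0) ∧
    Tendsto (fun n => eLpNorm (fun x => gradient (φ n) x - G x) p (volume.restrict Ω))
      atTop (𝓝 0)

/-- `λ₁(Ω)`, the infimum of `∫ |∇u|^N / ∫ |u|^N` over `u ∈ W_0^{1,N}(Ω)`, `u ≠ 0`. -/
noncomputable def firstEigenvalue {N : ℕ} (Ω : Set (EuclideanSpace ℝ (Fin N))) : ℝ :=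
  sInf {r : ℝ | ∃ u G, MemSobolevOneZero Ω (N : ℝ≥0∞) u G ∧
    ¬ (u =ᵐ[volume.restrict Ω] 0) ∧
    r = (∫ x in Ω, ‖G x‖ ^ N) / (∫ x in Ω, |u x| ^ N)}

/-- The primitive `F(x,u) = ∫_0^u f(x,t) dt`. -/
noncomputable def primF {N : ℕ} (f : EuclideanSpace ℝ (Fin N) → ℝ → ℝ)
    (x : EuclideanSpace ℝ (Fin N)) (u : ℝ) : ℝ :=
  ∫ t in (0 : ℝ)..u, f x t

/-- `H(x,u) = u f(x,u) - N F(x,u)`. -/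
noncomputable def auxH {N : ℕ} (f : EuclideanSpace ℝ (Fin N) → ℝ → ℝ)
    (x : EuclideanSpace ℝ (Fin N)) (u : ℝ) : ℝ :=
  u * f x u - N * primF f x u

/-- (L1): `f` is continuous on `Ω × ℝ`, nonnegative for `u ≥ 0` and zero for `u ≤ 0`. -/
structure CondL1 {N : ℕ} (Ω : Set (EuclideanSpace ℝ (Fin N)))
    (f : EuclideanSpace ℝ (Fin N) → ℝ → ℝ) : Prop where
  continuousOn : ContinuousOn (fun z : EuclideanSpace ℝ (Fin N) × ℝ => f z.1 z.2) (Ω ×ˢ univ)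
  nonneg : ∀ x ∈ Ω, ∀ u, 0 ≤ u → 0 ≤ f x u
  eq_zero : ∀ x ∈ Ω, ∀ u, u ≤ 0 → f x u = 0

/-- (L2): `F(x,u) / u^N → +∞` as `u → +∞`, uniformly in `x ∈ Ω`. -/
def CondL2 {N : ℕ} (Ω : Set (EuclideanSpace ℝ (Fin N)))
    (f : EuclideanSpace ℝ (Fin N) → ℝ → ℝ) : Prop :=
  ∀ M : ℝ, ∀ᶠ u : ℝ in atTop, ∀ x ∈ Ω, M ≤ primF f x u / u ^ N

/-- (L3): `H(x,t) ≤ θ H(x,s) + C` for all `0 < t < s` and `x ∈ Ω`. -/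
def CondL3 {N : ℕ} (Ω : Set (EuclideanSpace ℝ (Fin N)))
    (f : EuclideanSpace ℝ (Fin N) → ℝ → ℝ) : Prop :=
  ∃ C θ : ℝ, 0 ≤ C ∧ 1 ≤ θ ∧
    ∀ x ∈ Ω, ∀ t s : ℝ, 0 < t → t < s → auxH f x t ≤ θ * auxH f x s + C

/-- (L4): `limsup_{u → 0+} N F(x,u) / |u|^N < λ₁(Ω)`, uniformly in `x ∈ Ω`. -/
def CondL4 {N : ℕ} (Ω : Set (EuclideanSpace ℝ (Fin N)))
    (f : EuclideanSpace ℝ (Fin N) → ℝ → ℝ) : Prop :=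
  ∃ c : ℝ, c < firstEigenvalue Ω ∧
    ∀ᶠ u : ℝ in 𝓝[>] 0, ∀ x ∈ Ω, N * primF f x u / |u| ^ N ≤ c

/-- (SCE): for every `α > 0`, `|f(x,u)| / exp(α |u|^{N/(N-1)}) → 0` as `u → +∞`, uniformly in
`x ∈ Ω`. -/
def SubcriticalExpGrowth {N : ℕ} (Ω : Set (EuclideanSpace ℝ (Fin N)))
    (f : EuclideanSpace ℝ (Fin N) → ℝ → ℝ) : Prop :=
  ∀ α : ℝ, 0 < α → ∀ ε : ℝ, 0 < ε → ∀ᶠ u : ℝ in atTop, ∀ x ∈ Ω,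
    |f x u| / Real.exp (α * |u| ^ ((N : ℝ) / ((N : ℝ) - 1))) ≤ ε

/-- `u`, with weak gradient `G`, is a weak solution in `W_0^{1,N}(Ω)` of
`-div (|∇u|^{N-2} ∇u) = f(x,u)` in `Ω` (used for `N ≥ 2`). -/
structure IsWeakSolution {N : ℕ} (Ω : Set (EuclideanSpace ℝ (Fin N)))
    (f : EuclideanSpace ℝ (Fin N) → ℝ → ℝ)
    (u : EuclideanSpace ℝ (Fin N) → ℝ)
    (G : EuclideanSpace ℝ (Fin N) → EuclideanSpace ℝ (Fin N)) : Prop where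
  mem : MemSobolevOneZero Ω (N : ℝ≥0∞) u G
  integrableOn : ∀ v V, MemSobolevOneZero Ω (N : ℝ≥0∞) v V →
    IntegrableOn (fun x => f x (u x) * v x) Ω
  integral_eq : ∀ v V, MemSobolevOneZero Ω (N : ℝ≥0∞) v V →
    ∫ x in Ω, ‖G x‖ ^ (N - 2) * inner ℝ (G x) (V x) = ∫ x in Ω, f x (u x) * v x

/-! A solution is a critical point of `J(u) = (1/N) ∫ |∇u|^N - ∫ F(x,u)`. By (L4) and the Trudinger
inequality `J` is bounded below by a positive constant on a small sphere of `W_0^{1,N}`; by (L2) it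
is bounded above along the ray through a bump function. Two things are missing for the usual
mountain pass argument. There is no Ambrosetti–Rabinowitz condition, and `f` may be unbounded near
the boundary of `Ω`: (SCE) and (L3) bound `t f(x,t)` uniformly in `x`, but not `f(x,t)` for small
`t`.

Hence `truncate` replaces `f` by zero off the compact set `innerSet Ω n` and continues it by a
multiple of `t^(N+1)` beyond `n + 1`. Each truncation has polynomial growth and satisfies an
Ambrosetti–Rabinowitz condition (`exists_truncate_le`), while the conditions on `F`, `H` and the
exponential bounds survive with constants independent of `n` (`uniformFamily_truncate`). A truncated
problem is solved by Galerkin's method: a mountain pass theorem on a ball of a finite dimensional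
space (`exists_criticalPoint_of_mountainPass`), applied to spans of finitely many test functions,
followed by a passage to the limit (`exists_mountainPass_solution`).

The solutions `u_n` of the truncated problems have energies in a fixed interval, and they are
bounded (`exists_integral_norm_pow_le`). If not, let `w_n` be `u_n` divided by the `L^N` norm of its
gradient. Superlinearity forces `w_n → 0` almost everywhere along a subsequence, so the energy of `R
w_n` tends to `R^N / N`. But (L3) bounds the energy of every contraction `t u_n`, `0 < t ≤ 1`, by `θ
J_n(u_n) + C|Ω|/N` (`energy_dilation_le`), which is impossible for large `R`.

For bounded sequences Rellich's theorem gives almost everywhere convergence, the Trudinger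
inequality gives convergence of integrals of subcritical growth, and uniform convexity of `‖·‖^N`
turns an asymptotic upper bound on `∫ |∇u_k|^(N-2) ∇u_k · ∇(u_k - u_l)` into strong convergence of
gradients (`exists_limit_of_monotonicity`). For the truncated problems this bound comes from Fatou's
lemma, since nonlinearities and solutions are nonnegative. The limit equation holds on test
functions first and extends to `W_0^{1,N}` by `weakForm_of_isTestFunction`. The limit is not zero
because the energies stay above a positive constant.

A Trudinger inequality without the sharp constant suffices, since (SCE) allows every exponent `α >
0`. It follows from the decay of superlevel sets (`exists_measureReal_superlevel_le_exp`). -/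

/-! ### Convexity and uniform convexity of powers of the norm. -/

section VectorInequalities

variable {H : Type*} [NormedAddCommGroup H] [InnerProductSpace ℝ H]

/-- Bernoulli's inequality for `(q / p) ^ n`, multiplied by `p ^ n`. -/
lemma mul_pow_pred_mul_le {n : ℕ} (hn : 1 ≤ n) {p q : ℝ} (hp : 0 ≤ p) (hq : 0 ≤ q) :
    n * (p ^ (n - 1) * q) ≤ (n - 1) * p ^ n + q ^ n := by
  obtain ⟨m, rfl⟩ : ∃ m, n = m + 1 := ⟨n - 1, by omega⟩
  rcases hp.eq_or_lt with rfl | hp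
  · rcases Nat.eq_zero_or_pos m with rfl | hm
    · simp
    · have : 0 ≤ q ^ (m + 1) := by positivity
      simp [hm.ne']
      exact this
  · have h := one_add_mul_le_pow (a := q / p - 1) (by have := div_nonneg hq hp.le; linarith) (m + 1)
    have e : (1 + (q / p - 1)) ^ (m + 1) = q ^ (m + 1) / p ^ (m + 1) := by
      rw [← div_pow]; congr 1; ring
    rw [e, le_div_iff₀ (by positivity)] at h
    have e2 : q / p * p ^ (m + 1) = p ^ m * q := by
      rw [pow_succ]; field_simp
    simp only [Nat.add_sub_cancel]
    push_cast at h ⊢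
    nlinarith [h, e2]

/-- Convexity of `‖·‖ ^ n`: its graph lies above the tangent plane at `a`. Cauchy–Schwarz and the
scalar Young inequality suffice. -/
lemma norm_pow_add_inner_le {n : ℕ} (hn : 2 ≤ n) (a b : H) :
    ‖a‖ ^ n + n * (‖a‖ ^ (n - 2) * inner ℝ a (b - a)) ≤ ‖b‖ ^ n := by
  have h1 : ‖a‖ ^ (n - 2) * inner ℝ a b ≤ ‖a‖ ^ (n - 1) * ‖b‖ := by
    have : ‖a‖ ^ (n - 1) = ‖a‖ ^ (n - 2) * ‖a‖ := by rw [← pow_succ]; congr 1; omega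
    rw [this, mul_assoc]
    exact mul_le_mul_of_nonneg_left (real_inner_le_norm a b) (by positivity)
  have h2 := mul_pow_pred_mul_le (by omega : 1 ≤ n) (norm_nonneg a) (norm_nonneg b)
  have h3 : ‖a‖ ^ (n - 2) * inner ℝ a a = ‖a‖ ^ n := by
    rw [real_inner_self_eq_norm_sq, ← pow_add]; congr 1; omega
  have h4 : (n : ℝ) * (‖a‖ ^ (n - 2) * inner ℝ a b) ≤ n * (‖a‖ ^ (n - 1) * ‖b‖) := by gcongr
  rw [inner_sub_right, mul_sub, h3]
  linarith

/-- Clarkson's inequality for exponents at least two. -/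
lemma two_mul_norm_half_pow_le {n : ℕ} (hn : 2 ≤ n) (a b : H) :
    2 * ‖(2⁻¹ : ℝ) • (a + b)‖ ^ n + 2 * ‖(2⁻¹ : ℝ) • (b - a)‖ ^ n ≤ ‖a‖ ^ n + ‖b‖ ^ n := by
  have key : ∀ x : ℝ, 0 ≤ x → x ^ n = (x ^ 2) ^ ((n : ℝ) / 2) := by
    intro x hx
    rw [← Real.rpow_natCast, ← Real.rpow_natCast, ← Real.rpow_mul hx]
    congr 1; push_cast; ring
  have hp : (1 : ℝ) ≤ (n : ℝ) / 2 := by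
    have : (2 : ℝ) ≤ n := by exact_mod_cast hn
    linarith
  have hpar : ‖(2⁻¹ : ℝ) • (a + b)‖ ^ 2 + ‖(2⁻¹ : ℝ) • (b - a)‖ ^ 2
      = 2⁻¹ * ‖a‖ ^ 2 + 2⁻¹ * ‖b‖ ^ 2 := by
    have := parallelogram_law_with_norm ℝ a b
    rw [norm_smul, norm_smul, norm_sub_rev b a]
    simp only [norm_inv, Real.norm_ofNat]
    nlinarith
  rw [key _ (norm_nonneg _), key _ (norm_nonneg _), key _ (norm_nonneg a), key _ (norm_nonneg b)]
  -- In terms of squared norms and the exponent `n / 2 ≥ 1`: superadditivity of the power merges the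
  -- two terms on the left, the parallelogram law evaluates the merged square, and convexity of the
  -- power splits the result.
  have h1 := Real.add_rpow_le_rpow_add (sq_nonneg ‖(2⁻¹ : ℝ) • (a + b)‖)
    (sq_nonneg ‖(2⁻¹ : ℝ) • (b - a)‖) hp
  have h2 := (convexOn_rpow hp).2 (sq_nonneg ‖a‖) (sq_nonneg ‖b‖)
    (by norm_num : (0 : ℝ) ≤ 2⁻¹) (by norm_num : (0 : ℝ) ≤ 2⁻¹) (by norm_num)
  simp only [smul_eq_mul] at h2
  rw [hpar] at h1
  linarith

/-- Uniform convexity of `‖·‖ ^ n`, in the form of a quantitative gradient inequality. -/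
lemma norm_pow_add_inner_add_le {n : ℕ} (hn : 2 ≤ n) (a b : H) :
    ‖a‖ ^ n + n * (‖a‖ ^ (n - 2) * inner ℝ a (b - a)) + 2 * (2⁻¹ * ‖b - a‖) ^ n ≤ ‖b‖ ^ n := by
  -- The tangent plane inequality is used at the midpoint of `a` and `b`; Clarkson's inequality then
  -- leaves the extra term.
  have h1 := two_mul_norm_half_pow_le hn a b
  have h2 := norm_pow_add_inner_le hn a ((2⁻¹ : ℝ) • (a + b))
  have e : (2⁻¹ : ℝ) • (a + b) - a = (2⁻¹ : ℝ) • (b - a) := by module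
  have e2 : ‖(2⁻¹ : ℝ) • (b - a)‖ = 2⁻¹ * ‖b - a‖ := by rw [norm_smul]; simp
  rw [e, inner_smul_right] at h2
  rw [e2] at h1
  nlinarith

end VectorInequalities

/-! ### A mountain pass theorem in finite dimension. -/

section MountainPass

variable {H : Type*} [NormedAddCommGroup H]

/-- The derivative of `s ↦ Φ (a - s • X a)` is `-⟪X (a - s • X a), X a⟫`, which at `s = 0` is `-‖X
a‖ ^ 2`. By the tube lemma it stays below minus half the minimum of `‖X‖ ^ 2` on `K`, for all small
`s` simultaneously on `K`. -/
lemma exists_descent_step [InnerProductSpace ℝ H] [CompleteSpace H] {Φ : H → ℝ} {X : H → H} (hX : Continuous X)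
    (hΦ : ∀ a, HasGradientAt Φ (X a) a) {K : Set H} (hK : IsCompact K)
    (hne : ∀ a ∈ K, X a ≠ 0) :
    ∃ τ > 0, ∃ κ > 0, ∀ a ∈ K, ∀ s ∈ Icc 0 τ, Φ (a - s • X a) ≤ Φ a - s * κ := by
  rcases K.eq_empty_or_nonempty with rfl | hKne
  · exact ⟨1, one_pos, 1, one_pos, by simp⟩
  obtain ⟨a₀, ha₀, hmin⟩ := hK.exists_isMinOn hKne (hX.norm.continuousOn)
  have hδ : 0 < ‖X a₀‖ := norm_pos_iff.2 (hne a₀ ha₀)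
  set κ := ‖X a₀‖ ^ 2 / 2 with hκ
  have hκ0 : 0 < κ := by positivity
  have hcont : Continuous fun z : H × ℝ => inner ℝ (X (z.1 - z.2 • X z.1)) (X z.1) := by fun_prop
  have hopen : IsOpen {z : H × ℝ | κ < inner ℝ (X (z.1 - z.2 • X z.1)) (X z.1)} :=
    isOpen_lt continuous_const hcont
  have hsub : K ×ˢ ({0} : Set ℝ) ⊆ {z : H × ℝ | κ < inner ℝ (X (z.1 - z.2 • X z.1)) (X z.1)} := by
    rintro ⟨a, s⟩ ⟨ha, hs⟩
    have hs : s = 0 := hs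
    subst hs
    have h1 : ‖X a₀‖ ≤ ‖X a‖ := hmin ha
    simp only [mem_ofPred_eq, zero_smul, sub_zero, real_inner_self_eq_norm_sq]
    nlinarith
  obtain ⟨U, V, -, hV, hKU, h0V, hUV⟩ := generalized_tube_lemma hK isCompact_singleton hopen hsub
  obtain ⟨ε, hε, hball⟩ := Metric.isOpen_iff.1 hV 0 (h0V rfl)
  refine ⟨ε / 2, half_pos hε, κ, hκ0, fun a ha s hs => ?_⟩
  have hder : ∀ r : ℝ, HasDerivAt (fun r : ℝ => Φ (a - r • X a))
      (-inner ℝ (X (a - r • X a)) (X a)) r := by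
    intro r
    have h1 : HasDerivAt (fun r : ℝ => a - r • X a) (-X a) r := by
      simpa using ((hasDerivAt_id r).smul_const (X a)).const_sub a
    have h2 := (hΦ (a - r • X a)).hasFDerivAt.comp_hasDerivAt r h1
    simpa [Function.comp_def] using h2
  have hle : ∀ r ∈ Icc (0 : ℝ) (ε / 2), deriv (fun r : ℝ => Φ (a - r • X a)) r ≤ -κ := by
    intro r hr
    rw [(hder r).deriv]
    have : (a, r) ∈ U ×ˢ V := by
      refine ⟨hKU ha, hball ?_⟩
      rw [Metric.mem_ball, dist_zero_right, Real.norm_of_nonneg hr.1]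
      linarith [hr.2]
    have := hUV this
    simp only [mem_ofPred_eq] at this
    linarith
  have := (convex_Icc (0 : ℝ) (ε / 2)).image_sub_le_mul_sub_of_deriv_le
    (f := fun r : ℝ => Φ (a - r • X a)) (C := -κ)
    (fun r _ => (hder r).continuousAt.continuousWithinAt)
    (fun r _ => (hder r).differentiableAt.differentiableWithinAt)
    (fun r hr => hle r (interior_subset hr)) 0 ⟨le_rfl, by positivity⟩ s hs hs.1
  simp only [zero_smul, sub_zero] at this
  linarith

/-- Stop the path at the least time at which it meets the sphere; by the intermediate value theorem
it cannot have left the ball earlier. -/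
lemma exists_truncated_path {γ : ℝ → H} (hγ : Continuous γ) (h0 : γ 0 = 0) {R : ℝ} (hR : 0 < R)
    (h1 : R ≤ ‖γ 1‖) :
    ∃ t₀ ∈ Icc (0 : ℝ) 1, ‖γ t₀‖ = R ∧ ∀ t ∈ Icc 0 t₀, ‖γ t‖ ≤ R := by
  have hIVT : ∀ b, 0 ≤ b → R ≤ ‖γ b‖ → ∃ t ∈ Icc 0 b, ‖γ t‖ = R := by
    intro b hb hRb
    have := intermediate_value_Icc hb (f := fun t => ‖γ t‖) hγ.norm.continuousOn
    obtain ⟨t, ht, hte⟩ := this ⟨by simpa [h0] using hR.le, hRb⟩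
    exact ⟨t, ht, hte⟩
  have hcomp : IsCompact (Icc (0 : ℝ) 1 ∩ {t | ‖γ t‖ = R}) :=
    isCompact_Icc.inter_right (isClosed_eq hγ.norm continuous_const)
  obtain ⟨t, ht, hte⟩ := hIVT 1 zero_le_one h1
  obtain ⟨t₀, ⟨ht₀, ht₀e⟩, hleast⟩ := hcomp.exists_isLeast ⟨t, ht, hte⟩
  refine ⟨t₀, ht₀, ht₀e, fun s hs => ?_⟩
  by_contra hlt
  push Not at hlt
  obtain ⟨r, hr, hre⟩ := hIVT s hs.1 hlt.le
  have h2 : t₀ ≤ r := hleast ⟨⟨hr.1, hr.2.trans (hs.2.trans ht₀.2)⟩, hre⟩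
  have h3 : s = t₀ := le_antisymm hs.2 (h2.trans hr.2)
  rw [h3] at hlt
  exact hlt.ne ht₀e.symm

/-- A mountain pass theorem on a ball: if the functional decreases radially on the part of the
sphere that is relevant, every path from the centre to the sphere has to cross a barrier, and one
such path stays below a given level, then there is a critical point. -/
theorem exists_criticalPoint_of_mountainPass [InnerProductSpace ℝ H] [FiniteDimensional ℝ H] [CompleteSpace H] {Φ : H → ℝ} {X : H → H}
    (hX : Continuous X) (hΦ : ∀ a, HasGradientAt Φ (X a) a) (h0 : Φ 0 ≤ 0) {α β R : ℝ}
    (hα : 0 < α) (hR : 0 < R)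
    (hring : ∀ γ : ℝ → H, Continuous γ → γ 0 = 0 → ‖γ 1‖ = R → ∃ t ∈ Icc (0 : ℝ) 1, α ≤ Φ (γ t))
    (hpath : ∃ γ : ℝ → H, Continuous γ ∧ γ 0 = 0 ∧ R ≤ ‖γ 1‖ ∧ ∀ t ∈ Icc (0 : ℝ) 1, Φ (γ t) ≤ β)
    (hrad : ∀ a, ‖a‖ = R → Φ a ≤ β → inner ℝ (X a) a ≤ 0) :
    ∃ a, X a = 0 ∧ α / 2 ≤ Φ a ∧ Φ a ≤ β := by
  by_contra hcon
  push Not at hcon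
  have : ProperSpace H := FiniteDimensional.proper_real H
  have hΦc : Continuous Φ := continuous_iff_continuousAt.2 fun a => (hΦ a).continuousAt
  -- The relevant part of the energy strip, compact and by assumption free of critical points, so
  -- descent is uniform there.
  set K : Set H := Metric.closedBall 0 R ∩ (Φ ⁻¹' Icc (α / 2) β) with hKdef
  have hK : IsCompact K :=
    (isCompact_closedBall 0 R).inter_right (isClosed_Icc.preimage hΦc)
  obtain ⟨τ, hτ, κ, hκ, hdesc⟩ := exists_descent_step hX hΦ hK
    (fun a ha h => (hcon a h ha.2.1).not_ge ha.2.2)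
  have trunc : ∀ s, (∃ γ : ℝ → H, Continuous γ ∧ γ 0 = 0 ∧ R ≤ ‖γ 1‖ ∧
      ∀ t ∈ Icc (0 : ℝ) 1, Φ (γ t) ≤ s) → ∃ γ : ℝ → H, Continuous γ ∧ γ 0 = 0 ∧ ‖γ 1‖ = R ∧
      ∀ t ∈ Icc (0 : ℝ) 1, ‖γ t‖ ≤ R ∧ Φ (γ t) ≤ s := by
    rintro s ⟨γ, hγ, hγ0, hγ1, hγs⟩
    obtain ⟨t₀, ht₀, hte, htR⟩ := exists_truncated_path hγ hγ0 hR hγ1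
    refine ⟨fun t => γ (t₀ * t), by fun_prop, by simpa using hγ0, by simpa using hte, fun t ht => ?_⟩
    have h1 : t₀ * t ≤ t₀ := mul_le_of_le_one_right ht₀.1 ht.2
    have h2 : 0 ≤ t₀ * t := mul_nonneg ht₀.1 ht.1
    exact ⟨htR _ ⟨h2, h1⟩, hγs _ ⟨h2, h1.trans ht₀.2⟩⟩
  -- Cutoff for the descent: it is zero at levels up to `α / 2`, which keeps the origin fixed, and
  -- one from level `3 * α / 4` on, where full steps are needed.
  set ψ : H → ℝ := fun a => max 0 (min 1 (4 * Φ a / α - 2)) with hψ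
  have hψc : Continuous ψ := by fun_prop
  have hψ0 : ∀ a, 0 ≤ ψ a := fun a => le_max_left _ _
  have hψ1 : ∀ a, ψ a ≤ 1 := fun a => max_le zero_le_one (min_le_left _ _)
  have hψlow : ∀ a, Φ a ≤ α / 2 → ψ a = 0 := by
    intro a ha
    refine max_eq_left ((min_le_right _ _).trans ?_)
    rw [sub_nonpos, div_le_iff₀ hα]; linarith
  have hψhigh : ∀ a, 3 * α / 4 ≤ Φ a → ψ a = 1 := by
    intro a ha
    have : (1 : ℝ) ≤ 4 * Φ a / α - 2 := by
      rw [le_sub_iff_add_le, le_div_iff₀ hα]; linarith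
    simp only [hψ, min_eq_left this]; simp
  -- Every deformation lowers the maximum along the path by `τ * κ` until it reaches `3 * α / 4`;
  -- the path is then cut again at the sphere.
  have main : ∀ n : ℕ, ∃ γ : ℝ → H, Continuous γ ∧ γ 0 = 0 ∧ ‖γ 1‖ = R ∧
      ∀ t ∈ Icc (0 : ℝ) 1, ‖γ t‖ ≤ R ∧ Φ (γ t) ≤ max (3 * α / 4) (β - n * (τ * κ)) := by
    intro n
    induction n with
    | zero =>
      obtain ⟨γ, h1, h2, h3, h4⟩ := trunc β hpath
      exact ⟨γ, h1, h2, h3, fun t ht => ⟨(h4 t ht).1, by simpa using Or.inr (h4 t ht).2⟩⟩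
    | succ n ih =>
      obtain ⟨γ, hγ, hγ0, hγ1, hγs⟩ := ih
      have hn0 : 0 ≤ (n : ℝ) * (τ * κ) := by positivity
      have hτκ : 0 < τ * κ := by positivity
      have hβ : ∀ t ∈ Icc (0 : ℝ) 1, Φ (γ t) ≤ β := by
        intro t ht
        have hb : 3 * α / 4 ≤ β := by
          obtain ⟨γ', g1, g2, g3, g4⟩ := trunc β hpath
          obtain ⟨t', ht', g5⟩ := hring γ' g1 g2 g3
          linarith [(g4 t' ht').2]
        exact (hγs t ht).2.trans (max_le hb (by linarith))
      refine trunc _ ⟨fun t => γ t - (τ * ψ (γ t)) • X (γ t), by fun_prop, ?_, ?_, ?_⟩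
      · simp only [hγ0]
        rw [hψlow 0 (by linarith)]; simp
      -- Since `⟪X, γ 1⟫ ≤ 0`, moving the endpoint along `-X` cannot decrease its norm, so the
      -- deformed path still reaches the sphere.
      · have h1 := hrad (γ 1) hγ1 (hβ 1 ⟨zero_le_one, le_rfl⟩)
        refine le_of_sq_le_sq ?_ (norm_nonneg _) |>.trans' hγ1.ge
        rw [norm_sub_sq_real, inner_smul_right, real_inner_comm]
        have h2 : 0 ≤ τ * ψ (γ 1) := mul_nonneg hτ.le (hψ0 _)
        nlinarith [sq_nonneg ‖(τ * ψ (γ 1)) • X (γ 1)‖]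
      · intro t ht
        have hs := (hγs t ht).2
        beta_reduce
        rcases lt_or_ge (Φ (γ t)) (α / 2) with hlow | hmid
        · rw [hψlow _ hlow.le]
          simp only [mul_zero, zero_smul, sub_zero]
          exact le_max_of_le_left (by linarith)
        · have hmem : γ t ∈ K := ⟨by simpa using (hγs t ht).1, hmid, hβ t ht⟩
          have hstep := hdesc (γ t) hmem (τ * ψ (γ t))
            ⟨mul_nonneg hτ.le (hψ0 _), mul_le_of_le_one_right hτ.le (hψ1 _)⟩
          rcases lt_or_ge (Φ (γ t)) (3 * α / 4) with h3 | h3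
          · refine le_max_of_le_left ?_
            have : 0 ≤ τ * ψ (γ t) * κ := mul_nonneg (mul_nonneg hτ.le (hψ0 _)) hκ.le
            linarith
          · rw [hψhigh _ h3] at hstep ⊢
            rcases le_max_iff.1 hs with h4 | h4
            · refine le_max_of_le_left ?_
              nlinarith
            · refine le_max_of_le_right ?_
              push_cast
              nlinarith
  -- After this many steps the whole path lies below `α` and misses the barrier.
  obtain ⟨n, hn⟩ := exists_nat_gt (β / (τ * κ))
  obtain ⟨γ, h1, h2, h3, h4⟩ := main n
  obtain ⟨t, ht, h5⟩ := hring γ h1 h2 h3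
  have h6 := (h4 t ht).2
  have hτκ : 0 < τ * κ := by positivity
  rw [div_lt_iff₀ hτκ] at hn
  have : max (3 * α / 4) (β - n * (τ * κ)) < α := max_lt (by linarith) (by linarith)
  linarith

end MountainPass

/-! ### Fatou's lemma and Vitali convergence for Bochner integrals. -/

section Vitali

variable {X : Type*} [MeasurableSpace X] {μ : Measure X}

/-- Fatou's lemma. The bound is required only eventually, so `C` may be any number above the lower
limit of the integrals. -/
lemma integrable_of_tendsto_of_integral_le {h : ℕ → X → ℝ} {h₀ : X → ℝ}
    (hint : ∀ n, Integrable (h n) μ) (hpos : ∀ n, 0 ≤ᵐ[μ] h n)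
    (hlim : ∀ᵐ x ∂μ, Tendsto (fun n => h n x) atTop (𝓝 (h₀ x))) {C : ℝ}
    (hC : ∀ᶠ n in atTop, ∫ x, h n x ∂μ ≤ C) : Integrable h₀ μ ∧ ∫ x, h₀ x ∂μ ≤ C := by
  have hmeas : AEStronglyMeasurable h₀ μ :=
    aestronglyMeasurable_of_tendsto_ae atTop (fun n => (hint n).1) hlim
  have hpos0 : 0 ≤ᵐ[μ] h₀ := by
    filter_upwards [hlim, ae_all_iff.2 hpos] with x hx hx2
    exact ge_of_tendsto' hx hx2
  have hC0 : 0 ≤ C := by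
    obtain ⟨n, hn⟩ := hC.exists
    exact (integral_nonneg_of_ae (hpos n)).trans hn
  have hl : ∫⁻ x, ENNReal.ofReal (h₀ x) ∂μ ≤ ENNReal.ofReal C := by
    calc ∫⁻ x, ENNReal.ofReal (h₀ x) ∂μ
        = ∫⁻ x, liminf (fun n => ENNReal.ofReal (h n x)) atTop ∂μ := by
          refine lintegral_congr_ae ?_
          filter_upwards [hlim] with x hx
          exact ((ENNReal.continuous_ofReal.tendsto _).comp hx).liminf_eq.symm
      _ ≤ liminf (fun n => ∫⁻ x, ENNReal.ofReal (h n x) ∂μ) atTop :=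
          lintegral_liminf_le' fun n => (hint n).1.aemeasurable.ennreal_ofReal
      _ ≤ ENNReal.ofReal C := by
          refine liminf_le_of_frequently_le' (hC.frequently.mono fun n hn => ?_)
          rw [← ofReal_integral_eq_lintegral_ofReal (hint n) (hpos n)]
          exact ENNReal.ofReal_le_ofReal hn
  have hi : Integrable h₀ μ := by
    refine ⟨hmeas, ?_⟩
    rw [hasFiniteIntegral_iff_ofReal hpos0]
    exact hl.trans_lt ENNReal.ofReal_lt_top
  refine ⟨hi, ?_⟩
  rw [← ofReal_integral_eq_lintegral_ofReal hi hpos0] at hl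
  exact (ENNReal.ofReal_le_ofReal_iff hC0).1 hl

lemma integral_abs_sub_tendsto_imp {g : ℕ → X → ℝ} {g₀ : X → ℝ} (hg : ∀ n, Integrable (g n) μ)
    (hg₀ : Integrable g₀ μ) (h : Tendsto (fun n => ∫ x, |g n x - g₀ x| ∂μ) atTop (𝓝 0)) :
    Tendsto (fun n => ∫ x, g n x ∂μ) atTop (𝓝 (∫ x, g₀ x ∂μ)) := by
  rw [tendsto_iff_norm_sub_tendsto_zero]
  refine squeeze_zero (fun _ => norm_nonneg _) (fun n => ?_) h
  rw [← integral_sub (hg n) hg₀]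
  exact norm_integral_le_integral_norm _

/-- A sequence that is bounded in `L²` over a finite measure and converges almost everywhere
converges in `L¹`. -/
lemma tendsto_integral_of_sq_bounded [IsFiniteMeasure μ] {g : ℕ → X → ℝ} {g₀ : X → ℝ}
    (hg : ∀ n, AEStronglyMeasurable (g n) μ)
    (hlim : ∀ᵐ x ∂μ, Tendsto (fun n => g n x) atTop (𝓝 (g₀ x)))
    {C : ℝ} (hint : ∀ n, Integrable (fun x => g n x ^ 2) μ) (hC : ∀ n, ∫ x, g n x ^ 2 ∂μ ≤ C) :
    Integrable g₀ μ ∧ Tendsto (fun n => ∫ x, |g n x - g₀ x| ∂μ) atTop (𝓝 0) ∧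
      Tendsto (fun n => ∫ x, g n x ∂μ) atTop (𝓝 (∫ x, g₀ x ∂μ)) := by
  have hmeas : AEStronglyMeasurable g₀ μ := aestronglyMeasurable_of_tendsto_ae atTop hg hlim
  obtain ⟨hsq, hsqC⟩ := integrable_of_tendsto_of_integral_le (h := fun n x => g n x ^ 2)
    (h₀ := fun x => g₀ x ^ 2) hint (fun n => ae_of_all _ fun x => sq_nonneg _)
    (by filter_upwards [hlim] with x hx using hx.pow 2) (Eventually.of_forall hC)
  have hL2 : ∀ {k : X → ℝ}, AEStronglyMeasurable k μ → Integrable (fun x => k x ^ 2) μ →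
      Integrable k μ := fun hk hk2 =>
    ((memLp_two_iff_integrable_sq hk).2 hk2).integrable one_le_two
  have hgi : ∀ n, Integrable (g n) μ := fun n => hL2 (hg n) (hint n)
  have hg0i : Integrable g₀ μ := hL2 hmeas hsq
  have hdsq : ∀ n, Integrable (fun x => (g n x - g₀ x) ^ 2) μ := fun n =>
    (((memLp_two_iff_integrable_sq (hg n)).2 (hint n)).sub
      ((memLp_two_iff_integrable_sq hmeas).2 hsq)).integrable_sq
  have hdsqC : ∀ n, ∫ x, (g n x - g₀ x) ^ 2 ∂μ ≤ 4 * C := by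
    intro n
    calc ∫ x, (g n x - g₀ x) ^ 2 ∂μ ≤ ∫ x, (2 * g n x ^ 2 + 2 * g₀ x ^ 2) ∂μ := by
          refine integral_mono (hdsq n) (((hint n).const_mul 2).add (hsq.const_mul 2)) fun x => ?_
          simp only
          nlinarith [sq_nonneg (g n x + g₀ x)]
      _ = 2 * ∫ x, g n x ^ 2 ∂μ + 2 * ∫ x, g₀ x ^ 2 ∂μ := by
          rw [integral_add ((hint n).const_mul 2) (hsq.const_mul 2), integral_const_mul,
            integral_const_mul]
      _ ≤ 4 * C := by linarith [hC n]
  have hL1 : Tendsto (fun n => ∫ x, |g n x - g₀ x| ∂μ) atTop (𝓝 0) := by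
    have hC0 : 0 ≤ C := (integral_nonneg fun x => sq_nonneg (g 0 x)).trans (hC 0)
    rw [Metric.tendsto_atTop]
    intro ε hε
    -- The difference `d` is split by `|d| ≤ min |d| K + d ^ 2 / K`. The first part tends to zero by
    -- dominated convergence; the second has integral at most `4 * C / K < ε / 2`.
    set K : ℝ := 8 * (C + 1) / ε with hK
    have hKpos : 0 < K := by positivity
    have hmin : Tendsto (fun n => ∫ x, min |g n x - g₀ x| K ∂μ) atTop (𝓝 (∫ _, (0 : ℝ) ∂μ)) := by
      refine tendsto_integral_of_dominated_convergence (fun _ => K)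
        (fun n => ((hg n).sub hmeas).norm.inf aestronglyMeasurable_const) (integrable_const K)
        (fun n => ae_of_all _ fun x => ?_) ?_
      · rw [Real.norm_of_nonneg (le_min (abs_nonneg _) hKpos.le)]
        exact min_le_right _ _
      · filter_upwards [hlim] with x hx
        have h1 : Tendsto (fun n => |g n x - g₀ x|) atTop (𝓝 0) := by
          simpa using (hx.sub_const (g₀ x)).abs
        simpa [hKpos.le] using h1.min (tendsto_const_nhds (x := K))
    simp only [integral_zero] at hmin
    obtain ⟨n₀, hn₀⟩ := (Metric.tendsto_atTop.1 hmin) (ε / 2) (half_pos hε)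
    refine ⟨n₀, fun n hn => ?_⟩
    have h1 := hn₀ n hn
    rw [Real.dist_0_eq_abs] at h1 ⊢
    rw [abs_of_nonneg (integral_nonneg fun x => abs_nonneg _)]
    have hmi : Integrable (fun x => min |g n x - g₀ x| K) μ := by
      refine Integrable.mono' (integrable_const K)
        (((hg n).sub hmeas).norm.inf aestronglyMeasurable_const) (ae_of_all _ fun x => ?_)
      rw [Real.norm_of_nonneg (le_min (abs_nonneg _) hKpos.le)]
      exact min_le_right _ _
    have h2 : ∫ x, |g n x - g₀ x| ∂μ
        ≤ ∫ x, (min |g n x - g₀ x| K + K⁻¹ * (g n x - g₀ x) ^ 2) ∂μ := by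
      refine integral_mono ((hgi n).sub hg0i).abs (hmi.add ((hdsq n).const_mul _)) fun x => ?_
      simp only
      rcases le_total |g n x - g₀ x| K with h | h
      · rw [min_eq_left h]
        have : 0 ≤ K⁻¹ * (g n x - g₀ x) ^ 2 := by positivity
        linarith
      · rw [min_eq_right h, ← sq_abs, inv_mul_eq_div, pow_two]
        have : |g n x - g₀ x| ≤ |g n x - g₀ x| * |g n x - g₀ x| / K := by
          rw [le_div_iff₀ hKpos]
          exact mul_le_mul_of_nonneg_left h (abs_nonneg _)
        linarith
    rw [integral_add hmi ((hdsq n).const_mul _), integral_const_mul] at h2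
    have h3 : K⁻¹ * ∫ x, (g n x - g₀ x) ^ 2 ∂μ ≤ K⁻¹ * (4 * C) := by
      have := hdsqC n
      gcongr
    have h4 : K⁻¹ * (4 * C) < ε / 2 := by
      rw [inv_mul_eq_div, div_lt_iff₀ hKpos, hK]
      field_simp
      linarith
    linarith [le_abs_self (∫ x, min |g n x - g₀ x| K ∂μ)]
  exact ⟨hg0i, hL1, integral_abs_sub_tendsto_imp hgi hg0i hL1⟩

end Vitali

/-! ### Calculus of test functions. -/

section TestFunctions

variable {N : ℕ} {Ω : Set (EuclideanSpace ℝ (Fin N))} {φ ψ : EuclideanSpace ℝ (Fin N) → ℝ}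

lemma norm_gradient_eq (φ : EuclideanSpace ℝ (Fin N) → ℝ) (x : EuclideanSpace ℝ (Fin N)) :
    ‖gradient φ x‖ = ‖fderiv ℝ φ x‖ := by
  simp [gradient]

namespace IsTestFunction

lemma differentiable (h : IsTestFunction Ω φ) : Differentiable ℝ φ :=
  h.contDiff.differentiable (by simp)

lemma continuous (h : IsTestFunction Ω φ) : Continuous φ := h.contDiff.continuous

lemma continuous_gradient (h : IsTestFunction Ω φ) : Continuous (gradient φ) :=
  (InnerProductSpace.toDual ℝ _).symm.continuous.comp (h.contDiff.continuous_fderiv (by simp))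

lemma hasCompactSupport_gradient (h : IsTestFunction Ω φ) : HasCompactSupport (gradient φ) :=
  (h.hasCompactSupport.fderiv ℝ).comp_left (g := (InnerProductSpace.toDual ℝ _).symm) (map_zero _)

lemma eq_zero_of_notMem (h : IsTestFunction Ω φ) {x : EuclideanSpace ℝ (Fin N)} (hx : x ∉ Ω) :
    φ x = 0 :=
  image_eq_zero_of_notMem_tsupport fun h' => hx (h.tsupport_subset h')

lemma gradient_eq_zero_of_notMem_tsupport {x : EuclideanSpace ℝ (Fin N)}
    (hx : x ∉ tsupport φ) : gradient φ x = 0 := by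
  have : fderiv ℝ φ x = 0 :=
    image_eq_zero_of_notMem_tsupport fun h' => hx (tsupport_fderiv_subset ℝ h')
  simp [gradient, this]

lemma gradient_eq_zero_of_notMem (h : IsTestFunction Ω φ) {x : EuclideanSpace ℝ (Fin N)}
    (hx : x ∉ Ω) : gradient φ x = 0 :=
  gradient_eq_zero_of_notMem_tsupport fun h' => hx (h.tsupport_subset h')

lemma zero : IsTestFunction Ω (0 : EuclideanSpace ℝ (Fin N) → ℝ) :=
  ⟨contDiff_const, HasCompactSupport.zero, by simp [tsupport]⟩

lemma add (h : IsTestFunction Ω φ) (h' : IsTestFunction Ω ψ) : IsTestFunction Ω (φ + ψ) :=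
  ⟨h.contDiff.add h'.contDiff, h.hasCompactSupport.add h'.hasCompactSupport,
    (tsupport_add φ ψ).trans (union_subset h.tsupport_subset h'.tsupport_subset)⟩

lemma smul (h : IsTestFunction Ω φ) (c : ℝ) : IsTestFunction Ω (c • φ) :=
  ⟨h.contDiff.const_smul c, h.hasCompactSupport.smul_left (f := fun _ => c),
    (tsupport_smul_subset_right (fun _ => c) φ).trans h.tsupport_subset⟩

lemma sub (h : IsTestFunction Ω φ) (h' : IsTestFunction Ω ψ) : IsTestFunction Ω (φ - ψ) := by
  have := h.add (h'.smul (-1))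
  simpa [sub_eq_add_neg] using this

lemma comp_left (h : IsTestFunction Ω φ) {g : ℝ → ℝ} (hg : ContDiff ℝ ∞ g) (hg0 : g 0 = 0) :
    IsTestFunction Ω (fun x => g (φ x)) :=
  ⟨hg.comp h.contDiff, h.hasCompactSupport.comp_left hg0,
    (closure_mono (Function.support_comp_subset hg0 φ)).trans h.tsupport_subset⟩

lemma gradient_comp_left (h : IsTestFunction Ω φ) {g : ℝ → ℝ} (hg : Differentiable ℝ g)
    (x : EuclideanSpace ℝ (Fin N)) :
    gradient (fun x => g (φ x)) x = deriv g (φ x) • gradient φ x := by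
  have h1 := ((hg (φ x)).hasDerivAt.comp_hasFDerivAt x (h.differentiable x).hasFDerivAt).fderiv
  change fderiv ℝ (fun x => g (φ x)) x = _ at h1
  simp [gradient, h1]

lemma gradient_add (h : IsTestFunction Ω φ) (h' : IsTestFunction Ω ψ)
    (x : EuclideanSpace ℝ (Fin N)) : gradient (φ + ψ) x = gradient φ x + gradient ψ x := by
  simp [gradient, fderiv_add (h.differentiable x) (h'.differentiable x)]

lemma gradient_smul (h : IsTestFunction Ω φ) (c : ℝ)
    (x : EuclideanSpace ℝ (Fin N)) : gradient (c • φ) x = c • gradient φ x := by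
  simp [gradient, fderiv_const_smul (h.differentiable x)]

lemma gradient_sub (h : IsTestFunction Ω φ) (h' : IsTestFunction Ω ψ)
    (x : EuclideanSpace ℝ (Fin N)) : gradient (φ - ψ) x = gradient φ x - gradient ψ x := by
  simp [gradient, fderiv_sub (h.differentiable x) (h'.differentiable x)]

lemma memLp (h : IsTestFunction Ω φ) (p : ℝ≥0∞) (s : Set (EuclideanSpace ℝ (Fin N))) :
    MemLp φ p (volume.restrict s) :=
  (h.continuous.memLp_of_hasCompactSupport h.hasCompactSupport).restrict s

lemma memLp_gradient (h : IsTestFunction Ω φ) (p : ℝ≥0∞) (s : Set (EuclideanSpace ℝ (Fin N))) :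
    MemLp (gradient φ) p (volume.restrict s) :=
  (h.continuous_gradient.memLp_of_hasCompactSupport h.hasCompactSupport_gradient).restrict s

lemma exists_bound (h : IsTestFunction Ω φ) : ∃ C, ∀ x, |φ x| ≤ C :=
  h.hasCompactSupport.exists_bound_of_continuous h.continuous

lemma exists_bound_gradient (h : IsTestFunction Ω φ) : ∃ C, ∀ x, ‖gradient φ x‖ ≤ C :=
  h.hasCompactSupport_gradient.exists_bound_of_continuous h.continuous_gradient

/-- Integration by parts for test functions. -/
lemma integral_smul_gradient (h : IsTestFunction Ω φ) (h' : IsTestFunction Ω ψ) :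
    ∫ x in Ω, φ x • gradient ψ x = -∫ x in Ω, ψ x • gradient φ x := by
  have e1 : ∀ {a b : EuclideanSpace ℝ (Fin N) → ℝ}, IsTestFunction Ω a → IsTestFunction Ω b →
      ∫ x in Ω, a x • gradient b x = ∫ x, a x • gradient b x := by
    intro a b ha hb
    refine setIntegral_eq_integral_of_forall_compl_eq_zero fun x hx => ?_
    rw [ha.eq_zero_of_notMem hx, zero_smul]
  have int : ∀ {a b : EuclideanSpace ℝ (Fin N) → ℝ}, IsTestFunction Ω a → IsTestFunction Ω b →
      Integrable (fun x => a x • gradient b x) volume := fun ha hb =>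
    (ha.continuous.smul hb.continuous_gradient).integrable_of_hasCompactSupport
      ha.hasCompactSupport.smul_right
  rw [e1 h h', e1 h' h]
  -- Pairing with a fixed vector reduces the vector identity to scalar integration by parts in one
  -- direction.
  refine ext_inner_left ℝ fun v => ?_
  rw [inner_neg_right, ← integral_inner (int h h'), ← integral_inner (int h' h)]
  have e2 : ∀ (a b : EuclideanSpace ℝ (Fin N) → ℝ) x,
      inner ℝ v (a x • gradient b x) = a x * fderiv ℝ b x v := by
    intro a b x
    rw [inner_smul_right, real_inner_comm, inner_gradient_left]
  simp only [e2]
  have int2 : ∀ {a b : EuclideanSpace ℝ (Fin N) → ℝ}, IsTestFunction Ω a → IsTestFunction Ω b →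
      Integrable (fun x => a x * fderiv ℝ b x v) volume := fun ha hb =>
    ((int ha hb).const_inner v).congr (ae_of_all _ fun x => e2 _ _ x)
  have := integral_mul_fderiv_eq_neg_fderiv_mul_of_integrable (μ := volume) (f := φ) (g := ψ)
    (v := v) ((int2 h' h).congr (ae_of_all _ fun x => mul_comm _ _)) (int2 h h')
    ((h.continuous.mul h'.continuous).integrable_of_hasCompactSupport
      h.hasCompactSupport.mul_right) (fun x _ => h.differentiable x) (fun x _ => h'.differentiable x)
  rw [this]
  simp only [mul_comm]

end IsTestFunction

end TestFunctions

/-! ### Closure properties of `W_0^{1,p}`. -/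

section Sobolev

variable {N : ℕ} {Ω : Set (EuclideanSpace ℝ (Fin N))}

/-- On a finite measure space convergence in `L^p` implies convergence in `L^1`; the integrands `h
n` inherit it through the Lipschitz bound. -/
lemma tendsto_integral_of_tendsto_eLpNorm {X F F' : Type*} [MeasurableSpace X] {μ : Measure X}
    [IsFiniteMeasure μ] [NormedAddCommGroup F] [NormedAddCommGroup F'] [NormedSpace ℝ F']
    {p : ℝ≥0∞} (hp : 1 ≤ p) {f : ℕ → X → F} {f₀ : X → F} {h : ℕ → X → F'} {h₀ : X → F'}
    (hf : ∀ n, MemLp (f n) p μ) (hf₀ : MemLp f₀ p μ)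
    (hlim : Tendsto (fun n => eLpNorm (fun x => f n x - f₀ x) p μ) atTop (𝓝 0))
    (hh : ∀ n, Integrable (h n) μ) (hh₀ : Integrable h₀ μ) {C : ℝ}
    (hle : ∀ n, ∀ᵐ x ∂μ, ‖h n x - h₀ x‖ ≤ C * ‖f n x - f₀ x‖) :
    Tendsto (fun n => ∫ x, h n x ∂μ) atTop (𝓝 (∫ x, h₀ x ∂μ)) := by
  have h1 : Tendsto (fun n => eLpNorm (fun x => f n x - f₀ x) 1 μ) atTop (𝓝 0) := by
    have hK : μ univ ^ (1 / (1 : ℝ≥0∞).toReal - 1 / p.toReal) ≠ ⊤ := by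
      refine ENNReal.rpow_ne_top_of_nonneg ?_ (measure_ne_top _ _)
      by_cases hpt : p = ⊤
      · simp [hpt]
      · have : 1 ≤ p.toReal := by
          rw [← ENNReal.toReal_one]; exact ENNReal.toReal_mono hpt hp
        simp only [ENNReal.toReal_one, div_one, sub_nonneg]
        exact div_le_one_of_le₀ this (by linarith)
    have := ENNReal.Tendsto.mul_const hlim (Or.inr hK)
    rw [zero_mul] at this
    exact tendsto_of_tendsto_of_tendsto_of_le_of_le tendsto_const_nhds this (fun _ => zero_le)
      fun n => eLpNorm_le_eLpNorm_mul_rpow_measure_univ hp ((hf n).sub hf₀).1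
  refine tendsto_integral_of_L1' h₀ hh₀.1 (Eventually.of_forall hh) ?_
  have h2 := ENNReal.Tendsto.const_mul h1 (a := ENNReal.ofReal C) (Or.inr ENNReal.ofReal_ne_top)
  rw [mul_zero] at h2
  refine tendsto_of_tendsto_of_tendsto_of_le_of_le tendsto_const_nhds h2 (fun _ => zero_le)
    fun n => eLpNorm_le_mul_eLpNorm_of_ae_le_mul (hle n) 1

variable {p : ℝ≥0∞}

lemma IsTestFunction.memSobolevOneZero {φ : EuclideanSpace ℝ (Fin N) → ℝ}
    (h : IsTestFunction Ω φ) : MemSobolevOneZero Ω p φ (gradient φ) where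
  memLp := h.memLp p Ω
  memLp_grad := h.memLp_gradient p Ω
  hasWeakGradient :=
    ⟨h.continuous.locallyIntegrable.locallyIntegrableOn _,
      h.continuous_gradient.locallyIntegrable.locallyIntegrableOn _,
      fun _ hψ => h.integral_smul_gradient hψ⟩
  exists_approx := ⟨fun _ => φ, fun _ => h, by simp, by simp⟩

/-- Limits of test functions in `W^{1,p}` belong to `W_0^{1,p}`. -/
lemma memSobolevOneZero_of_tendsto (hp : 1 ≤ p) (hΩ : volume Ω ≠ ⊤)
    {φ : ℕ → EuclideanSpace ℝ (Fin N) → ℝ} (hφ : ∀ n, IsTestFunction Ω (φ n))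
    {u : EuclideanSpace ℝ (Fin N) → ℝ} {G : EuclideanSpace ℝ (Fin N) → EuclideanSpace ℝ (Fin N)}
    (hu : MemLp u p (volume.restrict Ω)) (hG : MemLp G p (volume.restrict Ω))
    (h1 : Tendsto (fun n => eLpNorm (fun x => φ n x - u x) p (volume.restrict Ω)) atTop (𝓝 0))
    (h2 : Tendsto (fun n => eLpNorm (fun x => gradient (φ n) x - G x) p (volume.restrict Ω))
      atTop (𝓝 0)) : MemSobolevOneZero Ω p u G := by
  have : IsFiniteMeasure (volume.restrict Ω) := ⟨by simpa using hΩ.lt_top⟩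
  refine ⟨⟨hu, hG, ⟨?_, ?_, fun ψ hψ => ?_⟩⟩, φ, hφ, h1, h2⟩
  · exact IntegrableOn.locallyIntegrableOn (hu.integrable hp)
  · exact IntegrableOn.locallyIntegrableOn (hG.integrable hp)
  · obtain ⟨C, hC⟩ := hψ.exists_bound
    obtain ⟨C', hC'⟩ := hψ.exists_bound_gradient
    -- Both sides of the integration by parts formula are continuous in `L^p`, because `ψ` and its
    -- gradient are bounded.
    have t1 := tendsto_integral_of_tendsto_eLpNorm hp (fun n => (hφ n).memLp p Ω) hu h1
      (h := fun n x => φ n x • gradient ψ x) (h₀ := fun x => u x • gradient ψ x) (C := C')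
      (fun n => ((((hφ n).memLp 1 Ω).integrable le_rfl).smul_bdd C'
        (hψ.memLp_gradient 1 Ω).1 (ae_of_all _ hC')))
      ((hu.integrable hp).smul_bdd C' (hψ.memLp_gradient 1 Ω).1 (ae_of_all _ hC'))
      (fun n => ae_of_all _ fun x => by
        rw [← sub_smul, norm_smul, mul_comm]; gcongr; exact hC' x)
    have t2 := tendsto_integral_of_tendsto_eLpNorm hp (fun n => (hφ n).memLp_gradient p Ω) hG h2
      (h := fun n x => ψ x • gradient (φ n) x) (h₀ := fun x => ψ x • G x) (C := C)
      (fun n => ((((hφ n).memLp_gradient 1 Ω).integrable le_rfl).bdd_smul C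
        (hψ.memLp 1 Ω).1 (ae_of_all _ hC)))
      ((hG.integrable hp).bdd_smul C (hψ.memLp 1 Ω).1 (ae_of_all _ hC))
      (fun n => ae_of_all _ fun x => by
        rw [← smul_sub, norm_smul]; gcongr; exact hC x)
    refine tendsto_nhds_unique t1 ?_
    simp only [(hφ _).integral_smul_gradient hψ]
    exact t2.neg

namespace MemSobolevOneZero

variable {u v : EuclideanSpace ℝ (Fin N) → ℝ}
  {G V : EuclideanSpace ℝ (Fin N) → EuclideanSpace ℝ (Fin N)}

lemma exists_close (h : MemSobolevOneZero Ω p u G) {ε : ℝ≥0∞} (hε : 0 < ε) :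
    ∃ φ, IsTestFunction Ω φ ∧ eLpNorm (fun x => φ x - u x) p (volume.restrict Ω) < ε ∧
      eLpNorm (fun x => gradient φ x - G x) p (volume.restrict Ω) < ε := by
  obtain ⟨φ, hφ, h1, h2⟩ := h.exists_approx
  obtain ⟨n, hn1, hn2⟩ := ((h1.eventually_lt_const hε).and (h2.eventually_lt_const hε)).exists
  exact ⟨φ n, hφ n, hn1, hn2⟩

/-- `W_0^{1,p}` is closed. -/
lemma of_tendsto (hp : 1 ≤ p) (hΩ : volume Ω ≠ ⊤) {w : ℕ → EuclideanSpace ℝ (Fin N) → ℝ}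
    {W : ℕ → EuclideanSpace ℝ (Fin N) → EuclideanSpace ℝ (Fin N)}
    (hw : ∀ n, MemSobolevOneZero Ω p (w n) (W n))
    (hu : MemLp u p (volume.restrict Ω)) (hG : MemLp G p (volume.restrict Ω))
    (h1 : Tendsto (fun n => eLpNorm (fun x => w n x - u x) p (volume.restrict Ω)) atTop (𝓝 0))
    (h2 : Tendsto (fun n => eLpNorm (fun x => W n x - G x) p (volume.restrict Ω))
      atTop (𝓝 0)) : MemSobolevOneZero Ω p u G := by
  have hpos : ∀ n : ℕ, (0 : ℝ≥0∞) < ((n : ℝ≥0∞) + 1)⁻¹ := fun n => by simp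
  have hlim : Tendsto (fun n : ℕ => ((n : ℝ≥0∞) + 1)⁻¹) atTop (𝓝 0) := by
    have := (tendsto_add_atTop_iff_nat 1).2 ENNReal.tendsto_inv_nat_nhds_zero
    simpa using this
  -- A diagonal choice: the `n`-th test function is within `1 / (n + 1)` of `w n`.
  choose φ hφ hφ1 hφ2 using fun n => (hw n).exists_close (hpos n)
  refine memSobolevOneZero_of_tendsto hp hΩ hφ hu hG ?_ ?_
  · have := hlim.add h1
    rw [add_zero] at this
    refine tendsto_of_tendsto_of_tendsto_of_le_of_le tendsto_const_nhds this (fun _ => zero_le)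
      fun n => ?_
    have e : (fun x => φ n x - u x) = (fun x => φ n x - w n x) + fun x => w n x - u x := by
      ext x; simp
    rw [e]
    exact (eLpNorm_add_le (((hφ n).memLp p Ω).sub (hw n).memLp).1 ((hw n).memLp.sub hu).1 hp).trans
      (add_le_add (hφ1 n).le le_rfl)
  · have := hlim.add h2
    rw [add_zero] at this
    refine tendsto_of_tendsto_of_tendsto_of_le_of_le tendsto_const_nhds this (fun _ => zero_le)
      fun n => ?_
    have e : (fun x => gradient (φ n) x - G x)
        = (fun x => gradient (φ n) x - W n x) + fun x => W n x - G x := by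
      ext x; simp
    rw [e]
    exact (eLpNorm_add_le (((hφ n).memLp_gradient p Ω).sub (hw n).memLp_grad).1
      ((hw n).memLp_grad.sub hG).1 hp).trans (add_le_add (hφ2 n).le le_rfl)

lemma smul (hp : 1 ≤ p) (hΩ : volume Ω ≠ ⊤) (h : MemSobolevOneZero Ω p u G) (c : ℝ) :
    MemSobolevOneZero Ω p (fun x => c * u x) (fun x => c • G x) := by
  obtain ⟨φ, hφ, h1, h2⟩ := h.exists_approx
  refine memSobolevOneZero_of_tendsto hp hΩ (fun n => (hφ n).smul c) (h.memLp.const_mul c)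
    (h.memLp_grad.const_smul c) ?_ ?_
  · have := ENNReal.Tendsto.const_mul h1 (a := ‖c‖ₑ) (Or.inr enorm_ne_top)
    rw [mul_zero] at this
    refine this.congr fun n => ?_
    rw [← eLpNorm_const_smul]
    congr 1; ext x; simp [mul_sub]
  · have := ENNReal.Tendsto.const_mul h2 (a := ‖c‖ₑ) (Or.inr enorm_ne_top)
    rw [mul_zero] at this
    refine this.congr fun n => ?_
    rw [← eLpNorm_const_smul]
    congr 1; ext1 x; simp [(hφ n).gradient_smul, smul_sub]

lemma sub (hp : 1 ≤ p) (hΩ : volume Ω ≠ ⊤) (h : MemSobolevOneZero Ω p u G)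
    (h' : MemSobolevOneZero Ω p v V) :
    MemSobolevOneZero Ω p (fun x => u x - v x) (fun x => G x - V x) := by
  obtain ⟨φ, hφ, h1, h2⟩ := h.exists_approx
  obtain ⟨ψ, hψ, k1, k2⟩ := h'.exists_approx
  refine memSobolevOneZero_of_tendsto hp hΩ (fun n => (hφ n).sub (hψ n)) (h.memLp.sub h'.memLp)
    (h.memLp_grad.sub h'.memLp_grad) ?_ ?_
  · have := h1.add k1
    rw [add_zero] at this
    refine tendsto_of_tendsto_of_tendsto_of_le_of_le tendsto_const_nhds this (fun _ => zero_le)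
      fun n => ?_
    refine le_trans (le_of_eq ?_) (eLpNorm_sub_le (((hφ n).memLp p Ω).sub h.memLp).1
      (((hψ n).memLp p Ω).sub h'.memLp).1 hp)
    congr 1; ext x; simp; ring
  · have := h2.add k2
    rw [add_zero] at this
    refine tendsto_of_tendsto_of_tendsto_of_le_of_le tendsto_const_nhds this (fun _ => zero_le)
      fun n => ?_
    refine le_trans (le_of_eq ?_) (eLpNorm_sub_le (((hφ n).memLp_gradient p Ω).sub h.memLp_grad).1
      (((hψ n).memLp_gradient p Ω).sub h'.memLp_grad).1 hp)
    congr 1; ext1 x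
    simp only [(hφ n).gradient_sub (hψ n), Pi.sub_apply]
    abel

end MemSobolevOneZero

end Sobolev

/-! ### `L^n` convergence expressed by integrals of `n`-th powers. -/

section PowerIntegrals

variable {X F : Type*} [MeasurableSpace X] {μ : Measure X} [NormedAddCommGroup F] {n : ℕ}

lemma eLpNorm_natCast_eq (hn : n ≠ 0) {f : X → F} (hf : MemLp f n μ) :
    eLpNorm f n μ = ENNReal.ofReal ((∫ x, ‖f x‖ ^ n ∂μ) ^ ((n : ℝ)⁻¹)) := by
  rw [hf.eLpNorm_eq_integral_rpow_norm (by exact_mod_cast hn) (by simp)]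
  simp

lemma tendsto_eLpNorm_natCast_iff (hn : n ≠ 0) {ι : Type*} {l : Filter ι} {f : ι → X → F}
    (hf : ∀ i, MemLp (f i) n μ) :
    Tendsto (fun i => eLpNorm (f i) n μ) l (𝓝 0) ↔
      Tendsto (fun i => ∫ x, ‖f i x‖ ^ n ∂μ) l (𝓝 0) := by
  have hn' : (0 : ℝ) < n := by exact_mod_cast Nat.pos_of_ne_zero hn
  have h0 : ∀ i, 0 ≤ ∫ x, ‖f i x‖ ^ n ∂μ := fun i => integral_nonneg fun x => by positivity
  simp only [eLpNorm_natCast_eq hn (hf _)]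
  constructor
  · intro h
    have h1 := ((ENNReal.tendsto_toReal ENNReal.zero_ne_top).comp h).pow n
    simp only [ENNReal.toReal_zero, zero_pow hn] at h1
    refine h1.congr fun i => ?_
    simp only [Function.comp_apply]
    rw [ENNReal.toReal_ofReal (Real.rpow_nonneg (h0 i) _), Real.rpow_inv_natCast_pow (h0 i) hn]
  · intro h
    have h1 := ENNReal.tendsto_ofReal (h.rpow_const (p := (n : ℝ)⁻¹) (Or.inr (by positivity)))
    rwa [Real.zero_rpow (by positivity), ENNReal.ofReal_zero] at h1

/-- Completeness of `L^n`. The Cauchy condition concerns only pairs `i ≤ j`, because a Galerkin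
equation may be tested only with elements of earlier spaces. -/
lemma exists_limit_of_cauchy_integral_pow [CompleteSpace F] (hn : 1 ≤ n) {f : ℕ → X → F}
    (hf : ∀ i, MemLp (f i) n μ)
    (hc : ∀ ε > 0, ∃ k₀, ∀ i j, k₀ ≤ i → i ≤ j → ∫ x, ‖f i x - f j x‖ ^ n ∂μ < ε) :
    ∃ f₀ : X → F, MemLp f₀ n μ ∧ Tendsto (fun i => ∫ x, ‖f i x - f₀ x‖ ^ n ∂μ) atTop (𝓝 0) := by
  have : Fact ((1 : ℝ≥0∞) ≤ n) := ⟨by exact_mod_cast hn⟩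
  have hn0 : n ≠ 0 := by omega
  have hd : ∀ i j, dist ((hf i).toLp (f i)) ((hf j).toLp (f j))
      = (∫ x, ‖f i x - f j x‖ ^ n ∂μ) ^ ((n : ℝ)⁻¹) := by
    intro i j
    rw [dist_edist, Lp.edist_toLp_toLp, eLpNorm_natCast_eq hn0 ((hf i).sub (hf j)),
      ENNReal.toReal_ofReal (by positivity)]
    simp
  have hcs : CauchySeq fun i => (hf i).toLp (f i) := by
    rw [Metric.cauchySeq_iff']
    intro ε hε
    obtain ⟨k₀, hk₀⟩ := hc (ε ^ n) (by positivity)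
    refine ⟨k₀, fun j hj => ?_⟩
    rw [dist_comm, hd]
    have h0 : 0 ≤ ∫ x, ‖f k₀ x - f j x‖ ^ n ∂μ := integral_nonneg fun x => by positivity
    refine lt_of_pow_lt_pow_left₀ n hε.le ?_
    rw [Real.rpow_inv_natCast_pow h0 hn0]
    exact hk₀ k₀ j le_rfl hj
  obtain ⟨g, hg⟩ := cauchySeq_tendsto_of_complete hcs
  refine ⟨g, Lp.memLp g, ?_⟩
  have h1 := (Lp.tendsto_Lp_iff_tendsto_eLpNorm' _ g).1 hg
  refine (tendsto_eLpNorm_natCast_iff hn0 (fun i => (hf i).sub (Lp.memLp g))).1 ?_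
  refine h1.congr fun i => eLpNorm_congr_ae ?_
  filter_upwards [(hf i).coeFn_toLp] with x hx
  simp [hx]

lemma tendsto_integral_norm_pow (hn : 1 ≤ n) {f : ℕ → X → F} {f₀ : X → F}
    (hf : ∀ i, MemLp (f i) n μ) (hf₀ : MemLp f₀ n μ)
    (h : Tendsto (fun i => ∫ x, ‖f i x - f₀ x‖ ^ n ∂μ) atTop (𝓝 0)) :
    Tendsto (fun i => ∫ x, ‖f i x‖ ^ n ∂μ) atTop (𝓝 (∫ x, ‖f₀ x‖ ^ n ∂μ)) := by
  have : Fact ((1 : ℝ≥0∞) ≤ n) := ⟨by exact_mod_cast hn⟩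
  have hn0 : n ≠ 0 := by omega
  have h1 : Tendsto (fun i => (hf i).toLp (f i)) atTop (𝓝 (hf₀.toLp f₀)) := by
    rw [Lp.tendsto_Lp_iff_tendsto_eLpNorm'' _ hf]
    exact (tendsto_eLpNorm_natCast_iff hn0 (fun i => (hf i).sub hf₀)).2 h
  have e : ∀ {g : X → F} (hg : MemLp g n μ), ‖hg.toLp g‖ ^ n = ∫ x, ‖g x‖ ^ n ∂μ := by
    intro g hg
    have h0 : 0 ≤ ∫ x, ‖g x‖ ^ n ∂μ := integral_nonneg fun x => by positivity
    rw [Lp.norm_toLp, eLpNorm_natCast_eq hn0 hg, ENNReal.toReal_ofReal (by positivity),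
      Real.rpow_inv_natCast_pow h0 hn0]
  have h2 := (h1.norm).pow n
  simpa only [e] using h2

/-- A sequence converging in `L^n` has an almost everywhere converging subsequence. -/
lemma exists_subseq_tendsto_ae_of_integral_pow (hn : n ≠ 0) {f : ℕ → X → F} {f₀ : X → F}
    (hf : ∀ i, MemLp (f i) n μ) (hf₀ : MemLp f₀ n μ)
    (h : Tendsto (fun i => ∫ x, ‖f i x - f₀ x‖ ^ n ∂μ) atTop (𝓝 0)) :
    ∃ ns : ℕ → ℕ, StrictMono ns ∧
      ∀ᵐ x ∂μ, Tendsto (fun i => f (ns i) x) atTop (𝓝 (f₀ x)) :=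
  (tendstoInMeasure_of_tendsto_eLpNorm (by exact_mod_cast hn) (fun i => (hf i).1) hf₀.1
    ((tendsto_eLpNorm_natCast_iff hn (fun i => (hf i).sub hf₀)).2 h)).exists_seq_tendsto_ae

end PowerIntegrals

/-! ### Young's inequality and continuity of the `n`-Laplace flux. -/

section Young

variable {H : Type*} [NormedAddCommGroup H] [InnerProductSpace ℝ H] {n : ℕ}

/-- Replacing `p` by `η * p` and `q` by `q / η ^ (n - 1)` leaves the product unchanged and puts the
small factor `η ^ n ≤ δ` in front of `p ^ n`. -/
lemma exists_pow_pred_mul_le (hn : 1 ≤ n) {δ : ℝ} (hδ : 0 < δ) :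
    ∃ K : ℝ, 0 ≤ K ∧ ∀ p q : ℝ, 0 ≤ p → 0 ≤ q → p ^ (n - 1) * q ≤ δ * p ^ n + K * q ^ n := by
  obtain ⟨η, hη0, hη1, hηδ⟩ : ∃ η : ℝ, 0 < η ∧ η ≤ 1 ∧ η ≤ δ :=
    ⟨min 1 δ, lt_min one_pos hδ, min_le_left _ _, min_le_right _ _⟩
  refine ⟨(η ^ (n - 1))⁻¹ ^ n, by positivity, fun p q hp hq => ?_⟩
  have h := mul_pow_pred_mul_le hn (p := η * p) (q := (η ^ (n - 1))⁻¹ * q) (by positivity)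
    (by positivity)
  have e : (η * p) ^ (n - 1) * ((η ^ (n - 1))⁻¹ * q) = p ^ (n - 1) * q := by
    rw [mul_pow]; field_simp
  rw [e, mul_pow, mul_pow] at h
  have hn' : (1 : ℝ) ≤ n := by exact_mod_cast hn
  have h1 : η ^ n ≤ δ := by
    calc η ^ n ≤ η ^ 1 := pow_le_pow_of_le_one hη0.le hη1 hn
      _ ≤ δ := by simpa using hηδ
  have h2 : η ^ n * p ^ n ≤ δ * p ^ n := by gcongr
  have h3 : 0 ≤ (η ^ (n - 1))⁻¹ ^ n * q ^ n := by positivity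
  have h4 : 0 ≤ δ * p ^ n := by positivity
  have h5 : (n : ℝ) * (p ^ (n - 1) * q) ≤ n * (δ * p ^ n + (η ^ (n - 1))⁻¹ ^ n * q ^ n) := by
    nlinarith
  exact le_of_mul_le_mul_left h5 (by linarith)

/-- The difference is `‖a‖ ^ k • (a - b)` plus `(‖a‖ ^ k - ‖b‖ ^ k) • b`, with `k = n - 2`; the
second term is estimated by the Lipschitz bound for scalar powers. -/
lemma norm_pow_smul_sub_le (hn : 2 ≤ n) (a b : H) :
    ‖‖a‖ ^ (n - 2) • a - ‖b‖ ^ (n - 2) • b‖ ≤ (n - 1) * ‖a - b‖ * max ‖a‖ ‖b‖ ^ (n - 2) := by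
  obtain ⟨k, rfl⟩ : ∃ k, n = k + 2 := ⟨n - 2, by omega⟩
  simp only [Nat.add_sub_cancel]
  set M := max ‖a‖ ‖b‖ with hM
  have hM0 : 0 ≤ M := (norm_nonneg a).trans (le_max_left _ _)
  have e : ‖a‖ ^ k • a - ‖b‖ ^ k • b = ‖a‖ ^ k • (a - b) + (‖a‖ ^ k - ‖b‖ ^ k) • b := by module
  have h1 : ‖‖a‖ ^ k • (a - b)‖ ≤ ‖a - b‖ * M ^ k := by
    rw [norm_smul, norm_pow, norm_norm, mul_comm]
    gcongr
    exact le_max_left _ _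
  have h2 : ‖(‖a‖ ^ k - ‖b‖ ^ k) • b‖ ≤ k * ‖a - b‖ * M ^ k := by
    rw [norm_smul, Real.norm_eq_abs]
    rcases Nat.eq_zero_or_pos k with rfl | hk
    · simp
    have h3 := abs_pow_sub_pow_le ‖a‖ ‖b‖ k
    rw [abs_norm, abs_norm, ← hM] at h3
    have h4 := abs_norm_sub_norm_le a b
    calc |‖a‖ ^ k - ‖b‖ ^ k| * ‖b‖ ≤ (‖a - b‖ * k * M ^ (k - 1)) * M := by
          gcongr
          · exact h3.trans (by gcongr)
          · exact le_max_right _ _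
      _ = k * ‖a - b‖ * M ^ k := by
          rw [mul_assoc, ← pow_succ, Nat.sub_add_cancel hk]; ring
  rw [e]
  refine (norm_add_le _ _).trans ((add_le_add h1 h2).trans (le_of_eq ?_))
  push_cast; ring

/-- A quantitative form of the continuity of `a ↦ ‖a‖ ^ (n - 2) • a`. -/
lemma exists_abs_inner_sub_le (hn : 2 ≤ n) {δ : ℝ} (hδ : 0 < δ) :
    ∃ K : ℝ, 0 ≤ K ∧ ∀ a b v : H,
      |‖a‖ ^ (n - 2) * inner ℝ a v - ‖b‖ ^ (n - 2) * inner ℝ b v| ≤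
        δ * (‖a‖ ^ n + ‖b‖ ^ n + ‖v‖ ^ n) + K * ‖a - b‖ ^ n := by
  have hn1 : (0 : ℝ) < n - 1 := by
    have : (2 : ℝ) ≤ n := by exact_mod_cast hn
    linarith
  obtain ⟨K, hK, h⟩ := exists_pow_pred_mul_le (by omega : 1 ≤ n)
    (div_pos hδ hn1)
  refine ⟨(n - 1) * K, by positivity, fun a b v => ?_⟩
  -- All three norms are replaced by one, so that a single product `M ^ (n - 1) * ‖a - b‖` remains
  -- for Young's inequality.
  set M := max (max ‖a‖ ‖b‖) ‖v‖ with hM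
  have hM0 : 0 ≤ M := (norm_nonneg v).trans (le_max_right _ _)
  have hMn : M ^ n ≤ ‖a‖ ^ n + ‖b‖ ^ n + ‖v‖ ^ n := by
    have ha : 0 ≤ ‖a‖ ^ n := by positivity
    have hb : 0 ≤ ‖b‖ ^ n := by positivity
    have hv : 0 ≤ ‖v‖ ^ n := by positivity
    rcases max_choice (max ‖a‖ ‖b‖) ‖v‖ with e | e
    · rcases max_choice ‖a‖ ‖b‖ with e' | e' <;> rw [hM, e, e'] <;> linarith
    · rw [hM, e]; linarith
  have e : ‖a‖ ^ (n - 2) * inner ℝ a v - ‖b‖ ^ (n - 2) * inner ℝ b v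
      = inner ℝ (‖a‖ ^ (n - 2) • a - ‖b‖ ^ (n - 2) • b) v := by
    rw [inner_sub_left, real_inner_smul_left, real_inner_smul_left]
  have e2 : M ^ (n - 1) = M ^ (n - 2) * M := by rw [← pow_succ]; congr 1; omega
  calc |‖a‖ ^ (n - 2) * inner ℝ a v - ‖b‖ ^ (n - 2) * inner ℝ b v|
      ≤ ‖‖a‖ ^ (n - 2) • a - ‖b‖ ^ (n - 2) • b‖ * ‖v‖ := by
        rw [e]; exact abs_real_inner_le_norm _ _
    _ ≤ ((n - 1) * ‖a - b‖ * M ^ (n - 2)) * M := by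
        gcongr
        · refine (norm_pow_smul_sub_le hn a b).trans ?_
          gcongr
          exact le_max_left _ _
        · exact le_max_right _ _
    _ = (n - 1) * (M ^ (n - 1) * ‖a - b‖) := by rw [e2]; ring
    _ ≤ (n - 1) * (δ / (n - 1) * M ^ n + K * ‖a - b‖ ^ n) := by
        gcongr
        exact h M _ hM0 (norm_nonneg _)
    _ = δ * M ^ n + (n - 1) * K * ‖a - b‖ ^ n := by field_simp
    _ ≤ _ := by gcongr

lemma exists_abs_pow_mul_inner_le (hn : 2 ≤ n) {δ : ℝ} (hδ : 0 < δ) :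
    ∃ K : ℝ, 0 ≤ K ∧ ∀ a v : H,
      |‖a‖ ^ (n - 2) * inner ℝ a v| ≤ δ * ‖a‖ ^ n + K * ‖v‖ ^ n := by
  obtain ⟨K, hK, h⟩ := exists_pow_pred_mul_le (by omega : 1 ≤ n) hδ
  refine ⟨K, hK, fun a v => ?_⟩
  refine le_trans ?_ (h ‖a‖ ‖v‖ (norm_nonneg _) (norm_nonneg _))
  have e2 : ‖a‖ ^ (n - 1) = ‖a‖ ^ (n - 2) * ‖a‖ := by rw [← pow_succ]; congr 1; omega
  rw [abs_mul, abs_of_nonneg (by positivity), e2, mul_assoc]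
  gcongr
  exact abs_real_inner_le_norm _ _

variable {X : Type*} [MeasurableSpace X] {μ : Measure X}

lemma integrable_pow_mul_inner (hn : 2 ≤ n) {G V : X → H} (hG : MemLp G n μ) (hV : MemLp V n μ) :
    Integrable (fun x => ‖G x‖ ^ (n - 2) * inner ℝ (G x) (V x)) μ := by
  obtain ⟨K, hK, h⟩ := exists_abs_pow_mul_inner_le (H := H) hn one_pos
  have hn0 : n ≠ 0 := by omega
  refine Integrable.mono' (((hG.integrable_norm_pow hn0).const_mul 1).add
    ((hV.integrable_norm_pow hn0).const_mul K)) ?_ (ae_of_all _ fun x => h _ _)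
  exact (hG.1.norm.pow _).mul (hG.1.inner hV.1)

/-- The pointwise estimate costs a small multiple of the energies, which stay bounded, and a large
multiple of the `L^n` distance, which tends to zero. -/
lemma tendsto_integral_pow_mul_inner (hn : 2 ≤ n) {G : ℕ → X → H} {G₀ V : X → H}
    (hG : ∀ i, MemLp (G i) n μ) (hG₀ : MemLp G₀ n μ) (hV : MemLp V n μ)
    (h : Tendsto (fun i => ∫ x, ‖G i x - G₀ x‖ ^ n ∂μ) atTop (𝓝 0)) :
    Tendsto (fun i => ∫ x, ‖G i x‖ ^ (n - 2) * inner ℝ (G i x) (V x) ∂μ) atTop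
      (𝓝 (∫ x, ‖G₀ x‖ ^ (n - 2) * inner ℝ (G₀ x) (V x) ∂μ)) := by
  have hn0 : n ≠ 0 := by omega
  have hnorm := tendsto_integral_norm_pow (by omega : 1 ≤ n) hG hG₀ h
  set A := ∫ x, ‖G₀ x‖ ^ n ∂μ
  set B := ∫ x, ‖V x‖ ^ n ∂μ
  have hA : 0 ≤ A := integral_nonneg fun x => by positivity
  have hB : 0 ≤ B := integral_nonneg fun x => by positivity
  rw [Metric.tendsto_atTop]
  intro ε hε
  -- The energies sum to `2 * A + B` in the limit, so this coefficient makes their share less than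
  -- `ε`.
  obtain ⟨K, hK, hle⟩ := exists_abs_inner_sub_le (H := H) hn
    (show 0 < ε / (2 * (2 * A + B + 1)) by positivity)
  set δ := ε / (2 * (2 * A + B + 1)) with hδ
  have hlim : Tendsto (fun i => δ * ((∫ x, ‖G i x‖ ^ n ∂μ) + A + B)
      + K * ∫ x, ‖G i x - G₀ x‖ ^ n ∂μ) atTop (𝓝 (δ * (A + A + B) + K * 0)) :=
    ((hnorm.add_const A).add_const B |>.const_mul δ).add (h.const_mul K)
  have hlt : δ * (A + A + B) + K * 0 < ε := by
    have e : δ * (2 * (2 * A + B + 1)) = ε := by rw [hδ]; field_simp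
    have : 0 < δ := by positivity
    nlinarith
  obtain ⟨i₀, hi₀⟩ := eventually_atTop.1 (hlim.eventually_lt_const hlt)
  refine ⟨i₀, fun i hi => lt_of_le_of_lt ?_ (hi₀ i hi)⟩
  have i1 := (hG i).integrable_norm_pow hn0
  have i2 := hG₀.integrable_norm_pow hn0
  have i3 := hV.integrable_norm_pow hn0
  have i4 := ((hG i).sub hG₀).integrable_norm_pow hn0
  simp only [Pi.sub_apply] at i4
  rw [Real.dist_eq, ← integral_sub (integrable_pow_mul_inner hn (hG i) hV)
    (integrable_pow_mul_inner hn hG₀ hV)]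
  refine abs_integral_le_integral_abs.trans ?_
  refine (integral_mono ((integrable_pow_mul_inner hn (hG i) hV).sub
    (integrable_pow_mul_inner hn hG₀ hV)).abs
    ((((i1.add i2).add i3).const_mul δ).add (i4.const_mul K))
    fun x => hle (G i x) (G₀ x) (V x)).trans (le_of_eq ?_)
  have i12 : Integrable (fun x => ‖G i x‖ ^ n + ‖G₀ x‖ ^ n) μ := i1.add i2
  have i123 : Integrable (fun x => ‖G i x‖ ^ n + ‖G₀ x‖ ^ n + ‖V x‖ ^ n) μ := i12.add i3
  simp only [Pi.add_apply]
  rw [integral_add (i123.const_mul δ) (i4.const_mul K), integral_const_mul, integral_const_mul,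
    integral_add i12 i3, integral_add i1 i2]

lemma tendsto_integral_pow_mul_inner_right (hn : 2 ≤ n) {V : ℕ → X → H} {G V₀ : X → H}
    (hV : ∀ i, MemLp (V i) n μ) (hG : MemLp G n μ) (hV₀ : MemLp V₀ n μ)
    (h : Tendsto (fun i => ∫ x, ‖V i x - V₀ x‖ ^ n ∂μ) atTop (𝓝 0)) :
    Tendsto (fun i => ∫ x, ‖G x‖ ^ (n - 2) * inner ℝ (G x) (V i x) ∂μ) atTop
      (𝓝 (∫ x, ‖G x‖ ^ (n - 2) * inner ℝ (G x) (V₀ x) ∂μ)) := by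
  have hn0 : n ≠ 0 := by omega
  set A := ∫ x, ‖G x‖ ^ n ∂μ
  have hA : 0 ≤ A := integral_nonneg fun x => by positivity
  rw [Metric.tendsto_atTop]
  intro ε hε
  obtain ⟨K, hK, hle⟩ := exists_abs_pow_mul_inner_le (H := H) hn
    (show 0 < ε / (2 * (A + 1)) by positivity)
  set δ := ε / (2 * (A + 1)) with hδ
  have hlim : Tendsto (fun i => δ * A + K * ∫ x, ‖V i x - V₀ x‖ ^ n ∂μ) atTop
      (𝓝 (δ * A + K * 0)) := (h.const_mul K).const_add _
  have hlt : δ * A + K * 0 < ε := by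
    have e : δ * (2 * (A + 1)) = ε := by rw [hδ]; field_simp
    have : 0 < δ := by positivity
    nlinarith
  obtain ⟨i₀, hi₀⟩ := eventually_atTop.1 (hlim.eventually_lt_const hlt)
  refine ⟨i₀, fun i hi => lt_of_le_of_lt ?_ (hi₀ i hi)⟩
  have i1 := hG.integrable_norm_pow hn0
  have i4 := ((hV i).sub hV₀).integrable_norm_pow hn0
  simp only [Pi.sub_apply] at i4
  rw [Real.dist_eq, ← integral_sub (integrable_pow_mul_inner hn hG (hV i))
    (integrable_pow_mul_inner hn hG hV₀)]
  refine abs_integral_le_integral_abs.trans ?_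
  refine (integral_mono ((integrable_pow_mul_inner hn hG (hV i)).sub
    (integrable_pow_mul_inner hn hG hV₀)).abs
    ((i1.const_mul δ).add (i4.const_mul K)) fun x => ?_).trans (le_of_eq ?_)
  · have := hle (G x) (V i x - V₀ x)
    rw [inner_sub_right, mul_sub] at this
    exact this
  · simp only [Pi.add_apply]
    rw [integral_add (i1.const_mul δ) (i4.const_mul K), integral_const_mul, integral_const_mul]

end Young

/-! ### Chain rule and Poincaré inequality in `W_0^{1,N}`. -/

section ChainRule

variable {N : ℕ} {Ω : Set (EuclideanSpace ℝ (Fin N))}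
  {u : EuclideanSpace ℝ (Fin N) → ℝ} {G : EuclideanSpace ℝ (Fin N) → EuclideanSpace ℝ (Fin N)}

namespace MemSobolevOneZero

/-- Approximation by test functions, with almost everywhere convergence. -/
lemma exists_approx_ae (hN : 1 ≤ N) (h : MemSobolevOneZero Ω (N : ℝ≥0∞) u G) :
    ∃ φ : ℕ → EuclideanSpace ℝ (Fin N) → ℝ, (∀ n, IsTestFunction Ω (φ n)) ∧
      Tendsto (fun n => ∫ x in Ω, |φ n x - u x| ^ N) atTop (𝓝 0) ∧
      Tendsto (fun n => ∫ x in Ω, ‖gradient (φ n) x - G x‖ ^ N) atTop (𝓝 0) ∧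
      ∀ᵐ x ∂(volume.restrict Ω), Tendsto (fun n => φ n x) atTop (𝓝 (u x)) := by
  have hN0 : N ≠ 0 := by omega
  obtain ⟨φ, hφ, h1, h2⟩ := h.exists_approx
  replace h1 := (tendsto_eLpNorm_natCast_iff hN0 fun n => ((hφ n).memLp _ Ω).sub h.memLp).1 h1
  replace h2 := (tendsto_eLpNorm_natCast_iff hN0
    fun n => ((hφ n).memLp_gradient _ Ω).sub h.memLp_grad).1 h2
  obtain ⟨ns, hns, hae⟩ := exists_subseq_tendsto_ae_of_integral_pow hN0
    (fun n => (hφ n).memLp _ Ω) h.memLp h1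
  exact ⟨fun n => φ (ns n), fun n => hφ _, h1.comp hns.tendsto_atTop, h2.comp hns.tendsto_atTop,
    hae⟩

/-- The chain rule in `W_0^{1,N}`. -/
lemma comp_left (hN : 1 ≤ N) (hΩ : volume Ω ≠ ⊤) (h : MemSobolevOneZero Ω (N : ℝ≥0∞) u G)
    {g : ℝ → ℝ} (hg : ContDiff ℝ ∞ g) (hg0 : g 0 = 0) {C : ℝ} (hC : ∀ t, |deriv g t| ≤ C) :
    MemSobolevOneZero Ω (N : ℝ≥0∞) (fun x => g (u x)) (fun x => deriv g (u x) • G x) := by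
  have hN0 : N ≠ 0 := by omega
  have hp : (1 : ℝ≥0∞) ≤ N := by exact_mod_cast hN
  have hC0 : 0 ≤ C := (abs_nonneg _).trans (hC 0)
  obtain ⟨φ, hφ, h1, h2, hae⟩ := h.exists_approx_ae hN
  have hgd : Differentiable ℝ g := hg.differentiable (by simp)
  have hgc : Continuous (deriv g) := hg.continuous_deriv (by simp)
  have hlip : ∀ s t, |g s - g t| ≤ C * |s - t| := fun s t =>
    convex_univ.norm_image_sub_le_of_norm_deriv_le (fun x _ => hgd x) (fun x _ => hC x)
      (mem_univ t) (mem_univ s)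
  have hmu : MemLp (fun x => g (u x)) N (volume.restrict Ω) := by
    refine MemLp.of_le_mul h.memLp (c := C) (hg.continuous.comp_aestronglyMeasurable h.memLp.1)
      (ae_of_all _ fun x => ?_)
    simpa [hg0] using hlip (u x) 0
  have hmG : MemLp (fun x => deriv g (u x) • G x) N (volume.restrict Ω) := by
    refine MemLp.of_le_mul h.memLp_grad (c := C)
      ((hgc.comp_aestronglyMeasurable h.memLp.1).smul h.memLp_grad.1) (ae_of_all _ fun x => ?_)
    rw [norm_smul]
    gcongr
    exact hC _
  have hT := fun n => (hφ n).comp_left hg hg0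
  refine memSobolevOneZero_of_tendsto hp hΩ hT hmu hmG ?_ ?_
  · refine (tendsto_eLpNorm_natCast_iff hN0 fun n => ((hT n).memLp _ Ω).sub hmu).2 ?_
    have := h1.const_mul (C ^ N)
    rw [mul_zero] at this
    refine squeeze_zero (fun n => integral_nonneg fun x => by positivity) (fun n => ?_) this
    rw [← integral_const_mul]
    refine integral_mono ((((hT n).memLp _ Ω).sub hmu).integrable_norm_pow hN0)
      (((((hφ n).memLp _ Ω).sub h.memLp).integrable_norm_pow hN0).const_mul _) fun x => ?_
    simp only [Real.norm_eq_abs]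
    rw [← mul_pow]
    gcongr
    exact hlip _ _
  · refine (tendsto_eLpNorm_natCast_iff hN0 fun n => ((hT n).memLp_gradient _ Ω).sub hmG).2 ?_
    -- The gradient error splits into `g'(φ n) • (∇φ n - G)` and `(g'(φ n) - g'(u)) • G`. The second
    -- part has no rate; it needs dominated convergence, hence the almost everywhere convergence of
    -- the approximation.
    have hR : Tendsto (fun n => ∫ x in Ω, |deriv g (φ n x) - deriv g (u x)| ^ N * ‖G x‖ ^ N) atTop
        (𝓝 (∫ x in Ω, (0 : ℝ))) := by
      refine tendsto_integral_of_dominated_convergence (fun x => (2 * C) ^ N * ‖G x‖ ^ N)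
        (fun n => ?_) ((h.memLp_grad.integrable_norm_pow hN0).const_mul _)
        (fun n => ae_of_all _ fun x => ?_) ?_
      · exact ((((hgc.comp_aestronglyMeasurable ((hφ n).memLp (N : ℝ≥0∞) Ω).1)).sub
          (hgc.comp_aestronglyMeasurable h.memLp.1)).norm.pow N).mul (h.memLp_grad.1.norm.pow N)
      · rw [Real.norm_of_nonneg (by positivity)]
        gcongr
        have := abs_sub (deriv g (φ n x)) (deriv g (u x))
        linarith [hC (φ n x), hC (u x)]
      · filter_upwards [hae] with x hx
        have h3 : Tendsto (fun n => |deriv g (φ n x) - deriv g (u x)|) atTop (𝓝 0) := by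
          simpa using (((hgc.tendsto _).comp hx).sub_const (deriv g (u x))).abs
        simpa [hN0] using (h3.pow N).mul_const (‖G x‖ ^ N)
    rw [integral_zero] at hR
    have hS : Tendsto (fun n => 2 ^ (N - 1) * (C ^ N * (∫ x in Ω, ‖gradient (φ n) x - G x‖ ^ N)
        + ∫ x in Ω, |deriv g (φ n x) - deriv g (u x)| ^ N * ‖G x‖ ^ N)) atTop (𝓝 0) := by
      simpa using ((h2.const_mul (C ^ N)).add hR).const_mul (2 ^ (N - 1))
    refine squeeze_zero (fun n => integral_nonneg fun x => by positivity) (fun n => ?_) hS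
    have i1 := ((((hφ n).memLp_gradient N Ω).sub h.memLp_grad).integrable_norm_pow hN0).const_mul
      (C ^ N)
    simp only [Pi.sub_apply] at i1
    have i2 : Integrable (fun x => |deriv g (φ n x) - deriv g (u x)| ^ N * ‖G x‖ ^ N)
        (volume.restrict Ω) := by
      refine Integrable.mono' ((h.memLp_grad.integrable_norm_pow hN0).const_mul ((2 * C) ^ N))
        ?_ (ae_of_all _ fun x => ?_)
      · exact ((((hgc.comp_aestronglyMeasurable ((hφ n).memLp (N : ℝ≥0∞) Ω).1)).sub
          (hgc.comp_aestronglyMeasurable h.memLp.1)).norm.pow N).mul (h.memLp_grad.1.norm.pow N)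
      · rw [Real.norm_of_nonneg (by positivity)]
        gcongr
        have := abs_sub (deriv g (φ n x)) (deriv g (u x))
        linarith [hC (φ n x), hC (u x)]
    rw [← integral_const_mul, ← integral_add i1 i2, ← integral_const_mul]
    refine integral_mono ((((hT n).memLp_gradient _ Ω).sub hmG).integrable_norm_pow hN0)
      ((i1.add i2).const_mul _) fun x => ?_
    simp only [Pi.sub_apply]
    rw [(hφ n).gradient_comp_left hgd]
    have e : deriv g (φ n x) • gradient (φ n) x - deriv g (u x) • G x
        = deriv g (φ n x) • (gradient (φ n) x - G x)
          + (deriv g (φ n x) - deriv g (u x)) • G x := by module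
    rw [e]
    refine (pow_le_pow_left₀ (norm_nonneg _) (norm_add_le _ _) N).trans ?_
    refine (add_pow_le (norm_nonneg _) (norm_nonneg _) N).trans ?_
    gcongr
    · rw [norm_smul, mul_pow]
      gcongr
      exact hC _
    · rw [norm_smul, mul_pow, Real.norm_eq_abs]

end MemSobolevOneZero

/-- The Poincaré inequality with the constant `λ₁`. -/
lemma firstEigenvalue_mul_le (hN : 1 ≤ N) (h : MemSobolevOneZero Ω (N : ℝ≥0∞) u G) :
    firstEigenvalue Ω * ∫ x in Ω, |u x| ^ N ≤ ∫ x in Ω, ‖G x‖ ^ N := by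
  have hN0 : N ≠ 0 := by omega
  have h0 : 0 ≤ ∫ x in Ω, ‖G x‖ ^ N := integral_nonneg fun x => by positivity
  by_cases hu : u =ᵐ[volume.restrict Ω] 0
  · have : ∫ x in Ω, |u x| ^ N = 0 := by
      refine integral_eq_zero_of_ae ?_
      filter_upwards [hu] with x hx
      simp [hx, hN0]
    rw [this, mul_zero]
    exact h0
  · have hpos : 0 < ∫ x in Ω, |u x| ^ N := by
      have hnn : 0 ≤ ∫ x in Ω, |u x| ^ N := integral_nonneg fun x => by positivity
      refine lt_of_le_of_ne hnn fun h' => hu ?_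
      have := (integral_eq_zero_iff_of_nonneg (fun x => by positivity)
        (h.memLp.integrable_norm_pow hN0)).1 h'.symm
      filter_upwards [this] with x hx
      simpa [hN0] using hx
    rw [← le_div_iff₀ hpos]
    refine csInf_le ⟨0, ?_⟩ ⟨u, G, h, hu, rfl⟩
    rintro _ ⟨w, W, -, -, rfl⟩
    exact div_nonneg (integral_nonneg fun x => by positivity)
      (integral_nonneg fun x => by positivity)

end ChainRule

/-! ### A Trudinger inequality by decay of superlevel sets. -/

section Trudinger

variable {N : ℕ} {Ω : Set (EuclideanSpace ℝ (Fin N))}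

/-- Outside the open unit interval the function attains its minimum or its maximum. -/
lemma deriv_smoothTransition_eq_zero {s : ℝ} (hs : s ≤ 0 ∨ 1 ≤ s) :
    deriv Real.smoothTransition s = 0 := by
  rcases hs with hs | hs
  · refine IsLocalMin.deriv_eq_zero (Eventually.of_forall fun t => ?_)
    rw [Real.smoothTransition.zero_of_nonpos hs]
    exact Real.smoothTransition.nonneg t
  · refine IsLocalMax.deriv_eq_zero (Eventually.of_forall fun t => ?_)
    rw [Real.smoothTransition.one_of_one_le hs]
    exact Real.smoothTransition.le_one t

lemma exists_abs_deriv_smoothTransition_le :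
    ∃ M : ℝ, 0 < M ∧ ∀ s, |deriv Real.smoothTransition s| ≤ M := by
  have hc : Continuous (deriv Real.smoothTransition) :=
    (Real.smoothTransition.contDiff (n := 1)).continuous_deriv le_rfl
  obtain ⟨C, hC⟩ := isCompact_Icc.exists_bound_of_continuousOn (s := Icc (0 : ℝ) 1) hc.continuousOn
  refine ⟨max C 1, by positivity, fun s => ?_⟩
  by_cases hs : s ∈ Icc (0 : ℝ) 1
  · exact (hC s hs).trans (le_max_left _ _)
  · rw [deriv_smoothTransition_eq_zero, abs_zero]
    · positivity
    · simp only [mem_Icc, not_and_or, not_le] at hs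
      rcases hs with hs | hs
      · exact Or.inl hs.le
      · exact Or.inr hs.le

/-- Decay of the measure of superlevel sets, controlled by the energy between two levels. -/
lemma exists_measureReal_superlevel_le (hN : 2 ≤ N) :
    ∃ B : ℝ, 0 < B ∧ ∀ (Ω : Set (EuclideanSpace ℝ (Fin N))) (ψ : EuclideanSpace ℝ (Fin N) → ℝ),
      IsTestFunction Ω ψ → ∀ a h : ℝ, 0 ≤ a → 0 < h →
      volume.real {x | a + h < ψ x} ≤ B * h ^ (-((N : ℝ) / (N - 1))) *
        (∫ x in {x | a < ψ x ∧ ψ x ≤ a + h}, ‖gradient ψ x‖ ^ N) ^ (1 / ((N : ℝ) - 1)) *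
        volume.real {x | a < ψ x} := by
  obtain ⟨M, hM, hMle⟩ := exists_abs_deriv_smoothTransition_le
  have hN1 : (1 : ℝ) < N := by exact_mod_cast (by omega : 1 < N)
  have hNm : (0 : ℝ) < N - 1 := by linarith
  have hconj : Real.HolderConjugate (N : ℝ) ((N : ℝ) / (N - 1)) := Real.HolderConjugate.conjExponent hN1
  set q : ℝ := (N : ℝ) / (N - 1) with hq
  have hq0 : 0 < q := by positivity
  set C₀ := lintegralPowLePowLIntegralFDerivConst
    (volume : Measure (EuclideanSpace ℝ (Fin N))) q with hC₀
  -- The summand `1` only makes the constant positive.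
  refine ⟨C₀ * M ^ q + 1, by positivity, fun Ω ψ hψ a h ha hh => ?_⟩
  -- A smooth step from `0` at level `a` to `1` at level `a + h`: `T ∘ ψ` is a test function, is one
  -- on the higher superlevel set, and has its gradient supported in the strip `S`.
  set T : ℝ → ℝ := fun s => Real.smoothTransition ((s - a) / h) with hT
  have hTs : ContDiff ℝ ∞ T := by
    refine ContDiff.comp (g := Real.smoothTransition) Real.smoothTransition.contDiff ?_
    exact (contDiff_id.sub contDiff_const).div_const h
  have hT0 : T 0 = 0 := by
    apply Real.smoothTransition.zero_of_nonpos
    rw [zero_sub]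
    exact div_nonpos_of_nonpos_of_nonneg (by linarith) hh.le
  have hv := hψ.comp_left hTs hT0
  set S : Set (EuclideanSpace ℝ (Fin N)) := {x | a < ψ x ∧ ψ x ≤ a + h} with hS
  have hSm : MeasurableSet S :=
    (isOpen_lt continuous_const hψ.continuous).measurableSet.inter
      (isClosed_le hψ.continuous continuous_const).measurableSet
  have hfin : volume {x | a < ψ x} < ⊤ := by
    refine lt_of_le_of_lt (measure_mono fun x hx => ?_) hψ.hasCompactSupport.isCompact.measure_lt_top
    refine subset_tsupport ψ ?_
    rw [Function.mem_support]
    have hx : a < ψ x := hx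
    linarith [hx]
  have hdT : ∀ s, deriv T s = deriv Real.smoothTransition ((s - a) / h) / h := by
    intro s
    have h1 : HasDerivAt (fun s : ℝ => (s - a) / h) (1 / h) s :=
      ((hasDerivAt_id s).sub_const a).div_const h
    have h2 := (Real.smoothTransition.contDiff (n := 1)).differentiable (by simp) ((s - a) / h)
    have := (h2.hasDerivAt.comp s h1).deriv
    simpa [Function.comp_def, hT, div_eq_mul_inv] using this
  have hgrad : ∀ x, ‖fderiv ℝ (fun x => T (ψ x)) x‖ₑ
      ≤ S.indicator (fun x => ENNReal.ofReal (M / h) * ‖gradient ψ x‖ₑ) x := by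
    intro x
    rw [← enorm_norm, ← norm_gradient_eq, enorm_norm,
      hψ.gradient_comp_left (hTs.differentiable (by simp)), hdT]
    by_cases hx : x ∈ S
    · rw [indicator_of_mem hx, enorm_smul]
      gcongr
      rw [Real.enorm_eq_ofReal_abs, abs_div, abs_of_pos hh]
      gcongr
      exact hMle _
    · rw [deriv_smoothTransition_eq_zero]
      · simp
      · simp only [hS, mem_ofPred_eq, not_and_or, not_lt, not_le] at hx
        rcases hx with hx | hx
        · exact Or.inl (div_nonpos_of_nonpos_of_nonneg (by linarith) hh.le)
        · refine Or.inr ?_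
          rw [le_div_iff₀ hh]; linarith
  -- Hölder on the strip, with exponents `N` and `q`.
  have hlint : ∫⁻ x, ‖fderiv ℝ (fun x => T (ψ x)) x‖ₑ ≤ ENNReal.ofReal (M / h) *
      ((∫⁻ x in S, ‖gradient ψ x‖ₑ ^ (N : ℝ)) ^ (1 / (N : ℝ)) * (volume S) ^ (1 / q)) := by
    refine (lintegral_mono hgrad).trans ?_
    rw [lintegral_indicator hSm, lintegral_const_mul _ hψ.continuous_gradient.measurable.enorm]
    gcongr
    have := ENNReal.lintegral_mul_le_Lp_mul_Lq (volume.restrict S) hconj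
      (f := fun x => ‖gradient ψ x‖ₑ) (g := fun _ => 1)
      hψ.continuous_gradient.measurable.enorm.aemeasurable aemeasurable_const
    simpa using this
  have hge : volume {x | a + h < ψ x} ≤ ∫⁻ x, ‖T (ψ x)‖ₑ ^ q := by
    rw [← lintegral_indicator_one (isOpen_lt continuous_const hψ.continuous).measurableSet]
    refine lintegral_mono fun x => ?_
    by_cases hx : x ∈ {x | a + h < ψ x}
    · rw [indicator_of_mem hx]
      have hx : a + h < ψ x := hx
      have : T (ψ x) = 1 := by
        apply Real.smoothTransition.one_of_one_le
        rw [le_div_iff₀ hh]; linarith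
      simp [this]
    · rw [indicator_of_notMem hx]; simp
  -- The Gagliardo–Nirenberg–Sobolev inequality from `W^{1,1}` to `L^q`. Its power `q` turns the
  -- factor `|S| ^ (1 / q)` into `|S|`, which makes the estimate iterable.
  have hgns := lintegral_pow_le_pow_lintegral_fderiv
    (volume : Measure (EuclideanSpace ℝ (Fin N))) (u := fun x => T (ψ x))
    (hv.contDiff.of_le (by simp)) hv.hasCompactSupport (p := q) (by simpa using hconj)
  have hSle : volume S ≤ volume {x | a < ψ x} := measure_mono fun x hx => hx.1
  have hGint : IntegrableOn (fun x => ‖gradient ψ x‖ ^ N) S :=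
    (hψ.memLp_gradient N S).integrable_norm_pow (by omega)
  have hG : ∫⁻ x in S, ‖gradient ψ x‖ₑ ^ (N : ℝ)
      = ENNReal.ofReal (∫ x in S, ‖gradient ψ x‖ ^ N) := by
    rw [ofReal_integral_eq_lintegral_ofReal hGint (ae_of_all _ fun x => by positivity)]
    refine lintegral_congr fun x => ?_
    rw [← ofReal_norm, ENNReal.rpow_natCast, ENNReal.ofReal_pow (norm_nonneg _)]
  have hG0 : 0 ≤ ∫ x in S, ‖gradient ψ x‖ ^ N := integral_nonneg fun x => by positivity
  have hexp : 1 / (N : ℝ) * q = 1 / ((N : ℝ) - 1) := by rw [hq]; field_simp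
  have hmain : volume {x | a + h < ψ x} ≤ ENNReal.ofReal ((C₀ * M ^ q + 1) * h ^ (-q) *
      (∫ x in S, ‖gradient ψ x‖ ^ N) ^ (1 / ((N : ℝ) - 1))) * volume {x | a < ψ x} := by
    calc volume {x | a + h < ψ x} ≤ C₀ * (∫⁻ x, ‖fderiv ℝ (fun x => T (ψ x)) x‖ₑ) ^ q :=
          hge.trans hgns
      _ ≤ C₀ * (ENNReal.ofReal (M / h) * ((ENNReal.ofReal (∫ x in S, ‖gradient ψ x‖ ^ N))
            ^ (1 / (N : ℝ)) * (volume S) ^ (1 / q))) ^ q := by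
          rw [hG] at hlint
          gcongr
      _ = ENNReal.ofReal (C₀ * (M / h) ^ q * (∫ x in S, ‖gradient ψ x‖ ^ N)
            ^ (1 / ((N : ℝ) - 1))) * volume S := by
          rw [ENNReal.mul_rpow_of_nonneg _ _ hq0.le, ENNReal.mul_rpow_of_nonneg _ _ hq0.le,
            ← ENNReal.rpow_mul, ← ENNReal.rpow_mul, hexp, one_div_mul_cancel hq0.ne',
            ENNReal.rpow_one, ENNReal.ofReal_mul (by positivity), ENNReal.ofReal_mul (by positivity),
            ENNReal.ofReal_rpow_of_nonneg (by positivity) hq0.le,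
            ENNReal.ofReal_rpow_of_nonneg hG0 (by positivity), ENNReal.ofReal_coe_nnreal]
          ring
      _ ≤ _ := by
          have e : C₀ * (M / h) ^ q = C₀ * M ^ q * h ^ (-q) := by
            rw [Real.div_rpow hM.le hh.le, Real.rpow_neg hh.le]; ring
          rw [e]
          gcongr
          linarith
  have := ENNReal.toReal_mono (ENNReal.mul_ne_top ENNReal.ofReal_ne_top hfin.ne) hmain
  rwa [ENNReal.toReal_mul, ENNReal.toReal_ofReal (by positivity)] at this

/-- Exponential decay of the distribution function of a normalized test function. -/
lemma exists_measureReal_superlevel_le_exp (hN : 2 ≤ N) :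
    ∃ B : ℝ, 0 < B ∧ ∀ (Ω : Set (EuclideanSpace ℝ (Fin N))), volume Ω ≠ ⊤ →
      ∀ ψ : EuclideanSpace ℝ (Fin N) → ℝ, IsTestFunction Ω ψ →
      ∫ x in Ω, ‖gradient ψ x‖ ^ N ≤ 1 → ∀ m : ℕ,
      volume.real {x | (B * m) ^ (((N : ℝ) - 1) / N) < ψ x} ≤
        Real.exp (-m) * volume.real Ω := by
  obtain ⟨B, hB, hstep⟩ := exists_measureReal_superlevel_le hN
  have hN1 : (1 : ℝ) < N := by exact_mod_cast (by omega : 1 < N)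
  have hNm : (0 : ℝ) < N - 1 := by linarith
  -- The levels up to `t` are divided into `m` steps of height `h = t / m`. The factor `e` in the
  -- constant makes the coefficient of one step equal to `e⁻¹ * m ^ s`, with `s = 1 / (N - 1)`.
  refine ⟨Real.exp 1 * B, by positivity, fun Ω hΩ ψ hψ hE m => ?_⟩
  have hsub : {x | 0 < ψ x} ⊆ Ω := by
    intro x hx
    by_contra hxΩ
    have hx : 0 < ψ x := hx
    rw [hψ.eq_zero_of_notMem hxΩ] at hx
    exact lt_irrefl _ hx
  have hsubr : volume.real {x | 0 < ψ x} ≤ volume.real Ω := measureReal_mono hsub hΩ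
  rcases Nat.eq_zero_or_pos m with rfl | hm
  · have : ((N : ℝ) - 1) / N ≠ 0 := by positivity
    simpa [Real.zero_rpow this] using hsubr
  have hm' : (0 : ℝ) < m := by exact_mod_cast hm
  set s : ℝ := 1 / ((N : ℝ) - 1) with hs
  have hs0 : 0 < s := by positivity
  set t : ℝ := (Real.exp 1 * B * m) ^ (((N : ℝ) - 1) / N) with ht
  have ht0 : 0 < t := by positivity
  set h : ℝ := t / m with hh
  have hh0 : 0 < h := by positivity
  have hhpow : B * h ^ (-((N : ℝ) / (N - 1))) = Real.exp (-1) * (m : ℝ) ^ s := by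
    have e1 : t ^ ((N : ℝ) / (N - 1)) = Real.exp 1 * B * m := by
      rw [ht, ← Real.rpow_mul (by positivity)]
      have : ((N : ℝ) - 1) / N * (N / (N - 1)) = 1 := by field_simp
      rw [this, Real.rpow_one]
    have e2 : (N : ℝ) / (N - 1) = 1 + s := by rw [hs]; field_simp; ring
    rw [Real.rpow_neg hh0.le, hh, Real.div_rpow ht0.le hm'.le, e1, e2, Real.rpow_add hm',
      Real.rpow_one, Real.exp_neg]
    field_simp
  set g : ℕ → ℝ := fun k => ∫ x in {x | k * h < ψ x ∧ ψ x ≤ k * h + h}, ‖gradient ψ x‖ ^ N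
    with hg
  have hg0 : ∀ k, 0 ≤ g k := fun k => integral_nonneg fun x => by positivity
  -- By `y ≤ exp (y - 1)` with `y = m * g j`, one step multiplies the measure by at most `exp (-1 +
  -- s * (m * g j - 1))`. After `m` steps the `s`-part of the exponent is nonpositive, because the
  -- strip energies add up to at most one.
  have hind : ∀ j : ℕ, volume.real {x | j * h < ψ x} ≤
      Real.exp (-j + s * (m * ∑ k ∈ Finset.range j, g k - j)) * volume.real Ω := by
    intro j
    induction j with
    | zero => simpa using hsubr
    | succ j ih =>
      have h1 := hstep Ω ψ hψ (j * h) h (by positivity) hh0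
      have e : ((j + 1 : ℕ) : ℝ) * h = j * h + h := by push_cast; ring
      rw [e]
      refine h1.trans ?_
      rw [hhpow]
      have h2 : (m : ℝ) ^ s * g j ^ s ≤ Real.exp (s * (m * g j - 1)) := by
        rw [← Real.mul_rpow hm'.le (hg0 j), mul_comm s, Real.exp_mul]
        refine Real.rpow_le_rpow (mul_nonneg hm'.le (hg0 j)) ?_ hs0.le
        have := Real.add_one_le_exp (m * g j - 1)
        linarith
      calc Real.exp (-1) * (m : ℝ) ^ s * g j ^ s * volume.real {x | j * h < ψ x}
          = Real.exp (-1) * ((m : ℝ) ^ s * g j ^ s) * volume.real {x | j * h < ψ x} := by ring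
        _ ≤ Real.exp (-1) * Real.exp (s * (m * g j - 1)) *
            (Real.exp (-j + s * (m * ∑ k ∈ Finset.range j, g k - j)) * volume.real Ω) := by
            gcongr
        _ = _ := by
            rw [← mul_assoc, ← Real.exp_add, ← Real.exp_add, Finset.sum_range_succ]
            push_cast
            congr 2
            ring
  -- The strips between consecutive levels are disjoint.
  have hsum : ∑ k ∈ Finset.range m, g k ≤ 1 := by
    refine le_trans ?_ hE
    have hmeas : ∀ k ∈ Finset.range m,
        MeasurableSet {x | (k : ℝ) * h < ψ x ∧ ψ x ≤ k * h + h} := fun k _ =>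
      (isOpen_lt continuous_const hψ.continuous).measurableSet.inter
        (isClosed_le hψ.continuous continuous_const).measurableSet
    have hint : ∀ t : Set (EuclideanSpace ℝ (Fin N)),
        IntegrableOn (fun x => ‖gradient ψ x‖ ^ N) t := fun t =>
      (hψ.memLp_gradient N t).integrable_norm_pow (by omega)
    rw [hg, ← integral_biUnion_finset _ hmeas ?_ fun k _ => hint _]
    · refine setIntegral_mono_set (hint Ω) (ae_of_all _ fun x => by positivity)
        (LE.le.eventuallyLE ?_)
      refine iUnion₂_subset fun k _ x hx => hsub ?_
      have : (0 : ℝ) ≤ k * h := by positivity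
      exact lt_of_le_of_lt this hx.1
    · have key : ∀ i j : ℕ, i < j → Disjoint {x | (i : ℝ) * h < ψ x ∧ ψ x ≤ i * h + h}
          {x | (j : ℝ) * h < ψ x ∧ ψ x ≤ j * h + h} := by
        intro i j hij
        refine Set.disjoint_left.2 fun x hx hx' => ?_
        have h1 : ψ x ≤ i * h + h := hx.2
        have h2 : (j : ℝ) * h < ψ x := hx'.1
        have h3 : (i : ℝ) + 1 ≤ j := by exact_mod_cast hij
        nlinarith
      intro i _ j _ hij
      rcases lt_or_gt_of_ne hij with hlt | hlt
      · exact key i j hlt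
      · exact (key j i hlt).symm
  have hfinal := hind m
  have e : (m : ℝ) * h = t := by rw [hh]; field_simp
  rw [e] at hfinal
  refine hfinal.trans ?_
  gcongr
  nlinarith [mul_nonneg hs0.le (mul_nonneg hm'.le (sub_nonneg.2 hsum))]

lemma IsTestFunction.integrableOn_exp {φ : EuclideanSpace ℝ (Fin N) → ℝ} (hφ : IsTestFunction Ω φ)
    (hΩ : volume Ω ≠ ⊤) (κ K : ℝ) {q : ℝ} (hq : 0 ≤ q) :
    IntegrableOn (fun x => Real.exp (κ * (|φ x| / K) ^ q)) Ω := by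
  have : IsFiniteMeasure (volume.restrict Ω) := ⟨by simpa using hΩ.lt_top⟩
  obtain ⟨C, hC⟩ := hφ.exists_bound
  have hcont : Continuous fun t : ℝ => Real.exp (κ * (|t| / K) ^ q) := by
    refine Real.continuous_exp.comp (continuous_const.mul ?_)
    exact Continuous.rpow_const (by fun_prop) fun _ => Or.inr hq
  obtain ⟨D, hD⟩ := isCompact_Icc.exists_bound_of_continuousOn (s := Icc (-C) C) hcont.continuousOn
  refine Integrable.of_bound (hcont.comp hφ.continuous).aestronglyMeasurable D
    (ae_of_all _ fun x => hD _ (abs_le.1 (hC x)))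

/-- Slice at the levels `(B * m) ^ (1 / q)`: between consecutive ones the integrand is at most `exp
((m + 1) / 2)`, on a set of measure at most `2 * exp (-m) * |Ω|`, and the products are summable. -/
lemma exists_integral_exp_le_of_isTestFunction (hN : 2 ≤ N) :
    ∃ κ C : ℝ, 0 < κ ∧ 0 ≤ C ∧ ∀ (Ω : Set (EuclideanSpace ℝ (Fin N))), volume Ω ≠ ⊤ →
      ∀ ψ : EuclideanSpace ℝ (Fin N) → ℝ, IsTestFunction Ω ψ →
      ∫ x in Ω, ‖gradient ψ x‖ ^ N ≤ 1 →
      ∫ x in Ω, Real.exp (κ * |ψ x| ^ ((N : ℝ) / (N - 1))) ≤ C * volume.real Ω := by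
  obtain ⟨B, hB, hdecay⟩ := exists_measureReal_superlevel_le_exp hN
  have hN1 : (1 : ℝ) < N := by exact_mod_cast (by omega : 1 < N)
  have hNm : (0 : ℝ) < N - 1 := by linarith
  set q : ℝ := (N : ℝ) / (N - 1) with hq
  have hq0 : 0 < q := by positivity
  have hqi : ((N : ℝ) - 1) / N = q⁻¹ := by rw [hq, inv_div]
  -- This is `exp ((m + 1) / 2) * (2 * exp (-m))`.
  set a : ℕ → ℝ := fun m => 2 * Real.exp ((1 - m) / 2) with ha
  have ha0 : ∀ m, 0 ≤ a m := fun m => by positivity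
  have hsum : Summable a := by
    have h1 : Summable fun m : ℕ => Real.exp (-1 / 2) ^ m :=
      summable_geometric_of_lt_one (Real.exp_pos _).le (by rw [Real.exp_lt_one_iff]; norm_num)
    refine (h1.mul_left (2 * Real.exp (1 / 2))).congr fun m => ?_
    rw [ha, ← Real.exp_nat_mul, mul_assoc, ← Real.exp_add]
    congr 2; ring
  have hS0 : 0 ≤ ∑' m, a m := tsum_nonneg ha0
  refine ⟨1 / (2 * B), 1 + ∑' m, a m, by positivity, by positivity,
    fun Ω hΩ ψ hψ hE => ?_⟩
  have hfin : IsFiniteMeasure (volume.restrict Ω) := ⟨by simpa using hΩ.lt_top⟩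
  set A : ℕ → Set (EuclideanSpace ℝ (Fin N)) := fun m => {x | (B * m) ^ q⁻¹ < |ψ x|} with hA
  have hAm : ∀ m, MeasurableSet (A m) := fun m =>
    (isOpen_lt continuous_const hψ.continuous.abs).measurableSet
  have hAle : ∀ m, (volume.restrict Ω) (A m)
      ≤ ENNReal.ofReal (2 * Real.exp (-m) * volume.real Ω) := by
    intro m
    have h1 := hdecay Ω hΩ ψ hψ hE m
    -- The decay estimate is one-sided; using it also for `-ψ` accounts for the factor two.
    have hψ' := hψ.smul (-1)
    have h2 := hdecay Ω hΩ _ hψ' (by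
      simpa only [hψ.gradient_smul, norm_smul, norm_neg, norm_one, one_mul] using hE) m
    rw [hqi] at h1 h2
    have hpos : 0 ≤ (B * (m : ℝ)) ^ q⁻¹ := by positivity
    have hsubΩ : ∀ {φ : EuclideanSpace ℝ (Fin N) → ℝ}, IsTestFunction Ω φ →
        volume {x | (B * (m : ℝ)) ^ q⁻¹ < φ x} ≠ ⊤ := by
      intro φ hφ
      refine ((measure_mono fun x hx => ?_).trans_lt hΩ.lt_top).ne
      by_contra hxΩ
      have hx : (B * (m : ℝ)) ^ q⁻¹ < φ x := hx
      rw [hφ.eq_zero_of_notMem hxΩ] at hx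
      exact hx.not_ge hpos
    calc (volume.restrict Ω) (A m) ≤ volume (A m) := Measure.restrict_apply_le _ _
      _ ≤ volume ({x | (B * (m : ℝ)) ^ q⁻¹ < ψ x} ∪
            {x | (B * (m : ℝ)) ^ q⁻¹ < ((-1 : ℝ) • ψ) x}) := by
          refine measure_mono fun x hx => ?_
          rcases lt_abs.1 (show (B * (m : ℝ)) ^ q⁻¹ < |ψ x| from hx) with h | h
          · exact Or.inl h
          · exact Or.inr (by simpa using h)
      _ ≤ volume {x | (B * (m : ℝ)) ^ q⁻¹ < ψ x} +
            volume {x | (B * (m : ℝ)) ^ q⁻¹ < ((-1 : ℝ) • ψ) x} := measure_union_le _ _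
      _ ≤ ENNReal.ofReal (Real.exp (-m) * volume.real Ω) +
            ENNReal.ofReal (Real.exp (-m) * volume.real Ω) := by
          gcongr
          · exact ENNReal.le_ofReal_iff_toReal_le (hsubΩ hψ) (by positivity) |>.2 h1
          · exact ENNReal.le_ofReal_iff_toReal_le (hsubΩ hψ') (by positivity) |>.2 h2
      _ = ENNReal.ofReal (2 * Real.exp (-m) * volume.real Ω) := by
          rw [← ENNReal.ofReal_add (by positivity) (by positivity)]
          congr 1; ring
  have hpt : ∀ x, ENNReal.ofReal (Real.exp (1 / (2 * B) * |ψ x| ^ q)) ≤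
      1 + ∑' m, (A m).indicator (fun _ => ENNReal.ofReal (Real.exp (((m : ℝ) + 1) / 2))) x := by
    intro x
    rcases (abs_nonneg (ψ x)).eq_or_lt with h0 | h0
    · rw [← h0, Real.zero_rpow hq0.ne']
      simp
    -- The ceiling minus one, rather than the floor, gives the strict lower inequality that
    -- membership in `A m` requires.
    · obtain ⟨m, hm1, hm2⟩ : ∃ m : ℕ, (m : ℝ) < |ψ x| ^ q / B ∧ |ψ x| ^ q / B ≤ m + 1 := by
        have hY : 0 < |ψ x| ^ q / B := by positivity
        refine ⟨⌈|ψ x| ^ q / B⌉₊ - 1, ?_, ?_⟩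
        · have := Nat.ceil_lt_add_one hY.le
          have h1 : 1 ≤ ⌈|ψ x| ^ q / B⌉₊ := Nat.one_le_iff_ne_zero.2 (Nat.ceil_pos.2 hY).ne'
          push_cast [h1]
          linarith
        · have := Nat.le_ceil (|ψ x| ^ q / B)
          have h1 : 1 ≤ ⌈|ψ x| ^ q / B⌉₊ := Nat.one_le_iff_ne_zero.2 (Nat.ceil_pos.2 hY).ne'
          push_cast [h1]
          linarith
      have hxA : x ∈ A m := by
        change (B * (m : ℝ)) ^ q⁻¹ < |ψ x|
        rw [lt_div_iff₀ hB, mul_comm] at hm1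
        have := Real.rpow_lt_rpow (by positivity) hm1 (inv_pos.2 hq0)
        rwa [Real.rpow_rpow_inv h0.le hq0.ne'] at this
      refine le_trans ?_ (le_add_left (ENNReal.le_tsum m))
      rw [indicator_of_mem hxA]
      gcongr
      have : 1 / (2 * B) * |ψ x| ^ q = (|ψ x| ^ q / B) / 2 := by field_simp
      rw [this]
      linarith
  have hlint : ∫⁻ x in Ω, ENNReal.ofReal (Real.exp (1 / (2 * B) * |ψ x| ^ q)) ≤
      ENNReal.ofReal ((1 + ∑' m, a m) * volume.real Ω) := by
    calc ∫⁻ x in Ω, ENNReal.ofReal (Real.exp (1 / (2 * B) * |ψ x| ^ q))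
        ≤ ∫⁻ x in Ω, (1 + ∑' m, (A m).indicator
            (fun _ => ENNReal.ofReal (Real.exp (((m : ℝ) + 1) / 2))) x) := lintegral_mono hpt
      _ = volume Ω + ∑' m : ℕ, ENNReal.ofReal (Real.exp (((m : ℝ) + 1) / 2)) *
            (volume.restrict Ω) (A m) := by
          rw [lintegral_add_left measurable_const, lintegral_tsum fun m =>
            (measurable_const.indicator (hAm m)).aemeasurable]
          congr 1
          · simp
          · congr 1; ext m
            rw [lintegral_indicator (hAm m), lintegral_const, Measure.restrict_apply_univ]
      _ ≤ ENNReal.ofReal (volume.real Ω) + ∑' m, ENNReal.ofReal (a m * volume.real Ω) := by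
          gcongr with m
          · rw [ofReal_measureReal hΩ]
          · refine (mul_le_mul_right (hAle m) _).trans ?_
            rw [← ENNReal.ofReal_mul (by positivity)]
            refine ENNReal.ofReal_le_ofReal (le_of_eq ?_)
            rw [ha]
            have : Real.exp ((1 - (m : ℝ)) / 2)
                = Real.exp (((m : ℝ) + 1) / 2) * Real.exp (-m) := by
              rw [← Real.exp_add]; congr 1; ring
            simp only
            rw [this]; ring
      _ = ENNReal.ofReal ((1 + ∑' m, a m) * volume.real Ω) := by
          rw [← ENNReal.ofReal_tsum_of_nonneg (fun m => mul_nonneg (ha0 m) measureReal_nonneg)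
            (hsum.mul_right _), tsum_mul_right, ← ENNReal.ofReal_add measureReal_nonneg
            (mul_nonneg hS0 measureReal_nonneg)]
          congr 1; ring
  have hint : IntegrableOn (fun x => Real.exp (1 / (2 * B) * |ψ x| ^ q)) Ω := by
    have := hψ.integrableOn_exp hΩ (1 / (2 * B)) 1 hq0.le
    simpa using this
  rw [← ofReal_integral_eq_lintegral_ofReal hint (ae_of_all _ fun x => (Real.exp_pos _).le)]
    at hlint
  exact (ENNReal.ofReal_le_ofReal_iff (by positivity)).1 hlint

/-- A (non sharp) Trudinger inequality in `W_0^{1,N}`. -/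
theorem exists_integral_exp_le (hN : 2 ≤ N) (hΩ : volume Ω ≠ ⊤) :
    ∃ κ C : ℝ, 0 < κ ∧ 0 ≤ C ∧ ∀ u G, MemSobolevOneZero Ω (N : ℝ≥0∞) u G → ∀ K : ℝ, 0 < K →
      ∫ x in Ω, ‖G x‖ ^ N ≤ K ^ N →
      IntegrableOn (fun x => Real.exp (κ * (|u x| / K) ^ ((N : ℝ) / (N - 1)))) Ω ∧
      ∫ x in Ω, Real.exp (κ * (|u x| / K) ^ ((N : ℝ) / (N - 1))) ≤ C := by
  obtain ⟨κ, C, hκ, hC, hT⟩ := exists_integral_exp_le_of_isTestFunction hN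
  have hN1 : (1 : ℝ) < N := by exact_mod_cast (by omega : 1 < N)
  have hNm : (0 : ℝ) < N - 1 := by linarith
  set q : ℝ := (N : ℝ) / (N - 1) with hq
  have hq0 : 0 < q := by positivity
  -- Approximating test functions satisfy the energy bound only with `2 * K` in place of `K`, and
  -- only eventually; the loss is paid by `2 ^ q`, and Fatou's lemma passes to the limit.
  refine ⟨κ / 2 ^ q, C * volume.real Ω, by positivity, by positivity, fun u G hu K hK hE => ?_⟩
  have hN0 : N ≠ 0 := by omega
  obtain ⟨φ, hφ, -, h2, hae⟩ := hu.exists_approx_ae (by omega)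
  have hlim := tendsto_integral_norm_pow (by omega) (fun n => (hφ n).memLp_gradient N Ω)
    hu.memLp_grad h2
  have hlt : ∫ x in Ω, ‖G x‖ ^ N < (2 * K) ^ N :=
    hE.trans_lt (pow_lt_pow_left₀ (by linarith) hK.le hN0)
  have e : ∀ t : ℝ, κ / 2 ^ q * (|t| / K) ^ q = κ * (|t| / (2 * K)) ^ q := by
    intro t
    rw [show |t| / (2 * K) = (|t| / K) / 2 by field_simp, Real.div_rpow (by positivity) two_pos.le]
    ring
  simp only [e]
  refine integrable_of_tendsto_of_integral_le (h := fun n x => Real.exp (κ * (|φ n x| / (2 * K)) ^ q))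
    (fun n => (hφ n).integrableOn_exp hΩ κ (2 * K) hq0.le)
    (fun n => ae_of_all _ fun x => (Real.exp_pos _).le) ?_ ?_
  · filter_upwards [hae] with x hx
    exact (Real.continuous_exp.tendsto _).comp
      (((hx.abs.div_const (2 * K)).rpow_const (Or.inr hq0.le)).const_mul κ)
  · filter_upwards [hlim.eventually_le_const hlt] with n hn
    have hψ := (hφ n).smul (2 * K)⁻¹
    have := hT Ω hΩ _ hψ ?_
    · refine le_trans (le_of_eq ?_) this
      congr 1; ext x
      simp only [Pi.smul_apply, smul_eq_mul, abs_mul, abs_inv, abs_of_pos (show 0 < 2 * K by positivity)]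
      rw [inv_mul_eq_div]
    · simp only [(hφ n).gradient_smul, norm_smul, mul_pow, integral_const_mul]
      rw [Real.norm_of_nonneg (by positivity), inv_pow, inv_mul_le_iff₀ (by positivity), mul_one]
      exact hn

end Trudinger

/-! ### Rellich compactness by averaging over balls. -/

section Rellich

variable {N : ℕ} {Ω : Set (EuclideanSpace ℝ (Fin N))} {φ : EuclideanSpace ℝ (Fin N) → ℝ}

namespace IsTestFunction

/-- The fundamental theorem of calculus on the segment from `x` to `x + z`, then Tonelli and
translation invariance. -/
lemma lintegral_translate_sub_le (hφ : IsTestFunction Ω φ) (z : EuclideanSpace ℝ (Fin N)) :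
    ∫⁻ x, ‖φ (x + z) - φ x‖ₑ ≤ ‖z‖ₑ * ∫⁻ x, ‖gradient φ x‖ₑ := by
  have hc := hφ.continuous_gradient
  have hpt : ∀ x, ‖φ (x + z) - φ x‖ₑ
      ≤ ∫⁻ t in Ioc (0 : ℝ) 1, ‖z‖ₑ * ‖gradient φ (x + t • z)‖ₑ := by
    intro x
    have hder : ∀ t ∈ uIcc (0 : ℝ) 1,
        HasDerivAt (fun t : ℝ => φ (x + t • z)) (inner ℝ (gradient φ (x + t • z)) z) t := by
      intro t _
      have h1 : HasDerivAt (fun t : ℝ => x + t • z) z t := by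
        simpa using ((hasDerivAt_id t).smul_const z).const_add x
      have h2 := ((hφ.differentiable (x + t • z)).hasFDerivAt).comp_hasDerivAt t h1
      rw [← inner_gradient_left] at h2
      exact h2
    have hFTC := intervalIntegral.integral_eq_sub_of_hasDerivAt hder
      (Continuous.intervalIntegrable (by fun_prop) _ _)
    simp only [one_smul, zero_smul, add_zero] at hFTC
    rw [← hFTC, intervalIntegral.integral_of_le zero_le_one]
    refine (enorm_integral_le_lintegral_enorm _).trans (lintegral_mono fun t => ?_)
    rw [← ofReal_norm, ← ofReal_norm, ← ofReal_norm, ← ENNReal.ofReal_mul (norm_nonneg _)]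
    refine ENNReal.ofReal_le_ofReal ?_
    rw [mul_comm]
    exact abs_real_inner_le_norm _ _
  have hmeas : Measurable fun p : EuclideanSpace ℝ (Fin N) × ℝ =>
      ‖z‖ₑ * ‖gradient φ (p.1 + p.2 • z)‖ₑ := by
    have : Continuous fun p : EuclideanSpace ℝ (Fin N) × ℝ => gradient φ (p.1 + p.2 • z) := by
      fun_prop
    exact this.measurable.enorm.const_mul _
  calc ∫⁻ x, ‖φ (x + z) - φ x‖ₑ
      ≤ ∫⁻ x, ∫⁻ t in Ioc (0 : ℝ) 1, ‖z‖ₑ * ‖gradient φ (x + t • z)‖ₑ := lintegral_mono hpt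
    _ = ∫⁻ t in Ioc (0 : ℝ) 1, ∫⁻ x, ‖z‖ₑ * ‖gradient φ (x + t • z)‖ₑ :=
        lintegral_lintegral_swap hmeas.aemeasurable
    _ = ∫⁻ t in Ioc (0 : ℝ) 1, ‖z‖ₑ * ∫⁻ x, ‖gradient φ x‖ₑ := by
        refine lintegral_congr fun t => ?_
        rw [lintegral_const_mul' _ _ enorm_ne_top,
          lintegral_add_right_eq_self (fun x => ‖gradient φ x‖ₑ)]
    _ = ‖z‖ₑ * ∫⁻ x, ‖gradient φ x‖ₑ := by simp

lemma integrable (hφ : IsTestFunction Ω φ) : Integrable φ volume :=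
  hφ.continuous.integrable_of_hasCompactSupport hφ.hasCompactSupport

lemma integrable_gradient (hφ : IsTestFunction Ω φ) : Integrable (gradient φ) volume :=
  hφ.continuous_gradient.integrable_of_hasCompactSupport hφ.hasCompactSupport_gradient

lemma integrable_translate_sub (hφ : IsTestFunction Ω φ) (z : EuclideanSpace ℝ (Fin N)) :
    Integrable (fun x => φ (x + z) - φ x) volume :=
  (hφ.integrable.comp_add_right z).sub hφ.integrable

lemma integral_translate_sub_le (hφ : IsTestFunction Ω φ) (z : EuclideanSpace ℝ (Fin N)) :
    ∫ x, |φ (x + z) - φ x| ≤ ‖z‖ * ∫ x, ‖gradient φ x‖ := by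
  have h := hφ.lintegral_translate_sub_le z
  have e1 := ofReal_integral_norm_eq_lintegral_enorm (hφ.integrable_translate_sub z)
  have e2 := ofReal_integral_norm_eq_lintegral_enorm hφ.integrable_gradient
  rw [← e1, ← e2, ← ofReal_norm, ← ENNReal.ofReal_mul (norm_nonneg _)] at h
  exact (ENNReal.ofReal_le_ofReal_iff (mul_nonneg (norm_nonneg _)
    (integral_nonneg fun x => norm_nonneg _))).1 h

end IsTestFunction

/-- The mean of `φ` over the ball of radius `h` about `x`. -/
noncomputable def ballMean (φ : EuclideanSpace ℝ (Fin N) → ℝ) (h : ℝ)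
    (x : EuclideanSpace ℝ (Fin N)) : ℝ :=
  (volume.real (Metric.ball (0 : EuclideanSpace ℝ (Fin N)) h))⁻¹ *
    ∫ z in Metric.ball (0 : EuclideanSpace ℝ (Fin N)) h, φ (x + z)

lemma volumeReal_ball_pos {h : ℝ} (hh : 0 < h) :
    0 < volume.real (Metric.ball (0 : EuclideanSpace ℝ (Fin N)) h) :=
  ENNReal.toReal_pos (Metric.measure_ball_pos _ _ hh).ne' measure_ball_lt_top.ne

namespace IsTestFunction

lemma abs_ballMean_le (hφ : IsTestFunction Ω φ) (h : ℝ) (x : EuclideanSpace ℝ (Fin N)) :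
    |ballMean φ h x| ≤
      (volume.real (Metric.ball (0 : EuclideanSpace ℝ (Fin N)) h))⁻¹ * ∫ x, |φ x| := by
  rw [ballMean, abs_mul, abs_of_nonneg (by positivity)]
  gcongr
  have hi : Integrable (fun z => φ (x + z)) volume := hφ.integrable.comp_add_left x
  calc |∫ z in Metric.ball (0 : EuclideanSpace ℝ (Fin N)) h, φ (x + z)|
      ≤ ∫ z in Metric.ball (0 : EuclideanSpace ℝ (Fin N)) h, |φ (x + z)| :=
        abs_integral_le_integral_abs
    _ ≤ ∫ z, |φ (x + z)| :=
        setIntegral_le_integral hi.abs (ae_of_all _ fun _ => abs_nonneg _)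
    _ = ∫ z, |φ z| := integral_add_left_eq_self (fun z => |φ z|) x

/-- For a fixed radius, a bound on the gradients in `L^1` makes the means equi-Lipschitz; this is
the source of compactness. -/
lemma abs_ballMean_sub_le (hφ : IsTestFunction Ω φ) (h : ℝ) (x y : EuclideanSpace ℝ (Fin N)) :
    |ballMean φ h x - ballMean φ h y| ≤
      (volume.real (Metric.ball (0 : EuclideanSpace ℝ (Fin N)) h))⁻¹ *
        (‖x - y‖ * ∫ x, ‖gradient φ x‖) := by
  have hi : ∀ x, Integrable (fun z => φ (x + z)) volume := fun x => hφ.integrable.comp_add_left x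
  rw [ballMean, ballMean, ← mul_sub, abs_mul, abs_of_nonneg (by positivity),
    ← integral_sub (hi x).integrableOn (hi y).integrableOn]
  gcongr
  calc |∫ z in Metric.ball (0 : EuclideanSpace ℝ (Fin N)) h, (φ (x + z) - φ (y + z))|
      ≤ ∫ z in Metric.ball (0 : EuclideanSpace ℝ (Fin N)) h, |φ (x + z) - φ (y + z)| :=
        abs_integral_le_integral_abs
    _ ≤ ∫ z, |φ (x + z) - φ (y + z)| :=
        setIntegral_le_integral ((hi x).sub (hi y)).abs (ae_of_all _ fun _ => abs_nonneg _)
    _ = ∫ z, |φ (z + (x - y)) - φ z| := by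
        rw [← integral_add_left_eq_self (fun z => |φ (z + (x - y)) - φ z|) y]
        congr 1; ext z; congr 3; abel
    _ ≤ _ := hφ.integral_translate_sub_le _

lemma continuous_ballMean (hφ : IsTestFunction Ω φ) (h : ℝ) : Continuous (ballMean φ h) := by
  refine LipschitzWith.continuous (K := Real.toNNReal
    ((volume.real (Metric.ball (0 : EuclideanSpace ℝ (Fin N)) h))⁻¹ * ∫ x, ‖gradient φ x‖))
    (LipschitzWith.of_dist_le' fun x y => ?_)
  rw [Real.dist_eq, dist_eq_norm]
  refine (hφ.abs_ballMean_sub_le h x y).trans (le_of_eq (by ring))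

/-- The error is an average of translation errors over `z` in the ball, each with `‖z‖ < h`. -/
lemma lintegral_ballMean_sub_le (hφ : IsTestFunction Ω φ) {h : ℝ} (hh : 0 < h) :
    ∫⁻ x, ‖ballMean φ h x - φ x‖ₑ ≤ ENNReal.ofReal h * ∫⁻ x, ‖gradient φ x‖ₑ := by
  set B := Metric.ball (0 : EuclideanSpace ℝ (Fin N)) h with hB
  set b := volume.real B with hb
  have hb0 : 0 < b := volumeReal_ball_pos hh
  have hpt : ∀ x, ‖ballMean φ h x - φ x‖ₑ
      ≤ ENNReal.ofReal b⁻¹ * ∫⁻ z in B, ‖φ (x + z) - φ x‖ₑ := by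
    intro x
    have hi : IntegrableOn (fun z => φ (x + z)) B := (hφ.integrable.comp_add_left x).integrableOn
    have e : ballMean φ h x - φ x = b⁻¹ * ∫ z in B, (φ (x + z) - φ x) := by
      rw [integral_sub hi (integrableOn_const measure_ball_lt_top.ne), setIntegral_const, mul_sub,
        smul_eq_mul, ← mul_assoc, ← hb, inv_mul_cancel₀ hb0.ne', one_mul]
      rfl
    rw [e, enorm_mul, Real.enorm_of_nonneg (by positivity)]
    gcongr
    exact enorm_integral_le_lintegral_enorm _
  have hmeas : Measurable fun p : EuclideanSpace ℝ (Fin N) × EuclideanSpace ℝ (Fin N) =>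
      ‖φ (p.1 + p.2) - φ p.1‖ₑ := by
    have := hφ.continuous
    have : Continuous fun p : EuclideanSpace ℝ (Fin N) × EuclideanSpace ℝ (Fin N) =>
      φ (p.1 + p.2) - φ p.1 := by fun_prop
    exact this.measurable.enorm
  calc ∫⁻ x, ‖ballMean φ h x - φ x‖ₑ
      ≤ ∫⁻ x, ENNReal.ofReal b⁻¹ * ∫⁻ z in B, ‖φ (x + z) - φ x‖ₑ := lintegral_mono hpt
    _ = ENNReal.ofReal b⁻¹ * ∫⁻ z in B, ∫⁻ x, ‖φ (x + z) - φ x‖ₑ := by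
        rw [lintegral_const_mul' _ _ ENNReal.ofReal_ne_top,
          lintegral_lintegral_swap hmeas.aemeasurable]
    _ ≤ ENNReal.ofReal b⁻¹ * ∫⁻ _ in B, ENNReal.ofReal h * ∫⁻ x, ‖gradient φ x‖ₑ := by
        refine mul_le_mul_right (setLIntegral_mono' Metric.isOpen_ball.measurableSet
          fun z hz => ?_) _
        refine (hφ.lintegral_translate_sub_le z).trans ?_
        gcongr
        rw [← ofReal_norm]
        exact ENNReal.ofReal_le_ofReal (by simpa using (mem_ball_zero_iff.1 hz).le)
    _ = ENNReal.ofReal h * ∫⁻ x, ‖gradient φ x‖ₑ := by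
        rw [setLIntegral_const, mul_comm, mul_assoc]
        have : volume B * ENNReal.ofReal b⁻¹ = 1 := by
          rw [← ofReal_measureReal measure_ball_lt_top.ne, ← ENNReal.ofReal_mul (by positivity),
            ← hb, mul_inv_cancel₀ hb0.ne', ENNReal.ofReal_one]
        rw [this, mul_one]

lemma integral_ballMean_sub_le (hφ : IsTestFunction Ω φ) {h : ℝ} (hh : 0 < h) :
    Integrable (fun x => ballMean φ h x - φ x) volume ∧
      ∫ x, |ballMean φ h x - φ x| ≤ h * ∫ x, ‖gradient φ x‖ := by
  have hl := hφ.lintegral_ballMean_sub_le hh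
  have e2 := ofReal_integral_norm_eq_lintegral_enorm hφ.integrable_gradient
  rw [← e2, ← ENNReal.ofReal_mul hh.le] at hl
  have hi : Integrable (fun x => ballMean φ h x - φ x) volume :=
    ⟨((hφ.continuous_ballMean h).sub hφ.continuous).aestronglyMeasurable,
      hl.trans_lt ENNReal.ofReal_lt_top⟩
  refine ⟨hi, ?_⟩
  rw [← ofReal_integral_norm_eq_lintegral_enorm hi] at hl
  exact (ENNReal.ofReal_le_ofReal_iff (mul_nonneg hh.le
    (integral_nonneg fun x => norm_nonneg _))).1 hl

/-- Translation by a vector of length `2 * R` moves `Ω` off itself, so on `Ω` the translation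
difference is `-φ`. -/
lemma integral_abs_le (hN : 1 ≤ N) {R : ℝ} (hR : 0 < R) (hΩR : Ω ⊆ Metric.ball 0 R)
    (hφ : IsTestFunction Ω φ) : ∫ x, |φ x| ≤ 2 * R * ∫ x, ‖gradient φ x‖ := by
  set z : EuclideanSpace ℝ (Fin N) := EuclideanSpace.single ⟨0, hN⟩ (2 * R) with hz
  have hzn : ‖z‖ = 2 * R := by rw [hz]; simp [abs_of_pos hR]
  have h := hφ.integral_translate_sub_le z
  rw [hzn] at h
  refine le_trans ?_ h
  refine integral_mono hφ.integrable.abs (hφ.integrable_translate_sub z).abs fun x => ?_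
  simp only
  by_cases hx : x ∈ Ω
  · have : x + z ∉ Ω := by
      intro hxz
      have h1 := mem_ball_zero_iff.1 (hΩR hx)
      have h2 := mem_ball_zero_iff.1 (hΩR hxz)
      have h3 := norm_sub_le (x + z) x
      rw [add_sub_cancel_left, hzn] at h3
      linarith
    rw [hφ.eq_zero_of_notMem this, zero_sub, abs_neg]
  · rw [hφ.eq_zero_of_notMem hx]; simp

end IsTestFunction

/-- Rellich's theorem for test functions: compactness in `L¹`. -/
lemma exists_subseq_cauchy_of_isTestFunction (hN : 1 ≤ N) (hΩ : Bornology.IsBounded Ω)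
    {φ : ℕ → EuclideanSpace ℝ (Fin N) → ℝ} (hφ : ∀ n, IsTestFunction Ω (φ n)) {C : ℝ}
    (hC : ∀ n, ∫ x, ‖gradient (φ n) x‖ ≤ C) :
    ∃ ns : ℕ → ℕ, StrictMono ns ∧ ∀ ε > 0, ∃ k₀, ∀ i j, k₀ ≤ i → k₀ ≤ j →
      ∫ x in Ω, |φ (ns i) x - φ (ns j) x| < ε := by
  have hfin : volume Ω < ⊤ := hΩ.measure_lt_top
  have : IsFiniteMeasure (volume.restrict Ω) := ⟨by simpa using hfin⟩
  have hC0 : 0 ≤ C := (integral_nonneg fun x => norm_nonneg _).trans (hC 0)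
  obtain ⟨R, hR, hΩR⟩ : ∃ R : ℝ, 0 < R ∧ Ω ⊆ Metric.ball 0 R := by
    obtain ⟨R, hR⟩ := hΩ.subset_ball 0
    exact ⟨max R 1, by positivity, hR.trans (Metric.ball_subset_ball (le_max_left _ _))⟩
  have hL1 : ∀ n, ∫ x, |φ n x| ≤ 2 * R * C := fun n =>
    ((hφ n).integral_abs_le hN hR hΩR).trans (by gcongr; exact hC n)
  set h : ℕ → ℝ := fun j => 1 / ((j : ℝ) + 1) with hh
  have hh0 : ∀ j, 0 < h j := fun j => Nat.one_div_pos_of_nat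
  set b : ℕ → ℝ := fun j =>
    (volume.real (Metric.ball (0 : EuclideanSpace ℝ (Fin N)) (h j)))⁻¹ with hb
  have hb0 : ∀ j, 0 < b j := fun j => inv_pos.2 (volumeReal_ball_pos (hh0 j))
  have hbdd : ∀ n j x, |ballMean (φ n) (h j) x| ≤ b j * (2 * R * C) := fun n j x =>
    ((hφ n).abs_ballMean_le (h j) x).trans (by gcongr; exact hL1 n)
  set x₀ := TopologicalSpace.denseSeq (EuclideanSpace ℝ (Fin N)) with hx₀
  -- All means at a dense sequence of points and at radii `1 / (j + 1)`, collected in one point of a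
  -- countable product of compact intervals. Sequential compactness of the product replaces a
  -- diagonal extraction.
  set P : ℕ → (ℕ × ℕ → ℝ) := fun n p => ballMean (φ n) (h p.2) (x₀ p.1) with hP
  have hK : IsCompact (Set.pi univ fun p : ℕ × ℕ =>
      Icc (-(b p.2 * (2 * R * C))) (b p.2 * (2 * R * C))) :=
    isCompact_univ_pi fun p => isCompact_Icc
  obtain ⟨a, -, ns, hns, hlim⟩ := hK.isSeqCompact (x := P) fun n p _ =>
    abs_le.1 (hbdd n p.2 (x₀ p.1))
  rw [tendsto_pi_nhds] at hlim
  -- The common Lipschitz constant extends convergence from the dense sequence to every point.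
  have hcau : ∀ j x, CauchySeq fun n => ballMean (φ (ns n)) (h j) x := by
    intro j x
    rw [Metric.cauchySeq_iff]
    intro ε hε
    obtain ⟨i, hi⟩ := (TopologicalSpace.denseRange_denseSeq
      (EuclideanSpace ℝ (Fin N))).exists_dist_lt x (show 0 < ε / (3 * (b j * (C + 1))) by
        have := hb0 j; positivity)
    have hci := (hlim (i, j)).cauchySeq
    obtain ⟨k₀, hk₀⟩ := Metric.cauchySeq_iff.1 hci (ε / 3) (by positivity)
    have hlip : ∀ n, |ballMean (φ (ns n)) (h j) x - ballMean (φ (ns n)) (h j) (x₀ i)| ≤ ε / 3 := by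
      intro n
      refine ((hφ (ns n)).abs_ballMean_sub_le (h j) x (x₀ i)).trans ?_
      rw [dist_eq_norm] at hi
      have hbj := hb0 j
      calc b j * (‖x - x₀ i‖ * ∫ x, ‖gradient (φ (ns n)) x‖)
          ≤ b j * (ε / (3 * (b j * (C + 1))) * (C + 1)) := by
            gcongr
            exact (hC _).trans (by linarith)
        _ = ε / 3 := by field_simp
    refine ⟨k₀, fun m hm n hn => ?_⟩
    have h1 := hk₀ m hm n hn
    have h2 := hlip m
    have h3 := hlip n
    simp only [Function.comp_apply, hP, Real.dist_eq] at h1 ⊢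
    rw [abs_lt] at h1 ⊢
    rw [abs_le] at h2 h3
    constructor <;> linarith
  have hptw : ∀ j, ∃ A : EuclideanSpace ℝ (Fin N) → ℝ, ∀ x,
      Tendsto (fun n => ballMean (φ (ns n)) (h j) x) atTop (𝓝 (A x)) := fun j => by
    choose A hA using fun x => cauchySeq_tendsto_of_complete (hcau j x)
    exact ⟨A, hA⟩
  choose A hA using hptw
  refine ⟨ns, hns, fun ε hε => ?_⟩
  -- At this radius all functions are within `ε / 4` of their means in `L^1`; the means themselves
  -- converge in `L^1(Ω)` by bounded convergence.
  obtain ⟨j, hj⟩ : ∃ j : ℕ, h j * (C + 1) < ε / 4 := by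
    obtain ⟨j, hj⟩ := exists_nat_one_div_lt (show 0 < ε / (4 * (C + 1)) by positivity)
    refine ⟨j, ?_⟩
    calc h j * (C + 1) < ε / (4 * (C + 1)) * (C + 1) := by gcongr
      _ = ε / 4 := by field_simp
  have hmeasA : Measurable (A j) :=
    measurable_of_tendsto_metrizable (fun n => ((hφ (ns n)).continuous_ballMean (h j)).measurable)
      (tendsto_pi_nhds.2 (hA j))
  have hAb : ∀ x, |A j x| ≤ b j * (2 * R * C) := fun x =>
    le_of_tendsto (hA j x).abs (Eventually.of_forall fun n => hbdd _ j x)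
  have hconst0 : 0 ≤ b j * (2 * R * C) := (abs_nonneg _).trans (hAb 0)
  have hAi : IntegrableOn (A j) Ω :=
    Integrable.of_bound hmeasA.aestronglyMeasurable _ (ae_of_all _ hAb)
  have hMi : ∀ n, IntegrableOn (ballMean (φ (ns n)) (h j)) Ω := fun n =>
    Integrable.of_bound ((hφ (ns n)).continuous_ballMean (h j)).aestronglyMeasurable _
      (ae_of_all _ fun x => hbdd (ns n) j x)
  have hconv : Tendsto (fun n => ∫ x in Ω, |ballMean (φ (ns n)) (h j) x - A j x|) atTop
      (𝓝 (∫ _ in Ω, (0 : ℝ))) := by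
    refine tendsto_integral_of_dominated_convergence (fun _ => 2 * (b j * (2 * R * C)))
      (fun n => ((hMi n).1.sub hAi.1).norm) (integrable_const _)
      (fun n => ae_of_all _ fun x => ?_) (ae_of_all _ fun x => ?_)
    · rw [Real.norm_eq_abs, abs_abs]
      exact (abs_sub _ _).trans (by linarith [hbdd (ns n) j x, hAb x])
    · simpa using ((hA j x).sub_const (A j x)).abs
  rw [integral_zero] at hconv
  obtain ⟨k₀, hk₀⟩ := eventually_atTop.1
    (hconv.eventually_lt_const (show 0 < ε / 4 by positivity))
  have hi1 : ∀ n, IntegrableOn (fun x => |ballMean (φ n) (h j) x - φ n x|) Ω := fun n =>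
    ((hφ n).integral_ballMean_sub_le (hh0 j)).1.abs.integrableOn
  have hclose : ∀ n, ∫ x in Ω, |ballMean (φ n) (h j) x - φ n x| < ε / 4 := by
    intro n
    refine lt_of_le_of_lt ?_ hj
    refine (setIntegral_le_integral ((hφ n).integral_ballMean_sub_le (hh0 j)).1.abs
      (ae_of_all _ fun x => abs_nonneg _)).trans ?_
    refine ((hφ n).integral_ballMean_sub_le (hh0 j)).2.trans ?_
    have := hC n
    have := hh0 j
    gcongr
    linarith
  have hi2 : ∀ n, IntegrableOn (fun x => |ballMean (φ (ns n)) (h j) x - A j x|) Ω := fun n =>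
    ((hMi n).sub hAi).abs
  refine ⟨k₀, fun i k hi hk => ?_⟩
  have hsum : ∫ x in Ω, |φ (ns i) x - φ (ns k) x| ≤
      ∫ x in Ω, ((|ballMean (φ (ns i)) (h j) x - φ (ns i) x|
        + |ballMean (φ (ns k)) (h j) x - φ (ns k) x|)
        + (|ballMean (φ (ns i)) (h j) x - A j x| + |ballMean (φ (ns k)) (h j) x - A j x|)) := by
    refine integral_mono (((hφ _).integrable.sub (hφ _).integrable).abs.integrableOn)
      (((hi1 _).add (hi1 _)).add ((hi2 i).add (hi2 k))) fun x => ?_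
    simp only
    have e : φ (ns i) x - φ (ns k) x = -(ballMean (φ (ns i)) (h j) x - φ (ns i) x)
      + (ballMean (φ (ns k)) (h j) x - φ (ns k) x)
      + ((ballMean (φ (ns i)) (h j) x - A j x) - (ballMean (φ (ns k)) (h j) x - A j x)) := by ring
    rw [e]
    refine (abs_add_le _ _).trans (add_le_add ((abs_add_le _ _).trans ?_) (abs_sub _ _))
    rw [abs_neg]
  have i1 : IntegrableOn (fun x => |ballMean (φ (ns i)) (h j) x - φ (ns i) x|
      + |ballMean (φ (ns k)) (h j) x - φ (ns k) x|) Ω := (hi1 _).add (hi1 _)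
  have i2 : IntegrableOn (fun x => |ballMean (φ (ns i)) (h j) x - A j x|
      + |ballMean (φ (ns k)) (h j) x - A j x|) Ω := (hi2 i).add (hi2 k)
  rw [integral_add i1 i2, integral_add (hi1 _) (hi1 _), integral_add (hi2 i) (hi2 k)] at hsum
  linarith [hclose (ns i), hclose (ns k), hk₀ i hi, hk₀ k hk]

/-- Rellich's theorem: a bounded sequence in `W_0^{1,N}` has a subsequence that converges almost
everywhere. -/
theorem exists_subseq_tendsto_ae (hN : 1 ≤ N) (hΩ : Bornology.IsBounded Ω)
    {u : ℕ → EuclideanSpace ℝ (Fin N) → ℝ}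
    {G : ℕ → EuclideanSpace ℝ (Fin N) → EuclideanSpace ℝ (Fin N)}
    (hu : ∀ n, MemSobolevOneZero Ω (N : ℝ≥0∞) (u n) (G n)) {C : ℝ}
    (hC : ∀ n, ∫ x in Ω, ‖G n x‖ ^ N ≤ C) :
    ∃ ns : ℕ → ℕ, StrictMono ns ∧ ∃ u₀ : EuclideanSpace ℝ (Fin N) → ℝ,
      ∀ᵐ x ∂(volume.restrict Ω), Tendsto (fun n => u (ns n) x) atTop (𝓝 (u₀ x)) := by
  have hN0 : N ≠ 0 := by omega
  have hfin : volume Ω < ⊤ := hΩ.measure_lt_top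
  have : IsFiniteMeasure (volume.restrict Ω) := ⟨by simpa using hfin⟩
  -- Each `u n` is replaced by a test function whose `L^N` error tends to zero and whose energy
  -- stays below `C + 1`. Compactness is needed only for these.
  have hex : ∀ n : ℕ, ∃ φ, IsTestFunction Ω φ ∧
      ∫ x in Ω, |φ x - u n x| ^ N < 1 / ((n : ℝ) + 1) ∧ ∫ x in Ω, ‖gradient φ x‖ ^ N < C + 1 := by
    intro n
    obtain ⟨φ, hφ, h1, h2, -⟩ := (hu n).exists_approx_ae hN
    have h3 := tendsto_integral_norm_pow hN (fun n => (hφ n).memLp_gradient N Ω)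
      (hu n).memLp_grad h2
    obtain ⟨k, hk1, hk2⟩ := ((h1.eventually_lt_const
      (show (0 : ℝ) < 1 / ((n : ℝ) + 1) from Nat.one_div_pos_of_nat)).and
      (h3.eventually_lt_const (show _ < C + 1 by linarith [hC n]))).exists
    exact ⟨φ k, hφ k, hk1, hk2⟩
  choose φ hφ h1 h2 using hex
  have hgrad : ∀ n, ∫ x, ‖gradient (φ n) x‖ ≤ volume.real Ω + (C + 1) := by
    intro n
    rw [← setIntegral_eq_integral_of_forall_compl_eq_zero (s := Ω) fun x hx => by
      rw [(hφ n).gradient_eq_zero_of_notMem hx, norm_zero]]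
    have i2 := ((hφ n).memLp_gradient N Ω).integrable_norm_pow hN0
    have : ∫ x in Ω, ‖gradient (φ n) x‖ ≤ ∫ x in Ω, (1 + ‖gradient (φ n) x‖ ^ N) := by
      refine integral_mono (hφ n).integrable_gradient.norm.integrableOn
        ((integrable_const 1).add i2) fun x => ?_
      simp only
      rcases le_total ‖gradient (φ n) x‖ 1 with h | h
      · have : 0 ≤ ‖gradient (φ n) x‖ ^ N := by positivity
        linarith
      · have := le_self_pow₀ h hN0
        linarith
    rw [integral_add (integrable_const 1) i2] at this
    simp only [integral_const, smul_eq_mul, mul_one, measureReal_restrict_apply_univ] at this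
    linarith [h2 n]
  obtain ⟨ns, hns, hcau⟩ := exists_subseq_cauchy_of_isTestFunction hN hΩ hφ hgrad
  obtain ⟨u₀, hu₀, hlim⟩ := exists_limit_of_cauchy_integral_pow (n := 1) (μ := volume.restrict Ω)
    le_rfl (f := fun n => φ (ns n)) (fun n => (hφ _).memLp _ Ω) (fun ε hε => by
      obtain ⟨k₀, hk₀⟩ := hcau ε hε
      refine ⟨k₀, fun i j hi hij => ?_⟩
      simpa using hk₀ i j hi (hi.trans hij))
  obtain ⟨ms, hms, hae1⟩ := exists_subseq_tendsto_ae_of_integral_pow one_ne_zero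
    (fun n => (hφ (ns n)).memLp _ Ω) hu₀ hlim
  -- A further subsequence makes the approximation error vanish almost everywhere, which transfers
  -- the limit back to the original sequence.
  have hdiff : Tendsto (fun n => ∫ x in Ω, ‖(φ (ns (ms n)) x - u (ns (ms n)) x) - 0‖ ^ N) atTop
      (𝓝 0) := by
    simp only [sub_zero, Real.norm_eq_abs]
    have h3 : Tendsto (fun n => ∫ x in Ω, |φ n x - u n x| ^ N) atTop (𝓝 0) :=
      squeeze_zero (fun n => integral_nonneg fun x => by positivity) (fun n => (h1 n).le)
        tendsto_one_div_add_atTop_nhds_zero_nat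
    exact h3.comp (hns.comp hms).tendsto_atTop
  obtain ⟨ls, hls, hae2⟩ := exists_subseq_tendsto_ae_of_integral_pow (n := N) hN0
    (fun n => ((hφ (ns (ms n))).memLp N Ω).sub (hu (ns (ms n))).memLp)
    (MemLp.zero (ε := ℝ)) hdiff
  refine ⟨fun n => ns (ms (ls n)), hns.comp (hms.comp hls), u₀, ?_⟩
  filter_upwards [hae1, hae2] with x hx1 hx2
  have := (hx1.comp hls.tendsto_atTop).sub hx2
  simpa using this

end Rellich

/-! ### Integrals of functions of exponential growth. -/

section ExponentialBounds

variable {N : ℕ} {Ω : Set (EuclideanSpace ℝ (Fin N))}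

/-- One term of the exponential series at `α * (1 + t ^ q)`, which dominates `α * t` because `q ≥
1`. -/
lemma exists_pow_le_exp {q : ℝ} (hq : 1 ≤ q) {α : ℝ} (hα : 0 < α) (p : ℕ) :
    ∃ C : ℝ, 0 < C ∧ ∀ t : ℝ, 0 ≤ t → t ^ p ≤ C * Real.exp (α * t ^ q) := by
  refine ⟨p.factorial / α ^ p * Real.exp α, by positivity, fun t ht => ?_⟩
  have h1 : t ≤ 1 + t ^ q := by
    rcases le_total t 1 with h | h
    · have : 0 ≤ t ^ q := by positivity
      linarith
    · have := Real.rpow_le_rpow_of_exponent_le h hq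
      rw [Real.rpow_one] at this
      linarith
  have hs : 0 ≤ α * (1 + t ^ q) := by positivity
  have h2 := Real.pow_div_factorial_le_exp (α * (1 + t ^ q)) hs p
  calc t ^ p ≤ (1 + t ^ q) ^ p := by gcongr
    _ = p.factorial / α ^ p * ((α * (1 + t ^ q)) ^ p / p.factorial) := by
        rw [mul_pow]; field_simp
    _ ≤ p.factorial / α ^ p * Real.exp (α * (1 + t ^ q)) := by gcongr
    _ = _ := by rw [mul_assoc, ← Real.exp_add]; congr 2; ring

lemma one_le_div_pred (hN : 2 ≤ N) : 1 ≤ (N : ℝ) / (N - 1) := by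
  have hN1 : (2 : ℝ) ≤ N := by exact_mod_cast hN
  rw [le_div_iff₀ (by linarith)]
  linarith

/-- Uniform exponential integrability on bounded sets of `W_0^{1,N}`. -/
lemma exists_integral_exp_le_of_energy_le (hN : 2 ≤ N) (hΩ : volume Ω ≠ ⊤) (A : ℝ) :
    ∃ α D : ℝ, 0 < α ∧ 0 ≤ D ∧ ∀ u G, MemSobolevOneZero Ω (N : ℝ≥0∞) u G →
      ∫ x in Ω, ‖G x‖ ^ N ≤ A →
      IntegrableOn (fun x => Real.exp (α * |u x| ^ ((N : ℝ) / (N - 1)))) Ω ∧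
      ∫ x in Ω, Real.exp (α * |u x| ^ ((N : ℝ) / (N - 1))) ≤ D := by
  obtain ⟨κ, C, hκ, hC, hT⟩ := exists_integral_exp_le hN hΩ
  have hq := one_le_div_pred hN
  set q := (N : ℝ) / (N - 1)
  -- With `K ≥ 1` one has `A ≤ K ≤ K ^ N`, so no root of `A` is needed.
  set K := max A 1
  have hK1 : 1 ≤ K := le_max_right _ _
  refine ⟨κ / K ^ q, C, by positivity, hC, fun u G hu hA => ?_⟩
  have hAK : ∫ x in Ω, ‖G x‖ ^ N ≤ K ^ N :=
    hA.trans ((le_max_left _ _).trans (le_self_pow₀ hK1 (by omega)))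
  have := hT u G hu K (by positivity) hAK
  have e : ∀ t : ℝ, κ / K ^ q * |t| ^ q = κ * (|t| / K) ^ q := by
    intro t
    rw [Real.div_rpow (abs_nonneg _) (by positivity)]
    ring
  simpa only [e] using this

lemma integrable_of_abs_le_exp {u h : EuclideanSpace ℝ (Fin N) → ℝ} {α C q : ℝ}
    (hh : AEStronglyMeasurable h (volume.restrict Ω))
    (hu : IntegrableOn (fun x => Real.exp (α * |u x| ^ q)) Ω)
    (hle : ∀ᵐ x ∂(volume.restrict Ω), |h x| ≤ C * Real.exp (α * |u x| ^ q)) :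
    IntegrableOn h Ω :=
  Integrable.mono' (hu.const_mul C) hh hle

/-- Convergence of integrals under exponential growth. -/
lemma tendsto_integral_of_exp_bound (hΩ : volume Ω ≠ ⊤) {u h : ℕ → EuclideanSpace ℝ (Fin N) → ℝ}
    {h₀ : EuclideanSpace ℝ (Fin N) → ℝ} {α C D q : ℝ}
    (hh : ∀ n, AEStronglyMeasurable (h n) (volume.restrict Ω))
    (hlim : ∀ᵐ x ∂(volume.restrict Ω), Tendsto (fun n => h n x) atTop (𝓝 (h₀ x)))
    (hu : ∀ n, IntegrableOn (fun x => Real.exp (α * |u n x| ^ q)) Ω)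
    (hD : ∀ n, ∫ x in Ω, Real.exp (α * |u n x| ^ q) ≤ D)
    (hle : ∀ n, ∀ᵐ x ∂(volume.restrict Ω), |h n x| ≤ C * Real.exp (α / 2 * |u n x| ^ q)) :
    IntegrableOn h₀ Ω ∧ Tendsto (fun n => ∫ x in Ω, |h n x - h₀ x|) atTop (𝓝 0) ∧
      Tendsto (fun n => ∫ x in Ω, h n x) atTop (𝓝 (∫ x in Ω, h₀ x)) := by
  have : IsFiniteMeasure (volume.restrict Ω) := ⟨by simpa using hΩ.lt_top⟩
  -- The growth rate `α / 2` doubles to `α` on squaring, so the integrands are bounded in `L^2` and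
  -- the Vitali lemma applies.
  have hsq : ∀ n, ∀ᵐ x ∂(volume.restrict Ω), h n x ^ 2 ≤ C ^ 2 * Real.exp (α * |u n x| ^ q) := by
    intro n
    filter_upwards [hle n] with x hx
    have h1 := pow_le_pow_left₀ (abs_nonneg _) hx 2
    rw [sq_abs, mul_pow, ← Real.exp_nat_mul] at h1
    refine h1.trans (le_of_eq ?_)
    congr 2; push_cast; ring
  have hint : ∀ n, IntegrableOn (fun x => h n x ^ 2) Ω := fun n => by
    refine Integrable.mono' ((hu n).const_mul (C ^ 2)) ((hh n).pow 2) ?_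
    filter_upwards [hsq n] with x hx
    rwa [Real.norm_of_nonneg (sq_nonneg _)]
  refine tendsto_integral_of_sq_bounded hh hlim (C := C ^ 2 * D) hint fun n => ?_
  refine (integral_mono_ae (hint n) ((hu n).const_mul (C ^ 2)) (hsq n)).trans ?_
  rw [integral_const_mul]
  exact mul_le_mul_of_nonneg_left (hD n) (sq_nonneg C)

end ExponentialBounds

/-! ### Carathéodory nonlinearities and their primitives. -/

section Nonlinearity

variable {N : ℕ}

/-- A nonnegative Carathéodory nonlinearity vanishing for nonpositive arguments. -/
structure IsNonlinearity (g : EuclideanSpace ℝ (Fin N) → ℝ → ℝ) : Prop where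
  measurable : Measurable fun z : EuclideanSpace ℝ (Fin N) × ℝ => g z.1 z.2
  continuous : ∀ x, Continuous (g x)
  nonneg : ∀ x t, 0 ≤ g x t
  eq_zero : ∀ x t, t ≤ 0 → g x t = 0

namespace IsNonlinearity

variable {g : EuclideanSpace ℝ (Fin N) → ℝ → ℝ}

lemma hasDerivAt_primF (hg : IsNonlinearity g) (x : EuclideanSpace ℝ (Fin N)) (t : ℝ) :
    HasDerivAt (primF g x) (g x t) t :=
  intervalIntegral.integral_hasDerivAt_right ((hg.continuous x).intervalIntegrable _ _)
    ((hg.continuous x).stronglyMeasurableAtFilter _ _) (hg.continuous x).continuousAt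

lemma continuous_primF (hg : IsNonlinearity g) (x : EuclideanSpace ℝ (Fin N)) :
    Continuous (primF g x) :=
  continuous_iff_continuousAt.2 fun t => (hg.hasDerivAt_primF x t).continuousAt

lemma monotone_primF (hg : IsNonlinearity g) (x : EuclideanSpace ℝ (Fin N)) :
    Monotone (primF g x) :=
  monotone_of_hasDerivAt_nonneg (hg.hasDerivAt_primF x) (hg.nonneg x)

@[simp] lemma _root_.primF_zero (g : EuclideanSpace ℝ (Fin N) → ℝ → ℝ)
    (x : EuclideanSpace ℝ (Fin N)) : primF g x 0 = 0 := by
  simp [primF]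

lemma primF_of_nonpos (hg : IsNonlinearity g) (x : EuclideanSpace ℝ (Fin N)) {t : ℝ} (ht : t ≤ 0) :
    primF g x t = 0 := by
  rw [primF]
  refine intervalIntegral.integral_zero_ae (ae_of_all _ fun s hs => hg.eq_zero x s ?_)
  rw [uIoc_of_ge ht] at hs
  exact hs.2

lemma primF_nonneg (hg : IsNonlinearity g) (x : EuclideanSpace ℝ (Fin N)) (t : ℝ) :
    0 ≤ primF g x t := by
  rcases le_total t 0 with h | h
  · rw [hg.primF_of_nonpos x h]
  · rw [← primF_zero g x]
    exact hg.monotone_primF x h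

lemma self_mul_nonneg (hg : IsNonlinearity g) (x : EuclideanSpace ℝ (Fin N)) (t : ℝ) :
    0 ≤ t * g x t := by
  rcases le_total t 0 with h | h
  · rw [hg.eq_zero x t h, mul_zero]
  · exact mul_nonneg h (hg.nonneg x t)

/-- Substituting `s ↦ t * s` fixes the interval of integration, so the primitive becomes a
parametric integral with a jointly measurable integrand. -/
lemma measurable_primF (hg : IsNonlinearity g) :
    Measurable fun z : EuclideanSpace ℝ (Fin N) × ℝ => primF g z.1 z.2 := by
  have e : ∀ x t, primF g x t = t * ∫ s in Ioc (0 : ℝ) 1, g x (t * s) := by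
    intro x t
    rw [← intervalIntegral.integral_of_le zero_le_one, primF]
    simp
  have h1 : Measurable fun p : (EuclideanSpace ℝ (Fin N) × ℝ) × ℝ => g p.1.1 (p.1.2 * p.2) :=
    hg.measurable.comp (measurable_fst.fst.prodMk (measurable_fst.snd.mul measurable_snd))
  have h2 : StronglyMeasurable fun z : EuclideanSpace ℝ (Fin N) × ℝ =>
      ∫ s in Ioc (0 : ℝ) 1, g z.1 (z.2 * s) := h1.stronglyMeasurable.integral_prod_right
  simp only [e]
  exact measurable_snd.mul h2.measurable

lemma primF_le_mul (hg : IsNonlinearity g) {x : EuclideanSpace ℝ (Fin N)} {t C : ℝ} (ht : 0 ≤ t)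
    (hC : ∀ s ∈ Icc 0 t, g x s ≤ C) : primF g x t ≤ C * t := by
  have := intervalIntegral.integral_mono_on (μ := volume) ht ((hg.continuous x).intervalIntegrable 0 t)
    (continuous_const.intervalIntegrable 0 t) (g := fun _ => C) hC
  simpa [primF, mul_comm] using this

variable {μ : Measure (EuclideanSpace ℝ (Fin N))} {u : EuclideanSpace ℝ (Fin N) → ℝ}

lemma aestronglyMeasurable_comp (hg : IsNonlinearity g) (hu : AEStronglyMeasurable u μ) :
    AEStronglyMeasurable (fun x => g x (u x)) μ :=
  (hg.measurable.comp_aemeasurable (aemeasurable_id.prodMk hu.aemeasurable)).aestronglyMeasurable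

lemma aestronglyMeasurable_primF (hg : IsNonlinearity g) (hu : AEStronglyMeasurable u μ) :
    AEStronglyMeasurable (fun x => primF g x (u x)) μ :=
  (hg.measurable_primF.comp_aemeasurable
    (aemeasurable_id.prodMk hu.aemeasurable)).aestronglyMeasurable

end IsNonlinearity

/-- The energy `(1/N) ∫ |∇u|^N - ∫ F(x,u)`. -/
noncomputable def energy (Ω : Set (EuclideanSpace ℝ (Fin N)))
    (g : EuclideanSpace ℝ (Fin N) → ℝ → ℝ) (u : EuclideanSpace ℝ (Fin N) → ℝ)
    (G : EuclideanSpace ℝ (Fin N) → EuclideanSpace ℝ (Fin N)) : ℝ :=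
  (1 / N) * (∫ x in Ω, ‖G x‖ ^ N) - ∫ x in Ω, primF g x (u x)

end Nonlinearity

/-! ### From test functions to all of `W_0^{1,N}` in the weak equation. -/

section WeakForm

variable {N : ℕ} {Ω : Set (EuclideanSpace ℝ (Fin N))}

/-- A smooth substitute for the absolute value: it vanishes at zero and has slope at most one, so
its composition with a test function is a test function with no larger gradient. -/
lemma smoothAbs_contDiff {ε : ℝ} (hε : 0 < ε) :
    ContDiff ℝ ∞ fun s : ℝ => √(s ^ 2 + ε ^ 2) - ε := by
  refine ContDiff.sub (ContDiff.sqrt (by fun_prop) fun s => ?_) contDiff_const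
  positivity

lemma abs_deriv_smoothAbs_le {ε : ℝ} (hε : 0 < ε) (s : ℝ) :
    |deriv (fun s : ℝ => √(s ^ 2 + ε ^ 2) - ε) s| ≤ 1 := by
  have hpos : 0 < s ^ 2 + ε ^ 2 := by positivity
  have h1 : HasDerivAt (fun s : ℝ => s ^ 2 + ε ^ 2) (2 * s) s := by
    simpa using (hasDerivAt_pow 2 s).add_const (ε ^ 2)
  have h2 := (h1.sqrt hpos.ne').sub_const ε
  rw [h2.deriv, abs_div, abs_of_pos (by positivity : 0 < 2 * √(s ^ 2 + ε ^ 2)),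
    div_le_one (by positivity), abs_mul, abs_two]
  gcongr
  refine Real.le_sqrt_of_sq_le ?_
  rw [sq_abs]
  nlinarith [sq_nonneg ε]

lemma smoothAbs_mem {ε : ℝ} (hε : 0 < ε) (s : ℝ) :
    0 ≤ √(s ^ 2 + ε ^ 2) - ε ∧ √(s ^ 2 + ε ^ 2) - ε ≤ |s| ∧ |s| - ε ≤ √(s ^ 2 + ε ^ 2) - ε := by
  refine ⟨?_, ?_, ?_⟩
  · rw [sub_nonneg]
    exact Real.le_sqrt_of_sq_le (by nlinarith [sq_nonneg s])
  · rw [sub_le_iff_le_add]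
    refine Real.sqrt_le_iff.2 ⟨by positivity, ?_⟩
    rw [← sq_abs s]
    nlinarith [abs_nonneg s]
  · gcongr
    refine Real.le_sqrt_of_sq_le ?_
    rw [sq_abs]
    nlinarith [sq_nonneg ε]

/-- If the nonnegative function `g₀` represents `-div (|G|^{N-2} G)` on test functions, then it
does so on all of `W_0^{1,N}`. -/
theorem weakForm_of_isTestFunction (hN : 2 ≤ N)
    {G : EuclideanSpace ℝ (Fin N) → EuclideanSpace ℝ (Fin N)}
    (hG : MemLp G N (volume.restrict Ω)) {g₀ : EuclideanSpace ℝ (Fin N) → ℝ}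
    (hg₀ : AEStronglyMeasurable g₀ (volume.restrict Ω))
    (hpos : ∀ᵐ x ∂(volume.restrict Ω), 0 ≤ g₀ x)
    (hint : ∀ φ, IsTestFunction Ω φ → IntegrableOn (fun x => g₀ x * φ x) Ω)
    (heq : ∀ φ, IsTestFunction Ω φ →
      ∫ x in Ω, ‖G x‖ ^ (N - 2) * inner ℝ (G x) (gradient φ x) = ∫ x in Ω, g₀ x * φ x)
    {v : EuclideanSpace ℝ (Fin N) → ℝ} {V : EuclideanSpace ℝ (Fin N) → EuclideanSpace ℝ (Fin N)}
    (hv : MemSobolevOneZero Ω (N : ℝ≥0∞) v V) :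
    IntegrableOn (fun x => g₀ x * v x) Ω ∧
      ∫ x in Ω, ‖G x‖ ^ (N - 2) * inner ℝ (G x) (V x) = ∫ x in Ω, g₀ x * v x := by
  have hN0 : N ≠ 0 := by omega
  set A := ∫ x in Ω, ‖G x‖ ^ N with hA
  have hA0 : 0 ≤ A := integral_nonneg fun x => by positivity
  -- No integrability of `g₀` up to the boundary is known, so Hölder is not available. Testing the
  -- equation with smoothed absolute values of `φ` bounds `∫ g₀ |φ|` by gradients alone; this uses
  -- `g₀ ≥ 0`.
  have habs : ∀ δ > 0, ∃ K : ℝ, 0 ≤ K ∧ ∀ φ, IsTestFunction Ω φ →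
      ∫ x in Ω, g₀ x * |φ x| ≤ δ * A + K * ∫ x in Ω, ‖gradient φ x‖ ^ N := by
    intro δ hδ
    obtain ⟨K, hK, hle⟩ := exists_abs_pow_mul_inner_le (H := EuclideanSpace ℝ (Fin N)) hN hδ
    refine ⟨K, hK, fun φ hφ => ?_⟩
    have hε : ∀ n : ℕ, (0 : ℝ) < 1 / ((n : ℝ) + 1) := fun n => Nat.one_div_pos_of_nat
    have i1 := hG.integrable_norm_pow hN0
    have i2 := (hφ.memLp_gradient N Ω).integrable_norm_pow hN0
    have hb : ∀ n : ℕ, ∫ x in Ω, g₀ x * (√(φ x ^ 2 + (1 / ((n : ℝ) + 1)) ^ 2) - 1 / ((n : ℝ) + 1))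
        ≤ δ * A + K * ∫ x in Ω, ‖gradient φ x‖ ^ N := by
      intro n
      have hψ := hφ.comp_left (smoothAbs_contDiff (hε n)) (by
        simp only [ne_eq, OfNat.ofNat_ne_zero, not_false_eq_true, zero_pow, zero_add]
        rw [Real.sqrt_sq (hε n).le, sub_self])
      rw [← heq _ hψ]
      have e : ∀ x, ‖gradient (fun x => √(φ x ^ 2 + (1 / ((n : ℝ) + 1)) ^ 2)
          - 1 / ((n : ℝ) + 1)) x‖ ≤ ‖gradient φ x‖ := by
        intro x
        have := hφ.gradient_comp_left ((smoothAbs_contDiff (hε n)).differentiable (by simp)) x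
        rw [this, norm_smul]
        exact mul_le_of_le_one_left (norm_nonneg _) (abs_deriv_smoothAbs_le (hε n) _)
      rw [hA, ← integral_const_mul, ← integral_const_mul,
        ← integral_add (i1.const_mul δ) (i2.const_mul K)]
      refine integral_mono (integrable_pow_mul_inner hN hG (hψ.memLp_gradient N Ω))
        ((i1.const_mul δ).add (i2.const_mul K)) fun x => ?_
      refine (le_abs_self _).trans ((hle _ _).trans ?_)
      gcongr
      exact e x
    refine le_of_tendsto' (tendsto_integral_of_dominated_convergence
      (fun x => |g₀ x * φ x|) (fun n => ?_) (hint φ hφ).abs (fun n => ?_) ?_) hb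
    · refine hg₀.mul (Continuous.aestronglyMeasurable ?_)
      have := hφ.continuous
      fun_prop
    · refine ae_of_all _ fun x => ?_
      rw [norm_mul, abs_mul, Real.norm_eq_abs, Real.norm_eq_abs]
      refine mul_le_mul_of_nonneg_left ?_ (abs_nonneg _)
      rw [abs_of_nonneg (smoothAbs_mem (hε n) _).1]
      exact (smoothAbs_mem (hε n) _).2.1
    · refine ae_of_all _ fun x => Tendsto.const_mul _ ?_
      have h0 := tendsto_one_div_add_atTop_nhds_zero_nat (𝕜 := ℝ)
      refine tendsto_of_tendsto_of_tendsto_of_le_of_le (g := fun n : ℕ => |φ x| - 1 / ((n : ℝ) + 1))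
        (h := fun _ => |φ x|) ?_ tendsto_const_nhds
        (fun n => (smoothAbs_mem (hε n) _).2.2) (fun n => (smoothAbs_mem (hε n) _).2.1)
      simpa using h0.const_sub |φ x|
  obtain ⟨φ, hφ, -, h2, hae⟩ := hv.exists_approx_ae (by omega)
  -- The bound is used for `φ m - φ n`; Fatou's lemma as `m → ∞` gives both integrability and
  -- smallness of `g₀ * |v - φ n|`.
  have hclose : ∀ ε > 0, ∃ n₀, ∀ n ≥ n₀, IntegrableOn (fun x => g₀ x * |v x - φ n x|) Ω ∧
      ∫ x in Ω, g₀ x * |v x - φ n x| ≤ ε := by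
    intro ε hε
    obtain ⟨K, hK, hle⟩ := habs (ε / (2 * (A + 1))) (by positivity)
    have hη : 0 < ε / (2 ^ (N - 1) * 4 * (K + 1)) := by positivity
    obtain ⟨n₀, hn₀⟩ := eventually_atTop.1 (h2.eventually_lt_const hη)
    refine ⟨n₀, fun n hn => ?_⟩
    refine integrable_of_tendsto_of_integral_le (h := fun m x => g₀ x * |φ m x - φ n x|)
      (fun m => ?_) (fun m => ?_) ?_ ?_
    · refine (hint _ ((hφ m).sub (hφ n))).abs.congr ?_
      filter_upwards [hpos] with x hx
      simp [abs_mul, abs_of_nonneg hx]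
    · filter_upwards [hpos] with x hx
      exact mul_nonneg hx (abs_nonneg _)
    · filter_upwards [hae] with x hx
      exact ((hx.sub_const (φ n x)).abs).const_mul _
    · filter_upwards [eventually_ge_atTop n₀] with m hm
      have h3 := hle _ ((hφ m).sub (hφ n))
      simp only [Pi.sub_apply] at h3
      refine h3.trans ?_
      have i3 := (((hφ m).memLp_gradient N Ω).sub hv.memLp_grad).integrable_norm_pow hN0
      have i4 := (((hφ n).memLp_gradient N Ω).sub hv.memLp_grad).integrable_norm_pow hN0
      simp only [Pi.sub_apply] at i3 i4
      have h4 : ∫ x in Ω, ‖gradient (φ m - φ n) x‖ ^ N ≤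
          ∫ x in Ω, 2 ^ (N - 1) * (‖gradient (φ m) x - V x‖ ^ N + ‖gradient (φ n) x - V x‖ ^ N) := by
        refine integral_mono ((((hφ m).sub (hφ n)).memLp_gradient N Ω).integrable_norm_pow hN0)
          ((i3.add i4).const_mul _) fun x => ?_
        simp only [(hφ m).gradient_sub (hφ n)]
        refine le_trans ?_ (add_pow_le (norm_nonneg _) (norm_nonneg _) N)
        gcongr
        refine le_trans (le_of_eq ?_) (norm_sub_le _ _)
        congr 1; abel
      rw [integral_const_mul, integral_add i3 i4] at h4
      have h5 := hn₀ m hm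
      have h6 := hn₀ n hn
      have h7 : K * ∫ x in Ω, ‖gradient (φ m - φ n) x‖ ^ N ≤ ε / 2 := by
        calc K * ∫ x in Ω, ‖gradient (φ m - φ n) x‖ ^ N
            ≤ (K + 1) * (2 ^ (N - 1) * (ε / (2 ^ (N - 1) * 4 * (K + 1))
              + ε / (2 ^ (N - 1) * 4 * (K + 1)))) := by
              refine mul_le_mul (by linarith) (h4.trans ?_)
                (integral_nonneg fun x => by positivity) (by positivity)
              gcongr
          _ = ε / 2 := by field_simp; norm_num
      have h8 : ε / (2 * (A + 1)) * A ≤ ε / 2 := by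
        rw [div_mul_eq_mul_div, div_le_div_iff₀ (by positivity) (by norm_num)]
        nlinarith
      linarith
  have hdiff : ∀ n, AEStronglyMeasurable (fun x => g₀ x * (v x - φ n x)) (volume.restrict Ω) :=
    fun n => hg₀.mul (hv.memLp.1.sub ((hφ n).memLp (N : ℝ≥0∞) Ω).1)
  have hinteg : ∀ n, IntegrableOn (fun x => g₀ x * |v x - φ n x|) Ω →
      IntegrableOn (fun x => g₀ x * v x) Ω := by
    intro n hn
    have h3 : IntegrableOn (fun x => g₀ x * (v x - φ n x)) Ω := by
      refine Integrable.mono' hn (hdiff n) ?_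
      filter_upwards [hpos] with x hx
      rw [Real.norm_eq_abs, abs_mul, abs_of_nonneg hx]
    refine (h3.add (hint _ (hφ n))).congr (ae_of_all _ fun x => ?_)
    simp only [Pi.add_apply]; ring
  obtain ⟨n₁, hn₁⟩ := hclose 1 one_pos
  have hvi := hinteg n₁ (hn₁ n₁ le_rfl).1
  refine ⟨hvi, ?_⟩
  have t1 := tendsto_integral_pow_mul_inner_right hN (fun n => (hφ n).memLp_gradient N Ω) hG
    hv.memLp_grad h2
  have t2 : Tendsto (fun n => ∫ x in Ω, g₀ x * φ n x) atTop (𝓝 (∫ x in Ω, g₀ x * v x)) := by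
    rw [Metric.tendsto_atTop]
    intro ε hε
    obtain ⟨n₀, hn₀⟩ := hclose (ε / 2) (half_pos hε)
    refine ⟨n₀, fun n hn => ?_⟩
    rw [Real.dist_eq, ← integral_sub (hint _ (hφ n)) hvi]
    refine lt_of_le_of_lt (abs_integral_le_integral_abs.trans ?_) (half_lt_self hε)
    refine le_trans (le_of_eq ?_) (hn₀ n hn).2
    refine integral_congr_ae ?_
    filter_upwards [hpos] with x hx
    rw [← mul_sub, abs_mul, abs_of_nonneg hx, abs_sub_comm]
  simp only [heq _ (hφ _)] at t1
  exact tendsto_nhds_unique t1 t2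

end WeakForm

/-! ### The energy as a function of finitely many coefficients. -/

section Galerkin

variable {N : ℕ} {Ω : Set (EuclideanSpace ℝ (Fin N))} {d : ℕ}
  {φ : Fin d → EuclideanSpace ℝ (Fin N) → ℝ} {g : EuclideanSpace ℝ (Fin N) → ℝ → ℝ}

lemma IsTestFunction.sum (hφ : ∀ i, IsTestFunction Ω (φ i)) (a : Fin d → ℝ) (s : Finset (Fin d)) :
    IsTestFunction Ω (∑ i ∈ s, a i • φ i) ∧
      ∀ x, gradient (∑ i ∈ s, a i • φ i) x = ∑ i ∈ s, a i • gradient (φ i) x := by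
  induction s using Finset.cons_induction with
  | empty =>
    refine ⟨by simpa using IsTestFunction.zero, fun x => ?_⟩
    simp only [Finset.sum_empty]
    exact gradient_const x 0
  | cons i s his ih =>
    rw [Finset.sum_cons]
    refine ⟨((hφ i).smul (a i)).add ih.1, fun x => ?_⟩
    rw [((hφ i).smul (a i)).gradient_add ih.1, (hφ i).gradient_smul, ih.2, Finset.sum_cons]

/-- The gradient of a linear combination of test functions, as a linear function of the
coefficients. -/
noncomputable def combGradient (φ : Fin d → EuclideanSpace ℝ (Fin N) → ℝ)
    (x : EuclideanSpace ℝ (Fin N)) : EuclideanSpace ℝ (Fin d) →L[ℝ] EuclideanSpace ℝ (Fin N) :=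
  ∑ i, (EuclideanSpace.proj i : EuclideanSpace ℝ (Fin d) →L[ℝ] ℝ).smulRight (gradient (φ i) x)

/-- The value of a linear combination of functions, as a linear function of the coefficients. -/
noncomputable def combValue (φ : Fin d → EuclideanSpace ℝ (Fin N) → ℝ)
    (x : EuclideanSpace ℝ (Fin N)) : EuclideanSpace ℝ (Fin d) →L[ℝ] ℝ :=
  ∑ i, φ i x • (EuclideanSpace.proj i : EuclideanSpace ℝ (Fin d) →L[ℝ] ℝ)

lemma combGradient_apply (x : EuclideanSpace ℝ (Fin N)) (a : EuclideanSpace ℝ (Fin d)) :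
    combGradient φ x a = ∑ i, a i • gradient (φ i) x := by
  simp [combGradient]

lemma combValue_apply (x : EuclideanSpace ℝ (Fin N)) (a : EuclideanSpace ℝ (Fin d)) :
    combValue φ x a = (∑ i, a i • φ i) x := by
  simp [combValue, mul_comm]

/-- The integrand of the gradient of the energy restricted to linear combinations. -/
noncomputable def galerkinField (g : EuclideanSpace ℝ (Fin N) → ℝ → ℝ)
    (φ : Fin d → EuclideanSpace ℝ (Fin N) → ℝ) (a : EuclideanSpace ℝ (Fin d))
    (x : EuclideanSpace ℝ (Fin N)) : EuclideanSpace ℝ (Fin d) :=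
  WithLp.toLp 2 fun i => ‖combGradient φ x a‖ ^ (N - 2) * inner ℝ (combGradient φ x a)
    (gradient (φ i) x) - g x (combValue φ x a) * φ i x

/-- By linearity, pairing the field with `b` is testing the equation with the combination that has
coefficients `b`. -/
lemma inner_galerkinField (a b : EuclideanSpace ℝ (Fin d)) (x : EuclideanSpace ℝ (Fin N)) :
    inner ℝ (galerkinField g φ a x) b = ‖combGradient φ x a‖ ^ (N - 2) *
      inner ℝ (combGradient φ x a) (combGradient φ x b) - g x (combValue φ x a) * combValue φ x b := by
  rw [combGradient_apply x b, combValue_apply x b, inner_sum, Finset.mul_sum, PiLp.inner_apply]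
  simp only [Finset.sum_apply, Pi.smul_apply, smul_eq_mul, Finset.mul_sum, inner_smul_right]
  rw [← Finset.sum_sub_distrib]
  refine Finset.sum_congr rfl fun i _ => ?_
  simp [galerkinField]
  ring

lemma hasFDerivAt_norm_pow (hN : 2 ≤ N) {F : Type*} [NormedAddCommGroup F] [InnerProductSpace ℝ F]
    (v : F) : HasFDerivAt (fun v : F => ‖v‖ ^ N) (((N : ℝ) * ‖v‖ ^ (N - 2)) • innerSL ℝ v) v := by
  have h := hasFDerivAt_norm_rpow v (p := N) (by exact_mod_cast (by omega : 1 < N))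
  have e : (N : ℝ) - 2 = ((N - 2 : ℕ) : ℝ) := by push_cast [hN]; ring
  rw [e] at h
  simpa only [Real.rpow_natCast] using h

lemma hasGradientAt_galerkin (hN : 2 ≤ N) (hg : IsNonlinearity g) (a : EuclideanSpace ℝ (Fin d))
    (x : EuclideanSpace ℝ (Fin N)) :
    HasGradientAt (fun a => (1 / N : ℝ) * ‖combGradient φ x a‖ ^ N - primF g x (combValue φ x a))
      (galerkinField g φ a x) a := by
  rw [hasGradientAt_iff_hasFDerivAt]
  have hN0 : (N : ℝ) ≠ 0 := by exact_mod_cast (by omega : N ≠ 0)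
  have h1 := ((hasFDerivAt_norm_pow hN (combGradient φ x a)).comp a
    (combGradient φ x).hasFDerivAt).const_mul (1 / N : ℝ)
  have h2 := (hg.hasDerivAt_primF x (combValue φ x a)).comp_hasFDerivAt a
    (combValue φ x).hasFDerivAt
  refine (h1.sub h2).congr_fderiv ?_
  ext1 b
  rw [InnerProductSpace.toDual_apply_apply, inner_galerkinField]
  simp
  field_simp

lemma exists_uniform_bound (hφ : ∀ i, IsTestFunction Ω (φ i)) :
    ∃ M : ℝ, 0 ≤ M ∧ ∀ i x, |φ i x| ≤ M ∧ ‖gradient (φ i) x‖ ≤ M := by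
  choose C hC using fun i => (hφ i).exists_bound
  choose C' hC' using fun i => (hφ i).exists_bound_gradient
  have h0 : ∀ i, 0 ≤ C i := fun i => (abs_nonneg _).trans (hC i 0)
  have h0' : ∀ i, 0 ≤ C' i := fun i => (norm_nonneg _).trans (hC' i 0)
  refine ⟨∑ i, (C i + C' i), Finset.sum_nonneg fun i _ => add_nonneg (h0 i) (h0' i),
    fun i x => ?_⟩
  have h1 : C i + C' i ≤ ∑ i, (C i + C' i) :=
    Finset.single_le_sum (f := fun i => C i + C' i) (fun i _ => add_nonneg (h0 i) (h0' i))
      (Finset.mem_univ i)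
  exact ⟨(hC i x).trans (by linarith [h0' i]), (hC' i x).trans (by linarith [h0 i])⟩

lemma abs_coord_le_norm (a : EuclideanSpace ℝ (Fin d)) (i : Fin d) : |a i| ≤ ‖a‖ :=
  PiLp.norm_apply_le a i

lemma norm_combGradient_le {M : ℝ} (hM : ∀ i x, |φ i x| ≤ M ∧ ‖gradient (φ i) x‖ ≤ M)
    (a : EuclideanSpace ℝ (Fin d)) (x : EuclideanSpace ℝ (Fin N)) :
    ‖combGradient φ x a‖ ≤ d * (‖a‖ * M) := by
  rw [combGradient_apply]
  refine (norm_sum_le _ _).trans ?_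
  refine (Finset.sum_le_card_nsmul _ _ (‖a‖ * M) fun i _ => ?_).trans (by simp)
  rw [norm_smul]
  exact mul_le_mul (abs_coord_le_norm a i) (hM i x).2 (norm_nonneg _) (norm_nonneg _)

lemma abs_combValue_le {M : ℝ} (hM : ∀ i x, |φ i x| ≤ M ∧ ‖gradient (φ i) x‖ ≤ M)
    (a : EuclideanSpace ℝ (Fin d)) (x : EuclideanSpace ℝ (Fin N)) :
    |combValue φ x a| ≤ d * (‖a‖ * M) := by
  rw [combValue_apply, Finset.sum_apply]
  refine (Finset.abs_sum_le_sum_abs _ _).trans ?_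
  refine (Finset.sum_le_card_nsmul _ _ (‖a‖ * M) fun i _ => ?_).trans (by simp)
  rw [Pi.smul_apply, smul_eq_mul, abs_mul]
  exact mul_le_mul (abs_coord_le_norm a i) (hM i x).1 (abs_nonneg _) (norm_nonneg _)

lemma norm_le_sum_abs_coord (y : EuclideanSpace ℝ (Fin d)) : ‖y‖ ≤ ∑ i, |y i| := by
  have e : y = ∑ i, EuclideanSpace.single i (y i) := by
    ext j; simp
  conv_lhs => rw [e]
  refine (norm_sum_le _ _).trans (le_of_eq ?_)
  simp

/-- The constant dominating function for differentiation under the integral sign; test functions are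
bounded, so polynomial growth of `g` is more than enough. -/
lemma exists_norm_galerkinField_le (hφ : ∀ i, IsTestFunction Ω (φ i)) (hg : IsNonlinearity g)
    {C : ℝ} {p : ℕ} (hgrow : ∀ x t, g x t ≤ C * (1 + |t| ^ p)) (r : ℝ) :
    ∃ K : ℝ, ∀ a x, ‖a‖ ≤ r → ‖galerkinField g φ a x‖ ≤ K := by
  obtain ⟨M, hM0, hM⟩ := exists_uniform_bound hφ
  have hC0 : 0 ≤ C := by
    have := (hg.nonneg 0 0).trans (hgrow 0 0)
    have h2 : (0 : ℝ) < 1 + |(0 : ℝ)| ^ p := by positivity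
    exact nonneg_of_mul_nonneg_left this h2
  set B := d * (r * M) with hB
  refine ⟨d * (B ^ (N - 2) * (B * M) + C * (1 + B ^ p) * M), fun a x ha => ?_⟩
  have hr : 0 ≤ r := (norm_nonneg a).trans ha
  have h1 : ‖combGradient φ x a‖ ≤ B := (norm_combGradient_le hM a x).trans (by rw [hB]; gcongr)
  have h2 : |combValue φ x a| ≤ B := (abs_combValue_le hM a x).trans (by rw [hB]; gcongr)
  have hB0 : 0 ≤ B := (norm_nonneg _).trans h1
  refine (norm_le_sum_abs_coord _).trans ?_
  refine (Finset.sum_le_card_nsmul _ _ (B ^ (N - 2) * (B * M) + C * (1 + B ^ p) * M)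
    fun i _ => ?_).trans (by rw [Finset.card_univ, Fintype.card_fin, nsmul_eq_mul])
  simp only [galerkinField]
  refine (abs_sub _ _).trans (add_le_add ?_ ?_)
  · rw [abs_mul, abs_of_nonneg (by positivity)]
    gcongr
    refine (abs_real_inner_le_norm _ _).trans ?_
    gcongr
    exact (hM i x).2
  · rw [abs_mul, abs_of_nonneg (hg.nonneg _ _)]
    gcongr
    · refine (hgrow _ _).trans ?_
      gcongr
    · exact (hM i x).1

lemma continuous_galerkinField (hg : IsNonlinearity g) (x : EuclideanSpace ℝ (Fin N)) :
    Continuous fun a => galerkinField g φ a x := by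
  refine (PiLp.continuous_toLp 2 _).comp (continuous_pi fun i => ?_)
  have := hg.continuous x
  fun_prop

lemma continuous_combGradient (hφ : ∀ i, IsTestFunction Ω (φ i)) (a : EuclideanSpace ℝ (Fin d)) :
    Continuous fun x => combGradient φ x a := by
  simp only [combGradient_apply]
  refine continuous_finsetSum _ fun i _ => ?_
  have := (hφ i).continuous_gradient
  fun_prop

lemma continuous_combValue (hφ : ∀ i, IsTestFunction Ω (φ i)) (a : EuclideanSpace ℝ (Fin d)) :
    Continuous fun x => combValue φ x a := by
  simp only [combValue_apply, Finset.sum_apply, Pi.smul_apply]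
  refine continuous_finsetSum _ fun i _ => ?_
  have := (hφ i).continuous
  fun_prop

lemma measurable_galerkinField (hφ : ∀ i, IsTestFunction Ω (φ i)) (hg : IsNonlinearity g)
    (a : EuclideanSpace ℝ (Fin d)) : Measurable fun x => galerkinField g φ a x := by
  refine (PiLp.continuous_toLp 2 _).measurable.comp (measurable_pi_lambda _ fun i => ?_)
  have h1 := continuous_combGradient hφ a
  have h2 := (continuous_combValue hφ a).measurable
  have h3 := (hφ i).continuous_gradient
  refine Measurable.sub (Continuous.measurable (by fun_prop)) ?_
  exact (hg.measurable.comp (measurable_id.prodMk h2)).mul (hφ i).continuous.measurable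

/-- The energy of a linear combination of test functions. -/
noncomputable def combEnergy (Ω : Set (EuclideanSpace ℝ (Fin N)))
    (g : EuclideanSpace ℝ (Fin N) → ℝ → ℝ) (φ : Fin d → EuclideanSpace ℝ (Fin N) → ℝ)
    (a : EuclideanSpace ℝ (Fin d)) : ℝ :=
  ∫ x in Ω, ((1 / N : ℝ) * ‖combGradient φ x a‖ ^ N - primF g x (combValue φ x a))

lemma integrable_galerkinField (hΩ : volume Ω ≠ ⊤) (hφ : ∀ i, IsTestFunction Ω (φ i))
    (hg : IsNonlinearity g) {C : ℝ} {p : ℕ} (hgrow : ∀ x t, g x t ≤ C * (1 + |t| ^ p))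
    (a : EuclideanSpace ℝ (Fin d)) : IntegrableOn (galerkinField g φ a) Ω := by
  have : IsFiniteMeasure (volume.restrict Ω) := ⟨by simpa using hΩ.lt_top⟩
  obtain ⟨K, hK⟩ := exists_norm_galerkinField_le hφ hg hgrow ‖a‖
  exact Integrable.of_bound (measurable_galerkinField hφ hg a).aestronglyMeasurable K
    (ae_of_all _ fun x => hK a x le_rfl)

lemma integrable_primF_of_bounded (hΩ : volume Ω ≠ ⊤) (hg : IsNonlinearity g) {C : ℝ} {p : ℕ}
    (hgrow : ∀ x t, g x t ≤ C * (1 + |t| ^ p)) {u : EuclideanSpace ℝ (Fin N) → ℝ}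
    (hu : AEStronglyMeasurable u (volume.restrict Ω)) {B : ℝ} (hB : ∀ x, |u x| ≤ B) :
    IntegrableOn (fun x => primF g x (u x)) Ω := by
  have : IsFiniteMeasure (volume.restrict Ω) := ⟨by simpa using hΩ.lt_top⟩
  have hB0 : 0 ≤ B := (abs_nonneg _).trans (hB 0)
  have hC0 : 0 ≤ C := by
    have := (hg.nonneg 0 0).trans (hgrow 0 0)
    have h2 : (0 : ℝ) < 1 + |(0 : ℝ)| ^ p := by positivity
    exact nonneg_of_mul_nonneg_left this h2
  refine Integrable.of_bound (hg.aestronglyMeasurable_primF hu) (C * (1 + B ^ p) * B)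
    (ae_of_all _ fun x => ?_)
  rw [Real.norm_of_nonneg (hg.primF_nonneg _ _)]
  refine (hg.monotone_primF x ((le_abs_self _).trans (hB x))).trans
    (hg.primF_le_mul hB0 fun s hs => (hgrow x s).trans ?_)
  have : |s| ≤ B := by rw [abs_of_nonneg hs.1]; exact hs.2
  gcongr

lemma combEnergy_eq (hΩ : volume Ω ≠ ⊤) (hφ : ∀ i, IsTestFunction Ω (φ i))
    (hg : IsNonlinearity g) {C : ℝ} {p : ℕ} (hgrow : ∀ x t, g x t ≤ C * (1 + |t| ^ p)) (hN : 2 ≤ N)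
    (a : EuclideanSpace ℝ (Fin d)) :
    combEnergy Ω g φ a = energy Ω g (∑ i, a i • φ i) (gradient (∑ i, a i • φ i)) := by
  have hs := IsTestFunction.sum hφ a Finset.univ
  have e : ∀ x, combGradient φ x a = gradient (∑ i, a i • φ i) x := fun x => by
    rw [combGradient_apply, hs.2]
  obtain ⟨B, hB⟩ := hs.1.exists_bound
  rw [combEnergy, energy]
  simp only [combValue_apply, e]
  rw [integral_sub, integral_const_mul]
  · exact ((hs.1.memLp_gradient N Ω).integrable_norm_pow (by omega)).const_mul _
  · exact integrable_primF_of_bounded hΩ hg hgrow (hs.1.memLp 1 Ω).1 hB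

/-- Differentiation under the integral, with the uniform bound on the unit ball about `a` as
dominating function. -/
lemma hasGradientAt_combEnergy (hN : 2 ≤ N) (hΩ : volume Ω ≠ ⊤) (hφ : ∀ i, IsTestFunction Ω (φ i))
    (hg : IsNonlinearity g) {C : ℝ} {p : ℕ} (hgrow : ∀ x t, g x t ≤ C * (1 + |t| ^ p))
    (a : EuclideanSpace ℝ (Fin d)) :
    HasGradientAt (combEnergy Ω g φ) (∫ x in Ω, galerkinField g φ a x) a := by
  have : IsFiniteMeasure (volume.restrict Ω) := ⟨by simpa using hΩ.lt_top⟩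
  obtain ⟨K, hK⟩ := exists_norm_galerkinField_le hφ hg hgrow (‖a‖ + 1)
  have hmeas : ∀ b : EuclideanSpace ℝ (Fin d), AEStronglyMeasurable (fun x =>
      (1 / N : ℝ) * ‖combGradient φ x b‖ ^ N - primF g x (combValue φ x b))
      (volume.restrict Ω) := by
    intro b
    have h1 := continuous_combGradient hφ b
    refine AEStronglyMeasurable.sub (Continuous.aestronglyMeasurable (by fun_prop)) ?_
    exact hg.aestronglyMeasurable_primF (continuous_combValue hφ b).aestronglyMeasurable
  have h := hasFDerivAt_integral_of_dominated_of_fderiv_le (𝕜 := ℝ) (μ := volume.restrict Ω)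
    (F := fun b x => (1 / N : ℝ) * ‖combGradient φ x b‖ ^ N - primF g x (combValue φ x b))
    (F' := fun b x => InnerProductSpace.toDual ℝ _ (galerkinField g φ b x)) (x₀ := a)
    (s := Metric.ball a 1) (bound := fun _ => K) (Metric.ball_mem_nhds a one_pos)
    (Eventually.of_forall hmeas) ?_ ?_ ?_ (integrable_const K) ?_
  · rw [hasGradientAt_iff_hasFDerivAt]
    refine h.congr_fderiv ?_
    ext1 b
    rw [InnerProductSpace.toDual_apply_apply, ContinuousLinearMap.integral_apply, real_inner_comm,
      ← integral_inner (integrable_galerkinField hΩ hφ hg hgrow a)]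
    · refine integral_congr_ae (ae_of_all _ fun x => ?_)
      simp only [InnerProductSpace.toDual_apply_apply]
      rw [real_inner_comm]
    · exact (InnerProductSpace.toDual ℝ
        (EuclideanSpace ℝ (Fin d))).toContinuousLinearEquiv.toContinuousLinearMap.integrable_comp
        (integrable_galerkinField hΩ hφ hg hgrow a)
  · have hs := IsTestFunction.sum hφ a Finset.univ
    have e : ∀ x, combGradient φ x a = gradient (∑ i, a i • φ i) x := fun x => by
      rw [combGradient_apply, hs.2]
    obtain ⟨B, hB⟩ := hs.1.exists_bound
    simp only [combValue_apply, e]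
    exact (((hs.1.memLp_gradient N Ω).integrable_norm_pow (by omega)).const_mul _).sub
      (integrable_primF_of_bounded hΩ hg hgrow (hs.1.memLp 1 Ω).1 hB)
  · exact (InnerProductSpace.toDual ℝ (EuclideanSpace ℝ (Fin d))).continuous.comp_aestronglyMeasurable
      (measurable_galerkinField hφ hg a).aestronglyMeasurable
  · refine ae_of_all _ fun x b hb => ?_
    rw [LinearIsometryEquiv.norm_map]
    refine hK b x ?_
    have h1 := norm_sub_norm_le b a
    rw [Metric.mem_ball, dist_eq_norm] at hb
    linarith
  · exact ae_of_all _ fun x b _ => (hasGradientAt_galerkin hN hg b x).hasFDerivAt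

lemma continuous_integral_galerkinField (hΩ : volume Ω ≠ ⊤)
    (hφ : ∀ i, IsTestFunction Ω (φ i)) (hg : IsNonlinearity g) {C : ℝ} {p : ℕ}
    (hgrow : ∀ x t, g x t ≤ C * (1 + |t| ^ p)) :
    Continuous fun a => ∫ x in Ω, galerkinField g φ a x := by
  have : IsFiniteMeasure (volume.restrict Ω) := ⟨by simpa using hΩ.lt_top⟩
  refine continuous_iff_continuousAt.2 fun a => ?_
  obtain ⟨K, hK⟩ := exists_norm_galerkinField_le hφ hg hgrow (‖a‖ + 1)
  refine continuousAt_of_dominated (bound := fun _ => K)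
    (Eventually.of_forall fun b => (measurable_galerkinField hφ hg b).aestronglyMeasurable) ?_
    (integrable_const K) (ae_of_all _ fun x => (continuous_galerkinField hg x).continuousAt)
  filter_upwards [Metric.ball_mem_nhds a one_pos] with b hb
  refine ae_of_all _ fun x => hK b x ?_
  have h1 := norm_sub_norm_le b a
  rw [Metric.mem_ball, dist_eq_norm] at hb
  linarith

end Galerkin

/-! ### Mountain pass points in finite dimensional subspaces. -/

section GalerkinCriticalPoint

variable {N : ℕ} {Ω : Set (EuclideanSpace ℝ (Fin N))}

/-- The `L^1` Poincaré inequality, followed by continuity. It makes the energy norm definite on the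
Galerkin spaces. -/
lemma IsTestFunction.eq_zero_of_integral_gradient_eq_zero (hN : 1 ≤ N)
    (hΩb : Bornology.IsBounded Ω) {φ : EuclideanSpace ℝ (Fin N) → ℝ} (hφ : IsTestFunction Ω φ)
    (h : ∫ x in Ω, ‖gradient φ x‖ ^ N = 0) : φ = 0 := by
  have hN0 : N ≠ 0 := by omega
  obtain ⟨R, hR0, hR⟩ := hΩb.subset_ball_lt 0 0
  have h1 : ∫ x, ‖gradient φ x‖ ^ N = 0 := by
    rw [← h, setIntegral_eq_integral_of_forall_compl_eq_zero]
    intro x hx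
    rw [hφ.gradient_eq_zero_of_notMem hx, norm_zero, zero_pow hN0]
  have hint : Integrable (fun x => ‖gradient φ x‖ ^ N) volume := by
    have := (hφ.memLp_gradient N univ).integrable_norm_pow hN0
    rwa [Measure.restrict_univ] at this
  have h2 := (integral_eq_zero_iff_of_nonneg (fun x => by positivity) hint).1 h1
  have h3 : ∫ x, ‖gradient φ x‖ = 0 := by
    refine integral_eq_zero_of_ae ?_
    filter_upwards [h2] with x hx
    exact pow_eq_zero_iff hN0 |>.1 hx
  have h4 := hφ.integral_abs_le hN hR0 hR
  rw [h3, mul_zero] at h4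
  have h5 := (integral_eq_zero_iff_of_nonneg (fun x => abs_nonneg (φ x)) hφ.integrable.abs).1
    (le_antisymm h4 (integral_nonneg fun x => abs_nonneg _))
  have h6 : φ =ᵐ[volume] 0 := by
    filter_upwards [h5] with x hx
    exact abs_eq_zero.1 hx
  exact (Continuous.ae_eq_iff_eq volume hφ.continuous continuous_zero).1 h6

/-- Critical points of the energy on a finite dimensional space of test functions. -/
theorem exists_galerkin_criticalPoint (hN : 2 ≤ N) (hΩb : Bornology.IsBounded Ω)
    {g : EuclideanSpace ℝ (Fin N) → ℝ → ℝ} (hg : IsNonlinearity g)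
    {C : ℝ} {p : ℕ} (hgrow : ∀ x t, g x t ≤ C * (1 + |t| ^ p))
    {μ C' : ℝ} (hμ : (N : ℝ) < μ) (hAR : ∀ x t, μ * primF g x t ≤ t * g x t + C')
    {ρ α β : ℝ} (hρ : 0 ≤ ρ) (hα : 0 < α)
    (hring : ∀ φ, IsTestFunction Ω φ → ∫ x in Ω, ‖gradient φ x‖ ^ N = ρ ^ N →
      α ≤ energy Ω g φ (gradient φ))
    {V : Submodule ℝ (EuclideanSpace ℝ (Fin N) → ℝ)} [FiniteDimensional ℝ V]
    (hV : ∀ φ ∈ V, IsTestFunction Ω φ) {e : EuclideanSpace ℝ (Fin N) → ℝ} (he : e ∈ V)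
    (he0 : e ≠ 0) (hpath : ∀ t : ℝ, 0 ≤ t → energy Ω g (t • e) (gradient (t • e)) ≤ β) :
    ∃ u ∈ V, α / 2 ≤ energy Ω g u (gradient u) ∧ energy Ω g u (gradient u) ≤ β ∧
      ∀ v ∈ V, ∫ x in Ω, ‖gradient u x‖ ^ (N - 2) * inner ℝ (gradient u x) (gradient v x) =
        ∫ x in Ω, g x (u x) * v x := by
  have hΩ : volume Ω ≠ ⊤ := hΩb.measure_lt_top.ne
  have : IsFiniteMeasure (volume.restrict Ω) := ⟨by simpa using hΩ.lt_top⟩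
  have hN0 : N ≠ 0 := by omega
  have hNpos : (0 : ℝ) < N := by positivity
  set d := Module.finrank ℝ V
  set b := Module.finBasis ℝ V
  set φ : Fin d → EuclideanSpace ℝ (Fin N) → ℝ := fun i => (b i : EuclideanSpace ℝ (Fin N) → ℝ)
  have hφ : ∀ i, IsTestFunction Ω (φ i) := fun i => hV _ (b i).2
  set U : EuclideanSpace ℝ (Fin d) → EuclideanSpace ℝ (Fin N) → ℝ := fun a => ∑ i, a i • φ i
    with hU
  have hUt : ∀ a, IsTestFunction Ω (U a) := fun a => (IsTestFunction.sum hφ a Finset.univ).1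
  have hUg : ∀ a x, combGradient φ x a = gradient (U a) x := fun a x => by
    rw [combGradient_apply, (IsTestFunction.sum hφ a Finset.univ).2]
  have hUv : ∀ a x, combValue φ x a = U a x := fun a x => combValue_apply x a
  have hUV : ∀ a, U a = (b.equivFun.symm (WithLp.ofLp a) : V) := fun a => by
    rw [b.equivFun_symm_apply]
    simp only [hU, φ, Submodule.coe_sum, Submodule.coe_smul]
    rfl
  have hsurj : ∀ v ∈ V, ∃ a, U a = v := fun v hv => by
    refine ⟨WithLp.toLp 2 (b.equivFun ⟨v, hv⟩), ?_⟩
    rw [hUV]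
    simp
  have hinj : ∀ a, U a = 0 → a = 0 := fun a ha => by
    rw [hUV] at ha
    have h1 : b.equivFun.symm (WithLp.ofLp a) = 0 := Subtype.ext ha
    rw [LinearEquiv.map_eq_zero_iff] at h1
    ext i
    exact congrFun h1 i
  have hUsmul : ∀ (t : ℝ) a, U (t • a) = t • U a := fun t a => by
    simp [hU, Finset.smul_sum, smul_smul]
  obtain ⟨M, hM0, hM⟩ := exists_uniform_bound hφ
  set n : EuclideanSpace ℝ (Fin d) → ℝ := fun a => ∫ x in Ω, ‖combGradient φ x a‖ ^ N with hn
  have hncont : Continuous n := by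
    refine continuous_iff_continuousAt.2 fun a => ?_
    refine continuousAt_of_dominated (bound := fun _ => (d * ((‖a‖ + 1) * M)) ^ N)
      (Eventually.of_forall fun b => ?_) ?_ (integrable_const _)
      (ae_of_all _ fun x => by fun_prop)
    · have := continuous_combGradient hφ b
      exact Continuous.aestronglyMeasurable (by fun_prop)
    · filter_upwards [Metric.ball_mem_nhds a one_pos] with b hb
      refine ae_of_all _ fun x => ?_
      have h1 := norm_sub_norm_le b a
      rw [Metric.mem_ball, dist_eq_norm] at hb
      rw [Real.norm_of_nonneg (by positivity)]
      gcongr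
      refine (norm_combGradient_le hM b x).trans ?_
      gcongr
      linarith
  have hnsmul : ∀ (t : ℝ) a, n (t • a) = |t| ^ N * n a := fun t a => by
    simp only [hn, map_smul, norm_smul, mul_pow, Real.norm_eq_abs]
    rw [integral_const_mul]
  have hnpos : ∀ a, a ≠ 0 → 0 < n a := fun a ha => by
    refine lt_of_le_of_ne (integral_nonneg fun x => by positivity) fun h0 => ha (hinj a ?_)
    refine (hUt a).eq_zero_of_integral_gradient_eq_zero (by omega) hΩb ?_
    simp only [hn, hUg] at h0
    exact h0.symm
  obtain ⟨ae, hae⟩ := hsurj e he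
  have hae0 : ae ≠ 0 := by
    rintro rfl
    refine he0 ?_
    rw [← hae]
    simp [hU]
  have haen : 0 < ‖ae‖ := norm_pos_iff.2 hae0
  -- Coercivity: `n` is homogeneous of degree `N` and positive on the compact unit sphere of
  -- coefficients.
  obtain ⟨c, hc0, hc⟩ : ∃ c > 0, ∀ a, c * ‖a‖ ^ N ≤ n a := by
    obtain ⟨a₀, ha₀, hmin⟩ := (isCompact_sphere (0 : EuclideanSpace ℝ (Fin d)) 1).exists_isMinOn
      ⟨‖ae‖⁻¹ • ae, by simp [norm_smul, haen.ne']⟩ hncont.continuousOn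
    have ha₀' : ‖a₀‖ = 1 := by simpa using ha₀
    refine ⟨n a₀, hnpos a₀ (by rintro rfl; simp at ha₀'), fun a => ?_⟩
    rcases eq_or_ne a 0 with rfl | ha
    · simp [hN0, hn]
    have ha' : 0 < ‖a‖ := norm_pos_iff.2 ha
    have h1 : n a₀ ≤ n (‖a‖⁻¹ • a) := hmin (by simp [norm_smul, ha'.ne'])
    have h2 := hnsmul ‖a‖ (‖a‖⁻¹ • a)
    rw [smul_inv_smul₀ ha'.ne', abs_norm] at h2
    rw [h2, mul_comm]
    gcongr
  have hΦ : ∀ a, combEnergy Ω g φ a = energy Ω g (U a) (gradient (U a)) :=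
    combEnergy_eq hΩ hφ hg hgrow hN
  have hUint : ∀ a, IntegrableOn (fun x => primF g x (U a x)) Ω := fun a => by
    obtain ⟨B, hB⟩ := (hUt a).exists_bound
    exact integrable_primF_of_bounded hΩ hg hgrow ((hUt a).memLp 1 Ω).1 hB
  have hgint : ∀ a, Integrable (fun x => g x (U a x)) (volume.restrict Ω) := fun a => by
    obtain ⟨B, hB⟩ := (hUt a).exists_bound
    refine Integrable.of_bound (hg.aestronglyMeasurable_comp ((hUt a).memLp 1 Ω).1)
      (|C| * (1 + B ^ p)) (ae_of_all _ fun x => ?_)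
    rw [Real.norm_of_nonneg (hg.nonneg _ _)]
    refine (hgrow _ _).trans (mul_le_mul (le_abs_self _) ?_ (by positivity) (abs_nonneg _))
    gcongr
    exact hB x
  have hgmul : ∀ a b, Integrable (fun x => g x (U a x) * U b x) (volume.restrict Ω) := fun a b => by
    obtain ⟨B, hB⟩ := (hUt b).exists_bound
    exact (hgint a).mul_bdd ((hUt b).memLp 1 Ω).1 (ae_of_all _ hB)
  have hX : ∀ a b, inner ℝ (∫ x in Ω, galerkinField g φ a x) b =
      (∫ x in Ω, ‖gradient (U a) x‖ ^ (N - 2) * inner ℝ (gradient (U a) x) (gradient (U b) x)) -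
        ∫ x in Ω, g x (U a x) * U b x := fun a b => by
    rw [real_inner_comm, ← integral_inner (integrable_galerkinField hΩ hφ hg hgrow a)]
    simp only [fun x => real_inner_comm (galerkinField g φ a x) b, inner_galerkinField, hUg, hUv]
    rw [integral_sub (integrable_pow_mul_inner hN ((hUt a).memLp_gradient N Ω)
      ((hUt b).memLp_gradient N Ω)) (hgmul a b)]
  -- The gradient energy that the boundary sphere must exceed: `ρ ^ N` forces every path to cross
  -- the ring, and the quotient makes the radial derivative nonpositive.
  set K := max (ρ ^ N) ((μ * |β| + |C'| * volume.real Ω) / (μ / N - 1)) with hK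
  have hμ1 : 0 < μ / N - 1 := by
    rw [sub_pos, lt_div_iff₀ hNpos]; linarith
  set R := max 1 (K / c) with hR
  have hR1 : 1 ≤ R := le_max_left _ _
  have hKR : ∀ a, ‖a‖ = R → K ≤ n a := fun a ha => by
    refine le_trans ?_ (hc a)
    rw [ha]
    have h1 : R ≤ R ^ N := le_self_pow₀ hR1 hN0
    have h2 : K / c ≤ R := le_max_right _ _
    rw [div_le_iff₀ hc0] at h2
    nlinarith
  suffices hcrit : ∃ a, ∫ x in Ω, galerkinField g φ a x = 0 ∧ α / 2 ≤ combEnergy Ω g φ a ∧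
      combEnergy Ω g φ a ≤ β by
    obtain ⟨a, haX, ha1, ha2⟩ := hcrit
    rw [hΦ] at ha1 ha2
    refine ⟨U a, by rw [hUV]; exact Subtype.coe_prop _, ha1, ha2, fun v hv => ?_⟩
    obtain ⟨b, rfl⟩ := hsurj v hv
    have := hX a b
    rw [haX, inner_zero_left] at this
    linarith
  refine exists_criticalPoint_of_mountainPass
    (continuous_integral_galerkinField hΩ hφ hg hgrow)
    (hasGradientAt_combEnergy hN hΩ hφ hg hgrow) (α := α) (β := β) (R := R) ?_ hα (by linarith)
    ?_ ?_ ?_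
  · simp [combEnergy, hN0]
  -- Along the path `n` runs from zero to at least `ρ ^ N`, so it takes the value at which the lower
  -- bound on the energy holds.
  · intro γ hγ h0 h1
    have hiv := intermediate_value_Icc (zero_le_one' ℝ) (hncont.comp hγ).continuousOn
    have hmem : ρ ^ N ∈ Icc ((n ∘ γ) 0) ((n ∘ γ) 1) := by
      refine ⟨?_, (le_max_left _ _).trans (hKR _ h1)⟩
      simp only [Function.comp, h0, hn, map_zero, norm_zero, zero_pow hN0, integral_zero]
      positivity
    obtain ⟨t, ht, hnt⟩ := hiv hmem
    refine ⟨t, ht, ?_⟩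
    rw [hΦ]
    refine hring _ (hUt _) ?_
    simp only [Function.comp, hn, hUg] at hnt
    exact hnt
  -- The segment on the ray through `e`, scaled to end on the sphere of radius `R`.
  · refine ⟨fun t => t • ((R / ‖ae‖) • ae), by fun_prop, by simp, ?_, fun t ht => ?_⟩
    · beta_reduce
      rw [one_smul, norm_smul, Real.norm_of_nonneg (by positivity), div_mul_cancel₀ _ haen.ne']
    · beta_reduce
      rw [hΦ, smul_smul, hUsmul, hae]
      exact hpath _ (mul_nonneg ht.1 (by positivity))
  -- The Ambrosetti–Rabinowitz condition bounds the radial derivative by `μ * |β| + |C'| * |Ω| - (μ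
  -- / N - 1) * n a`.
  · intro a ha hβ
    rw [hX]
    have h1 : ∫ x in Ω, ‖gradient (U a) x‖ ^ (N - 2) *
        inner ℝ (gradient (U a) x) (gradient (U a) x) = n a := by
      simp only [hn, hUg]
      refine integral_congr_ae (ae_of_all _ fun x => ?_)
      simp only [real_inner_self_eq_norm_sq]
      rw [← pow_add, Nat.sub_add_cancel hN]
    have h2 : μ * ∫ x in Ω, primF g x (U a x) ≤
        (∫ x in Ω, g x (U a x) * U a x) + C' * volume.real Ω := by
      rw [← integral_const_mul]
      have h3 : ∫ x in Ω, (g x (U a x) * U a x + C') =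
          (∫ x in Ω, g x (U a x) * U a x) + C' * volume.real Ω := by
        rw [integral_add (hgmul a a) (integrable_const _)]
        simp [mul_comm]
      rw [← h3]
      refine integral_mono ((hUint a).const_mul μ) ((hgmul a a).add (integrable_const _))
        fun x => ?_
      simp only [mul_comm (g x (U a x))]
      exact hAR x _
    rw [hΦ, energy] at hβ
    have h4 : ∫ x in Ω, ‖gradient (U a) x‖ ^ N = n a := by simp only [hn, hUg]
    rw [h4] at hβ
    rw [h1]
    have h5 := (le_max_right _ _).trans (hKR a ha)
    rw [div_le_iff₀ hμ1] at h5
    have h6 : μ * ((1 / N) * n a - ∫ x in Ω, primF g x (U a x)) ≤ μ * |β| :=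
      mul_le_mul_of_nonneg_left (hβ.trans (le_abs_self _)) (by linarith)
    have h7 : C' * volume.real Ω ≤ |C'| * volume.real Ω :=
      mul_le_mul_of_nonneg_right (le_abs_self _) measureReal_nonneg
    have h8 : μ * ((1 / N) * n a) = n a * (μ / N - 1) + n a := by ring
    linarith

end GalerkinCriticalPoint

/-! ### Compactness of bounded sequences in `W_0^{1,N}`. -/

section Compactness

variable {N : ℕ} {Ω : Set (EuclideanSpace ℝ (Fin N))}

lemma MemSobolevOneZero.integrable_pow (hN : 2 ≤ N) (hΩ : volume Ω ≠ ⊤) (p : ℕ)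
    {u : EuclideanSpace ℝ (Fin N) → ℝ} {G : EuclideanSpace ℝ (Fin N) → EuclideanSpace ℝ (Fin N)}
    (h : MemSobolevOneZero Ω (N : ℝ≥0∞) u G) : IntegrableOn (fun x => |u x| ^ p) Ω := by
  obtain ⟨α, D, hα, -, hT⟩ := exists_integral_exp_le_of_energy_le hN hΩ (∫ x in Ω, ‖G x‖ ^ N)
  obtain ⟨C, -, hCle⟩ := exists_pow_le_exp (one_le_div_pred hN) hα p
  refine integrable_of_abs_le_exp (C := C) ?_ (hT u G h le_rfl).1 (ae_of_all _ fun x => ?_)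
  · exact h.memLp.1.norm.pow p
  · rw [abs_of_nonneg (by positivity)]
    exact hCle _ (abs_nonneg _)

/-- Poincaré–Sobolev inequality on `W_0^{1,N}` for every integer exponent. -/
lemma exists_integral_pow_le (hN : 2 ≤ N) (hΩ : volume Ω ≠ ⊤) (p : ℕ) :
    ∃ P : ℝ, 0 ≤ P ∧ ∀ u G, MemSobolevOneZero Ω (N : ℝ≥0∞) u G → ∀ K : ℝ, 0 < K →
      ∫ x in Ω, ‖G x‖ ^ N ≤ K ^ N → ∫ x in Ω, |u x| ^ p ≤ P * K ^ p := by
  obtain ⟨κ, C, hκ, hC, hT⟩ := exists_integral_exp_le hN hΩ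
  obtain ⟨C', hC', hle⟩ := exists_pow_le_exp (one_le_div_pred hN) hκ p
  refine ⟨C' * C, by positivity, fun u G hu K hK hG => ?_⟩
  obtain ⟨h1, h2⟩ := hT u G hu K hK hG
  calc ∫ x in Ω, |u x| ^ p
      ≤ ∫ x in Ω, K ^ p * (C' * Real.exp (κ * (|u x| / K) ^ ((N : ℝ) / (N - 1)))) := by
        refine integral_mono (hu.integrable_pow hN hΩ p) ((h1.const_mul C').const_mul _) fun x => ?_
        have := hle (|u x| / K) (by positivity)
        rw [div_pow, div_le_iff₀ (by positivity)] at this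
        linarith
    _ = K ^ p * (C' * ∫ x in Ω, Real.exp (κ * (|u x| / K) ^ ((N : ℝ) / (N - 1)))) := by
        rw [integral_const_mul, integral_const_mul]
    _ ≤ K ^ p * (C' * C) := by gcongr
    _ = _ := by ring

/-- The Sobolev bound is homogeneous in the gradient bound `K`, which may be taken arbitrarily
small. -/
lemma tendsto_integral_pow_of_tendsto_gradient (hN : 2 ≤ N) (hΩ : volume Ω ≠ ⊤) {p : ℕ}
    (hp : p ≠ 0) {v : ℕ → EuclideanSpace ℝ (Fin N) → ℝ}
    {V : ℕ → EuclideanSpace ℝ (Fin N) → EuclideanSpace ℝ (Fin N)}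
    (hv : ∀ n, MemSobolevOneZero Ω (N : ℝ≥0∞) (v n) (V n))
    (hV : Tendsto (fun n => ∫ x in Ω, ‖V n x‖ ^ N) atTop (𝓝 0)) :
    Tendsto (fun n => ∫ x in Ω, |v n x| ^ p) atTop (𝓝 0) := by
  obtain ⟨P, hP, hle⟩ := exists_integral_pow_le (Ω := Ω) hN hΩ p
  rw [Metric.tendsto_atTop]
  intro ε hε
  obtain ⟨K, hK0, hK⟩ : ∃ K : ℝ, 0 < K ∧ P * K ^ p < ε := by
    have h1 : Tendsto (fun K : ℝ => P * K ^ p) (𝓝[>] 0) (𝓝 0) := by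
      have : ContinuousAt (fun K : ℝ => P * K ^ p) 0 := by fun_prop
      simpa [hp] using this.tendsto.mono_left nhdsWithin_le_nhds
    obtain ⟨K, h2, h3⟩ := ((h1.eventually_lt_const hε).and self_mem_nhdsWithin).exists
    exact ⟨K, h3, h2⟩
  obtain ⟨n₀, hn₀⟩ := eventually_atTop.1 (hV.eventually_lt_const (pow_pos hK0 N))
  refine ⟨n₀, fun n hn => ?_⟩
  rw [Real.dist_eq, sub_zero, abs_of_nonneg (integral_nonneg fun x => by positivity)]
  exact (hle _ _ (hv n) K hK0 (hn₀ n hn).le).trans_lt hK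

/-- A bounded sequence in `W_0^{1,N}` which converges almost everywhere converges in every
Lebesgue space. -/
lemma tendsto_integral_pow_sub_of_tendsto_ae (hN : 2 ≤ N) (hΩ : volume Ω ≠ ⊤) (p : ℕ) (hp : p ≠ 0)
    {u : ℕ → EuclideanSpace ℝ (Fin N) → ℝ}
    {G : ℕ → EuclideanSpace ℝ (Fin N) → EuclideanSpace ℝ (Fin N)}
    (hu : ∀ n, MemSobolevOneZero Ω (N : ℝ≥0∞) (u n) (G n)) {A : ℝ}
    (hA : ∀ n, ∫ x in Ω, ‖G n x‖ ^ N ≤ A) {u₀ : EuclideanSpace ℝ (Fin N) → ℝ}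
    (hlim : ∀ᵐ x ∂(volume.restrict Ω), Tendsto (fun n => u n x) atTop (𝓝 (u₀ x))) :
    IntegrableOn (fun x => |u₀ x| ^ p) Ω ∧
      Tendsto (fun n => ∫ x in Ω, |u n x - u₀ x| ^ p) atTop (𝓝 0) := by
  have : IsFiniteMeasure (volume.restrict Ω) := ⟨by simpa using hΩ.lt_top⟩
  have hmeas : AEStronglyMeasurable u₀ (volume.restrict Ω) :=
    aestronglyMeasurable_of_tendsto_ae atTop (fun n => (hu n).memLp.1) hlim
  have hKN : A ≤ (max A 1) ^ N :=
    (le_max_left _ _).trans (le_self_pow₀ (le_max_right _ _) (by omega))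
  have hfatou : ∀ p : ℕ, ∃ B, ∀ n, ∫ x in Ω, |u n x| ^ p ≤ B ∧
      IntegrableOn (fun x => |u₀ x| ^ p) Ω ∧ ∫ x in Ω, |u₀ x| ^ p ≤ B := by
    intro p
    obtain ⟨P, hP, hle⟩ := exists_integral_pow_le (Ω := Ω) hN hΩ p
    have hb := fun n => hle _ _ (hu n) (max A 1) (by positivity) ((hA n).trans hKN)
    refine ⟨_, fun n => ⟨hb n, integrable_of_tendsto_of_integral_le
      (fun n => (hu n).integrable_pow hN hΩ p) (fun n => ae_of_all _ fun x => by positivity) ?_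
      (Eventually.of_forall hb)⟩⟩
    filter_upwards [hlim] with x hx
    exact hx.abs.pow p
  -- Moments of order `2 * p` bound the `p`-th powers of the differences in `L^2`, as the Vitali
  -- lemma requires.
  obtain ⟨B, hB⟩ := hfatou (2 * p)
  obtain ⟨_, hBp⟩ := hfatou p
  refine ⟨(hBp 0).2.1, ?_⟩
  have hdom : ∀ n, IntegrableOn (fun x => 2 ^ (2 * p - 1) * (|u n x| ^ (2 * p) + |u₀ x| ^ (2 * p))) Ω :=
    fun n => (((hu n).integrable_pow hN hΩ (2 * p)).add (hB n).2.1).const_mul _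
  have hle : ∀ n x, (|u n x - u₀ x| ^ p) ^ 2 ≤
      2 ^ (2 * p - 1) * (|u n x| ^ (2 * p) + |u₀ x| ^ (2 * p)) := by
    intro n x
    rw [← pow_mul, mul_comm p 2]
    refine le_trans ?_ (add_pow_le (abs_nonneg _) (abs_nonneg _) _)
    gcongr
    exact abs_sub _ _
  have hmeas2 : ∀ n, AEStronglyMeasurable (fun x => |u n x - u₀ x| ^ p) (volume.restrict Ω) :=
    fun n => (((hu n).memLp.1.sub hmeas).norm).pow p
  have hint2 : ∀ n, Integrable (fun x => (|u n x - u₀ x| ^ p) ^ 2) (volume.restrict Ω) := fun n => by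
    refine (hdom n).mono' ((hmeas2 n).pow 2) (ae_of_all _ fun x => ?_)
    rw [Real.norm_of_nonneg (by positivity)]
    exact hle n x
  have h := tendsto_integral_of_sq_bounded (g₀ := fun _ => (0 : ℝ)) hmeas2 ?_
    (C := 2 ^ (2 * p - 1) * (B + B)) hint2 fun n => ?_
  · simpa using h.2.2
  · filter_upwards [hlim] with x hx
    have := ((hx.sub_const (u₀ x)).abs).pow p
    simpa [hp] using this
  · refine (integral_mono (hint2 n) (hdom n) (hle n)).trans ?_
    rw [integral_const_mul, integral_add ((hu n).integrable_pow hN hΩ (2 * p)) (hB n).2.1]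
    gcongr
    · exact (hB n).1
    · exact (hB n).2.2

/-- Strong convergence in `W_0^{1,N}` of bounded sequences `u k` for which
`∫ |∇u k|^{N-2} ∇u k · ∇(u k - u l)` is asymptotically nonpositive. -/
theorem exists_limit_of_monotonicity (hN : 2 ≤ N) (hΩ : volume Ω ≠ ⊤)
    {u : ℕ → EuclideanSpace ℝ (Fin N) → ℝ}
    {G : ℕ → EuclideanSpace ℝ (Fin N) → EuclideanSpace ℝ (Fin N)}
    (hu : ∀ n, MemSobolevOneZero Ω (N : ℝ≥0∞) (u n) (G n)) {A ℓ : ℝ}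
    (hA : ∀ n, ∫ x in Ω, ‖G n x‖ ^ N ≤ A)
    (hℓ : Tendsto (fun n => ∫ x in Ω, ‖G n x‖ ^ N) atTop (𝓝 ℓ))
    {u₀ : EuclideanSpace ℝ (Fin N) → ℝ}
    (hlim : ∀ᵐ x ∂(volume.restrict Ω), Tendsto (fun n => u n x) atTop (𝓝 (u₀ x)))
    (hmono : ∀ ε > 0, ∃ k₀, ∀ l k, k₀ ≤ l → l ≤ k →
      ∫ x in Ω, ‖G k x‖ ^ (N - 2) * inner ℝ (G k x) (G k x - G l x) ≤ ε) :
    ∃ G₀, MemSobolevOneZero Ω (N : ℝ≥0∞) u₀ G₀ ∧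
      Tendsto (fun n => ∫ x in Ω, ‖G n x - G₀ x‖ ^ N) atTop (𝓝 0) := by
  have hN0 : N ≠ 0 := by omega
  have hNpos : (0 : ℝ) < N := by positivity
  obtain ⟨G₀, hG₀, hGlim⟩ := exists_limit_of_cauchy_integral_pow (by omega : 1 ≤ N)
    (fun n => (hu n).memLp_grad) (fun ε hε => by
      -- Uniform convexity at the later gradient `G k` bounds `2 * 2⁻¹ ^ N * ∫ ‖G l - G k‖ ^ N` by
      -- the difference of the two energies, less than `2 * η` since these converge, plus `N` times
      -- the monotonicity term, at most `N * η`.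
      set η := 2 * (2⁻¹ : ℝ) ^ N * ε / (N + 3) with hη
      have hη0 : 0 < η := by positivity
      obtain ⟨k₀, hk₀⟩ := hmono η hη0
      obtain ⟨k₁, hk₁⟩ := Metric.tendsto_atTop.1 hℓ η hη0
      refine ⟨max k₀ k₁, fun l k hl hlk => ?_⟩
      have hlk' := (le_max_right _ _).trans hl
      have h1 := hk₀ l k ((le_max_left _ _).trans hl) hlk
      have h2 := abs_lt.1 (hk₁ l hlk')
      have h3 := abs_lt.1 (hk₁ k (hlk'.trans hlk))
      have i1 := (hu l).memLp_grad.integrable_norm_pow hN0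
      have i2 := (hu k).memLp_grad.integrable_norm_pow hN0
      have i3 := integrable_pow_mul_inner hN (hu k).memLp_grad ((hu k).memLp_grad.sub (hu l).memLp_grad)
      have i4 := ((hu l).memLp_grad.sub (hu k).memLp_grad).integrable_norm_pow hN0
      simp only [Pi.sub_apply] at i3 i4
      have h4 : ∫ x in Ω, 2 * 2⁻¹ ^ N * ‖G l x - G k x‖ ^ N ≤
          ∫ x in Ω, (‖G l x‖ ^ N - ‖G k x‖ ^ N +
            N * (‖G k x‖ ^ (N - 2) * inner ℝ (G k x) (G k x - G l x))) := by
        refine integral_mono (i4.const_mul _) ((i1.sub i2).add (i3.const_mul _)) fun x => ?_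
        have h5 := norm_pow_add_inner_add_le hN (G k x) (G l x)
        have h6 : (inner ℝ (G k x) (G k x - G l x) : ℝ) = - inner ℝ (G k x) (G l x - G k x) := by
          rw [← inner_neg_right, neg_sub]
        simp only [h6]
        rw [mul_pow] at h5
        linarith
      have i5 : Integrable (fun x => ‖G l x‖ ^ N - ‖G k x‖ ^ N) (volume.restrict Ω) := i1.sub i2
      rw [integral_const_mul, integral_add i5 (i3.const_mul _), integral_sub i1 i2,
        integral_const_mul] at h4
      have h7 : (N : ℝ) * ∫ x in Ω, ‖G k x‖ ^ (N - 2) * inner ℝ (G k x) (G k x - G l x) ≤ N * η := by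
        gcongr
      have h8 : 2 * 2⁻¹ ^ N * ∫ x in Ω, ‖G l x - G k x‖ ^ N < (N + 3) * η := by linarith
      rw [hη, mul_div_cancel₀ _ (by positivity)] at h8
      exact lt_of_mul_lt_mul_left h8 (by positivity))
  have hLN := tendsto_integral_pow_sub_of_tendsto_ae hN hΩ N hN0 hu hA hlim
  have hmeas : AEStronglyMeasurable u₀ (volume.restrict Ω) :=
    aestronglyMeasurable_of_tendsto_ae atTop (fun n => (hu n).memLp.1) hlim
  have hu₀ : MemLp u₀ N (volume.restrict Ω) := by
    rw [← integrable_norm_rpow_iff hmeas (by exact_mod_cast hN0) (by simp)]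
    simpa [IntegrableOn] using hLN.1
  refine ⟨G₀, MemSobolevOneZero.of_tendsto (by exact_mod_cast (by omega : 1 ≤ N)) hΩ hu hu₀ hG₀
    ?_ ?_, hGlim⟩
  · refine (tendsto_eLpNorm_natCast_iff hN0 fun n => (hu n).memLp.sub hu₀).2 ?_
    simpa using hLN.2
  · exact (tendsto_eLpNorm_natCast_iff hN0 fun n => (hu n).memLp_grad.sub hG₀).2 hGlim

theorem exists_subseq_tendsto_ae_and_energy (hN : 1 ≤ N) (hΩ : Bornology.IsBounded Ω)
    {u : ℕ → EuclideanSpace ℝ (Fin N) → ℝ}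
    {G : ℕ → EuclideanSpace ℝ (Fin N) → EuclideanSpace ℝ (Fin N)}
    (hu : ∀ n, MemSobolevOneZero Ω (N : ℝ≥0∞) (u n) (G n)) {A : ℝ}
    (hA : ∀ n, ∫ x in Ω, ‖G n x‖ ^ N ≤ A) :
    ∃ ns : ℕ → ℕ, StrictMono ns ∧ (∃ u₀ : EuclideanSpace ℝ (Fin N) → ℝ,
      ∀ᵐ x ∂(volume.restrict Ω), Tendsto (fun n => u (ns n) x) atTop (𝓝 (u₀ x))) ∧
      ∃ ℓ : ℝ, Tendsto (fun n => ∫ x in Ω, ‖G (ns n) x‖ ^ N) atTop (𝓝 ℓ) := by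
  obtain ⟨ns, hns, u₀, hu₀⟩ := exists_subseq_tendsto_ae hN hΩ hu hA
  obtain ⟨ℓ, -, ms, hms, hℓ⟩ := (isCompact_Icc (a := (0 : ℝ)) (b := A)).tendsto_subseq
    (x := fun n => ∫ x in Ω, ‖G (ns n) x‖ ^ N)
    fun n => ⟨integral_nonneg fun x => by positivity, hA _⟩
  refine ⟨ns ∘ ms, hns.comp hms, ⟨u₀, ?_⟩, ℓ, hℓ⟩
  filter_upwards [hu₀] with x hx
  exact hx.comp hms.tendsto_atTop

end Compactness

/-! ### Solutions under polynomial growth and an Ambrosetti–Rabinowitz condition. -/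

section RegularProblem

variable {N : ℕ} {Ω : Set (EuclideanSpace ℝ (Fin N))}

/-- The gradients of test functions form a subset of the separable space `L^N`, and such a subset
has a dense sequence of its own. -/
lemma exists_dense_isTestFunction (hN : 1 ≤ N) (Ω : Set (EuclideanSpace ℝ (Fin N))) :
    ∃ ψ : ℕ → EuclideanSpace ℝ (Fin N) → ℝ, (∀ i, IsTestFunction Ω (ψ i)) ∧
      ∀ φ, IsTestFunction Ω φ → ∃ i : ℕ → ℕ,
        Tendsto (fun n => ∫ x in Ω, ‖gradient (ψ (i n)) x - gradient φ x‖ ^ N) atTop (𝓝 0) := by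
  have hN0 : N ≠ 0 := by omega
  have : Fact (1 ≤ (N : ℝ≥0∞)) := ⟨by exact_mod_cast hN⟩
  have : Fact ((N : ℝ≥0∞) ≠ ⊤) := ⟨by simp⟩
  set T := {φ : EuclideanSpace ℝ (Fin N) → ℝ // IsTestFunction Ω φ}
  set F : T → Lp (EuclideanSpace ℝ (Fin N)) (N : ℝ≥0∞) (volume.restrict Ω) :=
    fun φ => (φ.2.memLp_gradient N Ω).toLp (gradient φ.1)
  have : Nonempty (range F) := ⟨⟨_, ⟨0, IsTestFunction.zero⟩, rfl⟩⟩
  choose ψ hψ using fun i => (TopologicalSpace.denseSeq (range F) i).2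
  refine ⟨fun i => (ψ i).1, fun i => (ψ i).2, fun φ hφ => ?_⟩
  have hd := TopologicalSpace.denseRange_denseSeq (range F) ⟨F ⟨φ, hφ⟩, ⟨φ, hφ⟩, rfl⟩
  obtain ⟨y, hy, hlim⟩ := mem_closure_iff_seq_limit.1 hd
  choose i hi using hy
  refine ⟨i, ?_⟩
  have h1 : Tendsto (fun n => F (ψ (i n))) atTop (𝓝 (F ⟨φ, hφ⟩)) := by
    have h2 := (continuous_subtype_val.tendsto _).comp hlim
    refine h2.congr fun n => ?_
    rw [hψ, hi]
    rfl
  have h3 := (Lp.tendsto_Lp_iff_tendsto_eLpNorm'' _ (fun n => (ψ (i n)).2.memLp_gradient N Ω) _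
    (hφ.memLp_gradient N Ω)).1 h1
  exact (tendsto_eLpNorm_natCast_iff hN0
    fun n => ((ψ (i n)).2.memLp_gradient N Ω).sub (hφ.memLp_gradient N Ω)).1 h3

/-- Young's inequality for the integral of a product. -/
lemma abs_integral_mul_le {X : Type*} [MeasurableSpace X] {μ : Measure X} {a b : X → ℝ}
    (ha : AEStronglyMeasurable a μ) (hb : AEStronglyMeasurable b μ)
    (ha2 : Integrable (fun x => a x ^ 2) μ) (hb2 : Integrable (fun x => |b x| ^ 2) μ) {δ : ℝ}
    (hδ : 0 < δ) : Integrable (fun x => a x * b x) μ ∧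
      |∫ x, a x * b x ∂μ| ≤ δ * ∫ x, a x ^ 2 ∂μ + (4 * δ)⁻¹ * ∫ x, |b x| ^ 2 ∂μ := by
  have hle : ∀ x, |a x * b x| ≤ δ * a x ^ 2 + (4 * δ)⁻¹ * |b x| ^ 2 := by
    intro x
    rw [abs_mul, ← sq_abs (a x), ← sub_nonneg]
    have : δ * |a x| ^ 2 + (4 * δ)⁻¹ * |b x| ^ 2 - |a x| * |b x| =
        (4 * δ)⁻¹ * (2 * δ * |a x| - |b x|) ^ 2 := by
      field_simp
      ring
    rw [this]
    positivity
  have hi : Integrable (fun x => δ * a x ^ 2 + (4 * δ)⁻¹ * |b x| ^ 2) μ :=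
    (ha2.const_mul δ).add (hb2.const_mul _)
  have hab : Integrable (fun x => a x * b x) μ := hi.mono' (ha.mul hb) (ae_of_all _ hle)
  refine ⟨hab, ?_⟩
  rw [← integral_const_mul, ← integral_const_mul, ← integral_add (ha2.const_mul δ) (hb2.const_mul _)]
  exact abs_integral_le_integral_abs.trans (integral_mono hab.abs hi hle)

variable {g : EuclideanSpace ℝ (Fin N) → ℝ → ℝ}

/-- Collects the bounds needed to pass to limits. The exponent is halved at the outset because
products of two bounded factors occur. -/
lemma IsNonlinearity.exists_le_exp (hN : 2 ≤ N) (hg : IsNonlinearity g) {C : ℝ} {p : ℕ}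
    (hgrow : ∀ x t, g x t ≤ C * (1 + |t| ^ p)) {α : ℝ} (hα : 0 < α) :
    ∃ B : ℝ, 0 ≤ B ∧ ∀ x t,
      g x t ≤ B * Real.exp (α * |t| ^ ((N : ℝ) / (N - 1))) ∧
      |t| * g x t ≤ B * Real.exp (α * |t| ^ ((N : ℝ) / (N - 1))) ∧
      primF g x t ≤ B * Real.exp (α * |t| ^ ((N : ℝ) / (N - 1))) ∧
      g x t ^ 2 ≤ B * Real.exp (α * |t| ^ ((N : ℝ) / (N - 1))) := by
  have hC0 : 0 ≤ C := by
    have := (hg.nonneg 0 0).trans (hgrow 0 0)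
    exact nonneg_of_mul_nonneg_left this (by positivity : (0 : ℝ) < 1 + |(0 : ℝ)| ^ p)
  have hq := one_le_div_pred hN
  set q := (N : ℝ) / (N - 1)
  obtain ⟨c₁, hc₁, h1⟩ := exists_pow_le_exp hq (half_pos hα) 1
  obtain ⟨c₂, hc₂, h2⟩ := exists_pow_le_exp hq (half_pos hα) p
  set D := C * (1 + c₂) with hD
  have hD0 : 0 ≤ D := by positivity
  refine ⟨D + c₁ * D + D ^ 2, by positivity, fun x t => ?_⟩
  set E := Real.exp (α / 2 * |t| ^ q) with hE
  have hE1 : 1 ≤ E := Real.one_le_exp (by positivity)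
  have hE2 : Real.exp (α * |t| ^ q) = E * E := by
    rw [hE, ← Real.exp_add]; congr 1; ring
  have ht1 : |t| ≤ c₁ * E := by simpa using h1 |t| (abs_nonneg t)
  have hpoly : C * (1 + |t| ^ p) ≤ D * E := by
    have := h2 |t| (abs_nonneg t)
    rw [hD, mul_assoc]
    gcongr
    linarith
  have hgE : g x t ≤ D * E := (hgrow x t).trans hpoly
  have hg0 := hg.nonneg x t
  have hEE : E ≤ E * E := le_mul_of_one_le_left (by positivity) hE1
  have hprod : |t| * (C * (1 + |t| ^ p)) ≤ c₁ * D * (E * E) := by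
    calc |t| * (C * (1 + |t| ^ p)) ≤ (c₁ * E) * (D * E) := by gcongr
      _ = _ := by ring
  rw [hE2]
  have k1 : 0 ≤ c₁ * D * (E * E) := by positivity
  have k2 : 0 ≤ D ^ 2 * (E * E) := by positivity
  have k3 : D * E ≤ D * (E * E) := by gcongr
  have k4 : 0 ≤ D * (E * E) := by positivity
  refine ⟨by linarith, ?_, ?_, ?_⟩
  · have : |t| * g x t ≤ |t| * (C * (1 + |t| ^ p)) :=
      mul_le_mul_of_nonneg_left (hgrow x t) (abs_nonneg t)
    linarith
  · have h3 : primF g x t ≤ C * (1 + |t| ^ p) * |t| := by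
      refine (hg.monotone_primF x (le_abs_self t)).trans
        (hg.primF_le_mul (abs_nonneg t) fun s hs => (hgrow x s).trans ?_)
      have : |s| ≤ |t| := by rw [abs_of_nonneg hs.1]; exact hs.2
      gcongr
    linarith
  · have : g x t ^ 2 ≤ (D * E) ^ 2 := by gcongr
    linarith [show (D * E) ^ 2 = D ^ 2 * (E * E) by ring]

/-- Test with `h(u)`, where `h(s) = smoothTransition (-s)` is a smooth substitute for the negative
part. As `g` vanishes where `h(u)` does not, `∫ h'(u) |G|^N = 0`; so `h(u)` has zero gradient, hence
is zero. -/
lemma ae_nonneg_of_weakForm (hN : 2 ≤ N) (hΩ : volume Ω ≠ ⊤) (hg : IsNonlinearity g)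
    {u : EuclideanSpace ℝ (Fin N) → ℝ} {G : EuclideanSpace ℝ (Fin N) → EuclideanSpace ℝ (Fin N)}
    (hu : MemSobolevOneZero Ω (N : ℝ≥0∞) u G)
    (hweak : ∀ v V, MemSobolevOneZero Ω (N : ℝ≥0∞) v V →
      ∫ x in Ω, ‖G x‖ ^ (N - 2) * inner ℝ (G x) (V x) = ∫ x in Ω, g x (u x) * v x) :
    ∀ᵐ x ∂(volume.restrict Ω), 0 ≤ u x := by
  have hN0 : N ≠ 0 := by omega
  obtain ⟨M, hM0, hM⟩ := exists_abs_deriv_smoothTransition_le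
  set h : ℝ → ℝ := fun s => Real.smoothTransition (-s)
  have hd : ∀ s, deriv h s = - deriv Real.smoothTransition (-s) := fun s =>
    deriv_comp_neg (f := Real.smoothTransition) s
  have hd0 : ∀ s, 0 ≤ deriv Real.smoothTransition s := fun s =>
    Real.smoothTransition.monotone.deriv_nonneg
  have hv := hu.comp_left (g := h) (C := M) (by omega) hΩ
    (Real.smoothTransition.contDiff.comp contDiff_neg) (by simp [h])
    fun t => by rw [hd, abs_neg]; exact hM _
  have h1 := hweak _ _ hv
  have h2 : ∫ x in Ω, g x (u x) * h (u x) = 0 := by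
    refine integral_eq_zero_of_ae (ae_of_all _ fun x => ?_)
    rcases le_total (u x) 0 with hx | hx
    · simp [hg.eq_zero x _ hx]
    · simp [h, Real.smoothTransition.zero_of_nonpos (neg_nonpos.2 hx)]
  rw [h2] at h1
  have h3 : ∀ x, ‖G x‖ ^ (N - 2) * inner ℝ (G x) (deriv h (u x) • G x) =
      - (deriv Real.smoothTransition (-u x) * ‖G x‖ ^ N) := fun x => by
    rw [inner_smul_right, real_inner_self_eq_norm_sq, hd]
    have : ‖G x‖ ^ N = ‖G x‖ ^ (N - 2) * ‖G x‖ ^ 2 := by rw [← pow_add, Nat.sub_add_cancel hN]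
    rw [this]
    ring
  have hint := integrable_pow_mul_inner hN hu.memLp_grad hv.memLp_grad
  simp only [h3] at h1 hint
  rw [integral_neg, neg_eq_zero] at h1
  have h4 := (integral_eq_zero_iff_of_nonneg (fun x => mul_nonneg (hd0 _) (by positivity))
    (by simpa using hint.neg)).1 h1
  have h5 : ∫ x in Ω, ‖deriv h (u x) • G x‖ ^ N = 0 := by
    refine integral_eq_zero_of_ae ?_
    filter_upwards [h4] with x hx
    simp only [Pi.zero_apply] at hx ⊢
    rcases mul_eq_zero.1 hx with hz | hz
    · simp [hd, hz, hN0]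
    · rw [norm_smul, mul_pow, hz, mul_zero]
  have h6 := tendsto_integral_pow_of_tendsto_gradient hN hΩ one_ne_zero (v := fun _ => _)
    (V := fun _ => _) (fun _ => hv) (by simp only [h5]; exact tendsto_const_nhds)
  have h7 := tendsto_nhds_unique h6 tendsto_const_nhds
  have h8 := (integral_eq_zero_iff_of_nonneg (fun x => by positivity)
    (hv.integrable_pow hN hΩ 1)).1 h7.symm
  filter_upwards [h8] with x hx
  have h9 : h (u x) = 0 := by simpa using hx
  linarith [Real.smoothTransition.zero_iff_nonpos.1 h9]

/-- Existence of a mountain pass solution under the Ambrosetti–Rabinowitz condition and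
polynomial growth. -/
theorem exists_mountainPass_solution (hN : 2 ≤ N) (hΩb : Bornology.IsBounded Ω)
    (hg : IsNonlinearity g)
    {C : ℝ} {p : ℕ} (hgrow : ∀ x t, g x t ≤ C * (1 + |t| ^ p))
    {μ C' : ℝ} (hμ : (N : ℝ) < μ) (hAR : ∀ x t, μ * primF g x t ≤ t * g x t + C')
    {ρ α β : ℝ} (hρ : 0 ≤ ρ) (hα : 0 < α)
    (hring : ∀ φ, IsTestFunction Ω φ → ∫ x in Ω, ‖gradient φ x‖ ^ N = ρ ^ N →
      α ≤ energy Ω g φ (gradient φ))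
    {e : EuclideanSpace ℝ (Fin N) → ℝ} (he : IsTestFunction Ω e) (he0 : e ≠ 0)
    (hpath : ∀ t : ℝ, 0 ≤ t → energy Ω g (t • e) (gradient (t • e)) ≤ β) :
    ∃ u G, MemSobolevOneZero Ω (N : ℝ≥0∞) u G ∧ (∀ᵐ x ∂(volume.restrict Ω), 0 ≤ u x) ∧
      α / 2 ≤ energy Ω g u G ∧ energy Ω g u G ≤ β ∧
      ∀ v V, MemSobolevOneZero Ω (N : ℝ≥0∞) v V → IntegrableOn (fun x => g x (u x) * v x) Ω ∧
        ∫ x in Ω, ‖G x‖ ^ (N - 2) * inner ℝ (G x) (V x) = ∫ x in Ω, g x (u x) * v x := by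
  have hΩ : volume Ω ≠ ⊤ := hΩb.measure_lt_top.ne
  have : IsFiniteMeasure (volume.restrict Ω) := ⟨by simpa using hΩ.lt_top⟩
  have hN0 : N ≠ 0 := by omega
  have hNpos : (0 : ℝ) < N := by positivity
  have hμ1 : 0 < μ / N - 1 := by
    rw [sub_pos, lt_div_iff₀ hNpos]; linarith
  obtain ⟨ψ, hψ, hdense⟩ := exists_dense_isTestFunction (by omega) Ω
  -- Every space contains `e`, so the same ray serves as path and the energy levels do not depend on
  -- `k`.
  set V : ℕ → Submodule ℝ (EuclideanSpace ℝ (Fin N) → ℝ) := fun k =>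
    Submodule.span ℝ (insert e (ψ '' Iio k)) with hVdef
  have hVt : ∀ k, ∀ φ ∈ V k, IsTestFunction Ω φ := fun k φ hφ => by
    refine Submodule.span_induction (p := fun φ _ => IsTestFunction Ω φ) ?_ IsTestFunction.zero
      (fun _ _ _ _ h h' => h.add h') (fun a _ _ h => h.smul a) hφ
    rintro _ (rfl | ⟨i, -, rfl⟩)
    · exact he
    · exact hψ i
  have hVmono : Monotone V := fun k l hkl =>
    Submodule.span_mono (insert_subset_insert (image_mono (Iio_subset_Iio hkl)))
  have hVfin : ∀ k, FiniteDimensional ℝ (V k) := fun k =>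
    FiniteDimensional.span_of_finite ℝ (((finite_Iio k).image ψ).insert e)
  choose u huV hu1 hu2 hu3 using fun k => exists_galerkin_criticalPoint hN hΩb hg hgrow hμ hAR hρ hα
    hring (hVt k) (Submodule.subset_span (mem_insert e _)) he0 hpath
  have hut : ∀ k, IsTestFunction Ω (u k) := fun k => hVt k _ (huV k)
  have huW : ∀ k, MemSobolevOneZero Ω (N : ℝ≥0∞) (u k) (gradient (u k)) :=
    fun k => (hut k).memSobolevOneZero
  -- the sequence is bounded
  have hA : ∀ k, ∫ x in Ω, ‖gradient (u k) x‖ ^ N ≤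
      (μ * β + C' * volume.real Ω) / (μ / N - 1) := fun k => by
    rw [le_div_iff₀ hμ1]
    obtain ⟨a, D, ha, -, hT⟩ := exists_integral_exp_le_of_energy_le hN hΩ
      (∫ x in Ω, ‖gradient (u k) x‖ ^ N)
    obtain ⟨B, -, hB⟩ := hg.exists_le_exp hN hgrow ha
    have hexp := (hT _ _ (huW k) le_rfl).1
    have i1 : Integrable (fun x => primF g x (u k x)) (volume.restrict Ω) :=
      integrable_of_abs_le_exp (hg.aestronglyMeasurable_primF (huW k).memLp.1) hexp
        (ae_of_all _ fun x => by
          rw [abs_of_nonneg (hg.primF_nonneg _ _)]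
          exact (hB x _).2.2.1)
    have i2 : Integrable (fun x => g x (u k x) * u k x) (volume.restrict Ω) :=
      integrable_of_abs_le_exp ((hg.aestronglyMeasurable_comp (huW k).memLp.1).mul (huW k).memLp.1)
        hexp (ae_of_all _ fun x => by
          rw [abs_mul, abs_of_nonneg (hg.nonneg _ _), mul_comm]
          exact (hB x _).2.1)
    have h1 := hu3 k _ (huV k)
    have h2 : ∀ x, ‖gradient (u k) x‖ ^ (N - 2) *
        inner ℝ (gradient (u k) x) (gradient (u k) x) = ‖gradient (u k) x‖ ^ N := fun x => by
      rw [real_inner_self_eq_norm_sq, ← pow_add, Nat.sub_add_cancel hN]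
    simp only [h2] at h1
    have h3 : ∫ x in Ω, μ * primF g x (u k x) ≤ ∫ x in Ω, (g x (u k x) * u k x + C') := by
      refine integral_mono (i1.const_mul μ) (i2.add (integrable_const _)) fun x => ?_
      simp only [mul_comm (g x (u k x))]
      exact hAR x _
    rw [integral_const_mul, integral_add i2 (integrable_const _), ← h1] at h3
    have h4 := mul_le_mul_of_nonneg_left (hu2 k) (by linarith : 0 ≤ μ)
    rw [energy] at h4
    simp only [integral_const, measureReal_restrict_apply_univ, smul_eq_mul] at h3
    have h8 : ∀ n : ℝ, μ * ((1 / N) * n) = n * (μ / N - 1) + n := fun n => by ring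
    rw [mul_sub, h8] at h4
    linarith
  set A := (μ * β + C' * volume.real Ω) / (μ / N - 1)
  obtain ⟨ns, hns, ⟨u₀, hu₀⟩, ℓ, hℓ⟩ := exists_subseq_tendsto_ae_and_energy (by omega) hΩb huW hA
  obtain ⟨a, D, ha, hD, hT⟩ := exists_integral_exp_le_of_energy_le hN hΩ A
  obtain ⟨B, hB0, hB⟩ := hg.exists_le_exp hN hgrow (half_pos ha)
  have hexp : ∀ k, IntegrableOn (fun x => Real.exp (a * |u (ns k) x| ^ ((N : ℝ) / (N - 1)))) Ω ∧
      ∫ x in Ω, Real.exp (a * |u (ns k) x| ^ ((N : ℝ) / (N - 1))) ≤ D :=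
    fun k => hT _ _ (huW _) (hA _)
  have hum : ∀ k, AEStronglyMeasurable (u (ns k)) (volume.restrict Ω) := fun k => (huW _).memLp.1
  have hu₀m : AEStronglyMeasurable u₀ (volume.restrict Ω) :=
    aestronglyMeasurable_of_tendsto_ae atTop hum hu₀
  -- Polynomial growth bounds `g(u_k)` in `L^2`; together with convergence of `u_k` in `L^2` this
  -- handles the products below.
  have hsq := tendsto_integral_of_exp_bound hΩ (h := fun k x => g x (u (ns k) x) ^ 2)
    (h₀ := fun x => g x (u₀ x) ^ 2) (C := B)
    (fun k => (hg.aestronglyMeasurable_comp (hum k)).pow 2)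
    (by filter_upwards [hu₀] with x hx
        exact (((hg.continuous x).tendsto _).comp hx).pow 2)
    (fun k => (hexp k).1) (fun k => (hexp k).2)
    (fun k => ae_of_all _ fun x => by rw [abs_of_nonneg (by positivity)]; exact (hB x _).2.2.2)
  have hprim := tendsto_integral_of_exp_bound hΩ (h := fun k x => primF g x (u (ns k) x))
    (h₀ := fun x => primF g x (u₀ x)) (C := B)
    (fun k => hg.aestronglyMeasurable_primF (hum k))
    (by filter_upwards [hu₀] with x hx
        exact ((hg.continuous_primF x).tendsto _).comp hx)
    (fun k => (hexp k).1) (fun k => (hexp k).2)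
    (fun k => ae_of_all _ fun x => by
      rw [abs_of_nonneg (hg.primF_nonneg _ _)]; exact (hB x _).2.2.1)
  have hgφ : ∀ φ, IsTestFunction Ω φ → IntegrableOn (fun x => g x (u₀ x) * φ x) Ω ∧
      Tendsto (fun k => ∫ x in Ω, g x (u (ns k) x) * φ x) atTop
        (𝓝 (∫ x in Ω, g x (u₀ x) * φ x)) := fun φ hφ => by
    obtain ⟨b, hb⟩ := hφ.exists_bound
    have := tendsto_integral_of_exp_bound hΩ (h := fun k x => g x (u (ns k) x) * φ x)
      (h₀ := fun x => g x (u₀ x) * φ x) (C := B * b)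
      (fun k => (hg.aestronglyMeasurable_comp (hum k)).mul (hφ.memLp 1 Ω).1)
      (by filter_upwards [hu₀] with x hx
          exact (((hg.continuous x).tendsto _).comp hx).mul_const _)
      (fun k => (hexp k).1) (fun k => (hexp k).2)
      (fun k => ae_of_all _ fun x => by
        rw [abs_mul, abs_of_nonneg (hg.nonneg _ _), mul_right_comm]
        exact mul_le_mul (hB x _).1 (hb x) (abs_nonneg _) (by positivity))
    exact ⟨this.1, this.2.2⟩
  obtain ⟨hint2, hL2⟩ := tendsto_integral_pow_sub_of_tendsto_ae hN hΩ 2 two_ne_zero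
    (fun k => huW (ns k)) (fun k => hA (ns k)) hu₀
  -- strong convergence of the gradients
  obtain ⟨G₀, hG₀, hGlim⟩ := exists_limit_of_monotonicity hN hΩ (fun k => huW (ns k))
    (fun k => hA (ns k)) hℓ hu₀ (fun ε hε => by
      obtain ⟨S, hS0, hS⟩ : ∃ S : ℝ, 0 ≤ S ∧ ∀ k, ∫ x in Ω, g x (u (ns k) x) ^ 2 ≤ S := by
        obtain ⟨S, hS⟩ := hsq.2.2.bddAbove_range
        refine ⟨S, ?_, fun k => hS ⟨k, rfl⟩⟩
        exact (integral_nonneg fun x => by positivity).trans (hS ⟨0, rfl⟩)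
      set δ := ε / (2 * (S + 1)) with hδ
      have hδ0 : 0 < δ := by positivity
      obtain ⟨k₀, hk₀⟩ := eventually_atTop.1
        (hL2.eventually_lt_const (by positivity : 0 < ε * δ / 2))
      refine ⟨k₀, fun l k hl hlk => ?_⟩
      -- The earlier function `u (ns l)` lies in the later space, so the difference is admissible in
      -- the equation for `u (ns k)`.
      have hsub : u (ns k) - u (ns l) ∈ V (ns k) :=
        (V (ns k)).sub_mem (huV _) (hVmono (hns.monotone hlk) (huV _))
      have h1 := hu3 (ns k) _ hsub
      simp only [(hut (ns k)).gradient_sub (hut (ns l)), Pi.sub_apply] at h1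
      rw [h1]
      have hsubW := (hVt _ _ hsub).memSobolevOneZero (p := (N : ℝ≥0∞))
      have i1 : Integrable (fun x => g x (u (ns k) x) ^ 2) (volume.restrict Ω) :=
        integrable_of_abs_le_exp ((hg.aestronglyMeasurable_comp (hum k)).pow 2) (hexp k).1
          (C := B) (ae_of_all _ fun x => by
            rw [abs_of_nonneg (by positivity)]
            refine (hB x _).2.2.2.trans ?_
            gcongr
            linarith)
      have i2 : Integrable (fun x => |u (ns k) x - u (ns l) x| ^ 2) (volume.restrict Ω) :=
        hsubW.integrable_pow hN hΩ 2
      have i3 : ∀ k, Integrable (fun x => |u (ns k) x - u₀ x| ^ 2) (volume.restrict Ω) := fun k => by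
        have := ((huW (ns k)).integrable_pow hN hΩ 2).add hint2
        refine (this.const_mul 2).mono' ((((hum k).sub hu₀m).norm).pow 2) (ae_of_all _ fun x => ?_)
        simp only [Pi.add_apply, sq_abs, norm_pow, Real.norm_eq_abs]
        nlinarith [sq_nonneg (u (ns k) x + u₀ x)]
      have h2 := (abs_integral_mul_le (hg.aestronglyMeasurable_comp (hum k))
        (hsubW.memLp.1) i1 i2 hδ0).2
      have h3 : ∫ x in Ω, |u (ns k) x - u (ns l) x| ^ 2 ≤
          2 * (∫ x in Ω, |u (ns k) x - u₀ x| ^ 2) + 2 * ∫ x in Ω, |u (ns l) x - u₀ x| ^ 2 := by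
        rw [← integral_const_mul, ← integral_const_mul, ← integral_add ((i3 k).const_mul 2)
          ((i3 l).const_mul 2)]
        refine integral_mono i2 (((i3 k).const_mul 2).add ((i3 l).const_mul 2)) fun x => ?_
        simp only [sq_abs]
        nlinarith [sq_nonneg (u (ns k) x - u₀ x + (u (ns l) x - u₀ x))]
      have h4 : δ * ∫ x in Ω, g x (u (ns k) x) ^ 2 ≤ ε / 2 := by
        calc δ * ∫ x in Ω, g x (u (ns k) x) ^ 2 ≤ δ * (S + 1) := by
              gcongr
              linarith [hS k]
          _ = ε / 2 := by rw [hδ]; field_simp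
      have h5 : (4 * δ)⁻¹ * ∫ x in Ω, |u (ns k) x - u (ns l) x| ^ 2 ≤ ε / 2 := by
        calc (4 * δ)⁻¹ * ∫ x in Ω, |u (ns k) x - u (ns l) x| ^ 2
            ≤ (4 * δ)⁻¹ * (2 * (ε * δ / 2) + 2 * (ε * δ / 2)) := by
              gcongr
              linarith [hk₀ k (hl.trans hlk), hk₀ l hl]
          _ = ε / 2 := by field_simp; norm_num
      have h6 := (le_abs_self _).trans h2
      simp only [Pi.sub_apply] at h6
      linarith)
  -- the limit equation
  have hψeq : ∀ i, ∫ x in Ω, ‖G₀ x‖ ^ (N - 2) * inner ℝ (G₀ x) (gradient (ψ i) x) =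
      ∫ x in Ω, g x (u₀ x) * ψ i x := fun i => by
    refine tendsto_nhds_unique (tendsto_integral_pow_mul_inner hN (fun k => (huW (ns k)).memLp_grad)
      hG₀.memLp_grad ((hψ i).memLp_gradient N Ω) hGlim) ((hgφ _ (hψ i)).2.congr' ?_)
    -- From here on `ψ i` belongs to the Galerkin space, since `i < k ≤ ns k`.
    filter_upwards [eventually_gt_atTop i] with k hk
    exact (hu3 (ns k) _ (Submodule.subset_span (mem_insert_of_mem _
      ⟨i, hk.trans_le (hns.id_le k), rfl⟩))).symm
  have hφeq : ∀ φ, IsTestFunction Ω φ →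
      ∫ x in Ω, ‖G₀ x‖ ^ (N - 2) * inner ℝ (G₀ x) (gradient φ x) =
        ∫ x in Ω, g x (u₀ x) * φ x := fun φ hφ => by
    obtain ⟨i, hi⟩ := hdense φ hφ
    have h1 := tendsto_integral_pow_mul_inner_right hN (fun n => (hψ (i n)).memLp_gradient N Ω)
      hG₀.memLp_grad (hφ.memLp_gradient N Ω) hi
    simp only [hψeq] at h1
    refine tendsto_nhds_unique h1 ?_
    -- Convergence of gradients implies convergence in `L^2`, which suffices on the right because
    -- `g(u₀)` is square integrable.
    have hW : ∀ n, MemSobolevOneZero Ω (N : ℝ≥0∞) (ψ (i n) - φ) (gradient (ψ (i n) - φ)) :=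
      fun n => ((hψ (i n)).sub hφ).memSobolevOneZero
    have h2 := tendsto_integral_pow_of_tendsto_gradient hN hΩ two_ne_zero hW
      (by simpa only [(hψ _).gradient_sub hφ] using hi)
    set S := ∫ x in Ω, g x (u₀ x) ^ 2 with hSdef
    have hS0 : 0 ≤ S := integral_nonneg fun x => by positivity
    rw [Metric.tendsto_atTop]
    intro ε hε
    set δ := ε / (2 * (S + 1)) with hδ
    have hδ0 : 0 < δ := by positivity
    obtain ⟨n₀, hn₀⟩ := eventually_atTop.1
      (h2.eventually_lt_const (by positivity : 0 < ε * δ * 2))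
    refine ⟨n₀, fun n hn => ?_⟩
    have h3 := (abs_integral_mul_le (hg.aestronglyMeasurable_comp hu₀m) (hW n).memLp.1 hsq.1
      ((hW n).integrable_pow hN hΩ 2) hδ0).2
    rw [Real.dist_eq, ← integral_sub (hgφ _ (hψ _)).1 (hgφ _ hφ).1]
    simp only [← mul_sub]
    refine lt_of_le_of_lt h3 ?_
    have h4 : δ * (S + 1) = ε / 2 := by rw [hδ]; field_simp
    have h5 : (4 * δ)⁻¹ * ∫ x in Ω, |(ψ (i n) - φ) x| ^ 2 < ε / 2 := by
      calc (4 * δ)⁻¹ * ∫ x in Ω, |(ψ (i n) - φ) x| ^ 2 < (4 * δ)⁻¹ * (ε * δ * 2) := by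
            gcongr
            exact hn₀ n hn
        _ = ε / 2 := by field_simp; norm_num
    linarith
  have hweak : ∀ v V, MemSobolevOneZero Ω (N : ℝ≥0∞) v V →
      IntegrableOn (fun x => g x (u₀ x) * v x) Ω ∧
        ∫ x in Ω, ‖G₀ x‖ ^ (N - 2) * inner ℝ (G₀ x) (V x) = ∫ x in Ω, g x (u₀ x) * v x :=
    fun v V hv => weakForm_of_isTestFunction hN hG₀.memLp_grad (hg.aestronglyMeasurable_comp hu₀m)
      (ae_of_all _ fun x => hg.nonneg _ _) (fun φ hφ => (hgφ φ hφ).1) hφeq hv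
  have henergy : Tendsto (fun k => energy Ω g (u (ns k)) (gradient (u (ns k)))) atTop
      (𝓝 (energy Ω g u₀ G₀)) :=
    ((tendsto_integral_norm_pow (by omega) (fun k => (huW (ns k)).memLp_grad) hG₀.memLp_grad
      hGlim).const_mul _).sub hprim.2.2
  exact ⟨u₀, G₀, hG₀, ae_nonneg_of_weakForm hN hΩ hg hG₀ fun v V hv => (hweak v V hv).2,
    ge_of_tendsto' henergy fun k => hu1 _, le_of_tendsto' henergy fun k => hu2 _, hweak⟩

end RegularProblem

/-! ### Bounds on `H` as monotonicity of shifted quotients `F / t^N`. -/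

section PrimitiveQuotient

variable {N : ℕ} {g : EuclideanSpace ℝ (Fin N) → ℝ → ℝ}

namespace IsNonlinearity

/-- The derivative of `F / τ^N` is `H / τ^(N+1)`, and adding `k / N` to `F` subtracts `k` from `H`.
A one-sided bound on `H` thus makes a suitably shifted quotient monotone. -/
lemma hasDerivAt_primF_add_div_pow (hN : N ≠ 0) (hg : IsNonlinearity g) (x : EuclideanSpace ℝ (Fin N)) (k : ℝ)
    {τ : ℝ} (hτ : 0 < τ) :
    HasDerivAt (fun τ => (primF g x τ + k / N) / τ ^ N) ((auxH g x τ - k) / τ ^ (N + 1)) τ := by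
  have h := ((hg.hasDerivAt_primF x τ).add_const (k / N)).div (hasDerivAt_pow N τ)
    (pow_pos hτ N).ne'
  refine h.congr_deriv ?_
  have e : τ ^ N = τ ^ (N - 1) * τ := by rw [← pow_succ, Nat.sub_add_cancel (by omega)]
  have hN0 : (N : ℝ) ≠ 0 := by exact_mod_cast hN
  have hp : τ ^ (N - 1) ≠ 0 := (pow_pos hτ _).ne'
  rw [auxH, pow_succ τ N, e]
  generalize τ ^ (N - 1) = p at hp
  field_simp
  ring

/-- Upper bounds for `H` on `(0,s]` control `F` on dilations of `s`. -/
lemma pow_mul_primF_le (hN : N ≠ 0) (hg : IsNonlinearity g) {x : EuclideanSpace ℝ (Fin N)}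
    {s t K : ℝ} (hs : 0 ≤ s) (ht : 0 < t) (ht1 : t ≤ 1) (hK : ∀ τ, τ ≤ s → auxH g x τ ≤ K) :
    t ^ N * primF g x s ≤ primF g x (t * s) + (1 - t ^ N) * (K / N) := by
  rcases hs.eq_or_lt with rfl | hs
  · have h0 : 0 ≤ K := by simpa [auxH] using hK 0 le_rfl
    have : t ^ N ≤ 1 := pow_le_one₀ ht.le ht1
    simp only [primF_zero, mul_zero, zero_add]
    exact mul_nonneg (by linarith) (by positivity)
  have hanti : AntitoneOn (fun τ => (primF g x τ + K / N) / τ ^ N) (Ioc 0 s) := by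
    refine antitoneOn_of_deriv_nonpos (convex_Ioc 0 s)
      (fun τ hτ => (hg.hasDerivAt_primF_add_div_pow hN x K hτ.1).continuousAt.continuousWithinAt)
      (fun τ hτ => ?_) fun τ hτ => ?_
    · rw [interior_Ioc] at hτ
      exact (hg.hasDerivAt_primF_add_div_pow hN x K hτ.1).differentiableAt.differentiableWithinAt
    · rw [interior_Ioc] at hτ
      rw [(hg.hasDerivAt_primF_add_div_pow hN x K hτ.1).deriv]
      have := hτ.1
      exact div_nonpos_of_nonpos_of_nonneg (by linarith [hK τ hτ.2.le]) (by positivity)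
  have h := hanti (a := t * s) (b := s) ⟨by positivity, mul_le_of_le_one_left hs.le ht1⟩
    ⟨hs, le_rfl⟩ (mul_le_of_le_one_left hs.le ht1)
  simp only at h
  rw [mul_pow, div_le_div_iff₀ (by positivity) (by positivity)] at h
  have hsN : 0 < s ^ N := by positivity
  have h' : (primF g x s + K / N) * t ^ N ≤ primF g x (t * s) + K / N := by
    refine le_of_mul_le_mul_right ?_ hsN
    linarith
  linarith

/-- Lower bounds for `H` make `F` grow at least like a power. -/
lemma div_pow_mul_primF_le (hN : N ≠ 0) (hg : IsNonlinearity g) {x : EuclideanSpace ℝ (Fin N)}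
    {s t C : ℝ} (hs : 0 < s) (hst : s ≤ t) (hC : ∀ τ, 0 ≤ τ → -C ≤ auxH g x τ) :
    (t / s) ^ N * (primF g x s - C / N) ≤ primF g x t - C / N := by
  have hmono : MonotoneOn (fun τ => (primF g x τ + -C / N) / τ ^ N) (Ioi 0) := by
    refine monotoneOn_of_deriv_nonneg (convex_Ioi 0)
      (fun τ hτ => (hg.hasDerivAt_primF_add_div_pow hN x (-C) hτ).continuousAt.continuousWithinAt)
      (fun τ hτ => ?_) fun τ hτ => ?_
    · rw [interior_Ioi] at hτ
      exact (hg.hasDerivAt_primF_add_div_pow hN x (-C) hτ).differentiableAt.differentiableWithinAt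
    · rw [interior_Ioi] at hτ
      rw [(hg.hasDerivAt_primF_add_div_pow hN x (-C) hτ).deriv]
      have : (0 : ℝ) < τ := hτ
      exact div_nonneg (by linarith [hC τ this.le]) (by positivity)
  have ht : 0 < t := hs.trans_le hst
  have h := hmono (a := s) (b := t) hs ht hst
  simp only [neg_div, ← sub_eq_add_neg] at h
  rw [le_div_iff₀ (by positivity)] at h
  rw [div_pow]
  refine le_trans (le_of_eq ?_) h
  ring

end IsNonlinearity

end PrimitiveQuotient

/-! ### Truncation in space and in size. -/

section Truncation

variable {N : ℕ} {Ω D : Set (EuclideanSpace ℝ (Fin N))} {f : EuclideanSpace ℝ (Fin N) → ℝ → ℝ}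
  {M : ℝ}

/-- The nonlinearity `f` cut off outside `D` and continued by a power beyond `M`. -/
noncomputable def truncate (D : Set (EuclideanSpace ℝ (Fin N))) (M : ℝ)
    (f : EuclideanSpace ℝ (Fin N) → ℝ → ℝ) (x : EuclideanSpace ℝ (Fin N)) (t : ℝ) : ℝ :=
  D.indicator (fun y => f y (min t M) * (max t M / M) ^ (N + 1)) x

lemma truncate_of_notMem {x : EuclideanSpace ℝ (Fin N)} (hx : x ∉ D) (t : ℝ) :
    truncate D M f x t = 0 := indicator_of_notMem hx _

lemma truncate_of_le (hM : 0 < M) {x : EuclideanSpace ℝ (Fin N)} (hx : x ∈ D) {t : ℝ}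
    (ht : t ≤ M) : truncate D M f x t = f x t := by
  rw [truncate, indicator_of_mem hx, min_eq_left ht, max_eq_right ht, div_self hM.ne', one_pow,
    mul_one]

lemma truncate_of_ge {x : EuclideanSpace ℝ (Fin N)} (hx : x ∈ D) {t : ℝ}
    (ht : M ≤ t) : truncate D M f x t = f x M / M ^ (N + 1) * t ^ (N + 1) := by
  rw [truncate, indicator_of_mem hx, min_eq_right ht, max_eq_left ht, div_pow]
  ring

lemma IsNonlinearity.truncate (hf : IsNonlinearity f) (hD : MeasurableSet D) (hM : 0 < M) :
    IsNonlinearity (truncate D M f) where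
  measurable := by
    have h1 : Measurable fun z : EuclideanSpace ℝ (Fin N) × ℝ =>
        f z.1 (min z.2 M) * (max z.2 M / M) ^ (N + 1) :=
      (hf.measurable.comp (measurable_fst.prodMk (measurable_snd.min measurable_const))).mul
        (((measurable_snd.max measurable_const).div_const M).pow_const _)
    have h2 := h1.indicator (s := D ×ˢ univ) (hD.prod MeasurableSet.univ)
    convert h2 using 2 with z
    by_cases hz : z.1 ∈ D <;> simp [_root_.truncate, hz]
  continuous x := by
    by_cases hx : x ∈ D
    · have := hf.continuous x
      have e : _root_.truncate D M f x = fun t => f x (min t M) * (max t M / M) ^ (N + 1) :=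
        funext fun t => indicator_of_mem hx _
      rw [e]
      fun_prop
    · have e : _root_.truncate D M f x = fun _ => 0 := funext fun t => truncate_of_notMem hx t
      rw [e]
      exact continuous_const
  nonneg x t := indicator_nonneg (fun y _ => mul_nonneg (hf.nonneg _ _)
    (pow_nonneg (div_nonneg (hM.le.trans (le_max_right _ _)) hM.le) _)) x
  eq_zero x t ht := by
    by_cases hx : x ∈ D
    · rw [truncate_of_le hM hx (ht.trans hM.le), hf.eq_zero x t ht]
    · exact truncate_of_notMem hx t

lemma primF_truncate_of_notMem {x : EuclideanSpace ℝ (Fin N)} (hx : x ∉ D) (t : ℝ) :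
    primF (truncate D M f) x t = 0 := by
  simp [primF, truncate_of_notMem hx]

lemma auxH_truncate_of_notMem {x : EuclideanSpace ℝ (Fin N)} (hx : x ∉ D) (t : ℝ) :
    auxH (truncate D M f) x t = 0 := by
  simp [auxH, truncate_of_notMem hx, primF_truncate_of_notMem hx]

lemma primF_truncate_of_le (hM : 0 < M) {x : EuclideanSpace ℝ (Fin N)} (hx : x ∈ D) {t : ℝ}
    (ht : t ≤ M) : primF (truncate D M f) x t = primF f x t := by
  refine intervalIntegral.integral_congr fun s hs => truncate_of_le hM hx ?_
  exact hs.2.trans (max_le hM.le ht)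

lemma auxH_truncate_of_le (hM : 0 < M) {x : EuclideanSpace ℝ (Fin N)} (hx : x ∈ D) {t : ℝ}
    (ht : t ≤ M) : auxH (truncate D M f) x t = auxH f x t := by
  rw [auxH, auxH, primF_truncate_of_le hM hx ht, truncate_of_le hM hx ht]

lemma primF_truncate_of_ge (hf : IsNonlinearity f) (hD : MeasurableSet D) (hM : 0 < M)
    {x : EuclideanSpace ℝ (Fin N)} (hx : x ∈ D) {t : ℝ} (ht : M ≤ t) :
    primF (truncate D M f) x t = primF f x M +
      f x M / M ^ (N + 1) * ((t ^ (N + 2) - M ^ (N + 2)) / (N + 2)) := by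
  have hc := (hf.truncate hD hM).continuous x
  rw [primF, ← intervalIntegral.integral_add_adjacent_intervals (hc.intervalIntegrable 0 M)
    (hc.intervalIntegrable M t)]
  congr 1
  · exact primF_truncate_of_le hM hx le_rfl
  · rw [intervalIntegral.integral_congr (g := fun s => f x M / M ^ (N + 1) * s ^ (N + 1))
      fun s hs => truncate_of_ge hx (by rw [uIcc_of_le ht] at hs; exact hs.1)]
    rw [intervalIntegral.integral_const_mul, integral_pow]
    push_cast
    rw [add_assoc (N : ℝ) 1 1, one_add_one_eq_two]

/-- For the power `t^(N+1)` the contribution to `H` has the coefficient `1 - N / (N + 2)`. It is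
positive, so `H` does not decrease beyond `M`. -/
lemma auxH_truncate_of_ge (hf : IsNonlinearity f) (hD : MeasurableSet D) (hM : 0 < M)
    {x : EuclideanSpace ℝ (Fin N)} (hx : x ∈ D) {t : ℝ} (ht : M ≤ t) :
    auxH (truncate D M f) x t = auxH f x M +
      2 / (N + 2) * (f x M / M ^ (N + 1)) * (t ^ (N + 2) - M ^ (N + 2)) := by
  rw [auxH, auxH, primF_truncate_of_ge hf hD hM hx ht, truncate_of_ge hx ht]
  have hN : (N : ℝ) + 2 ≠ 0 := by positivity
  field_simp
  ring

/-- If `M` separates `t` and `s`, compare through `M`; beyond `M` use monotonicity. The constants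
`θ` and `C` are not changed by the truncation. -/
lemma auxH_truncate_le (hf : IsNonlinearity f) (hD : MeasurableSet D) (hM : 0 < M) {θ C : ℝ}
    (hθ : 1 ≤ θ) (hC : 0 ≤ C) (hH : ∀ x t s, t ≤ s → auxH f x t ≤ θ * auxH f x s + C)
    (x : EuclideanSpace ℝ (Fin N)) {t s : ℝ} (hts : t ≤ s) :
    auxH (truncate D M f) x t ≤ θ * auxH (truncate D M f) x s + C := by
  by_cases hx : x ∈ D
  swap
  · simp [auxH_truncate_of_notMem hx, hC]
  rcases le_total s M with hs | hs
  · rw [auxH_truncate_of_le hM hx hs, auxH_truncate_of_le hM hx (hts.trans hs)]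
    exact hH x t s hts
  set a := 2 / (N + 2) * (f x M / M ^ (N + 1)) with ha
  have ha0 : 0 ≤ a := by
    have := hf.nonneg x M
    positivity
  have hsH : auxH (truncate D M f) x s = auxH f x M + a * (s ^ (N + 2) - M ^ (N + 2)) :=
    auxH_truncate_of_ge hf hD hM hx hs
  have hs0 : auxH f x M ≤ auxH (truncate D M f) x s := by
    rw [hsH]
    have : M ^ (N + 2) ≤ s ^ (N + 2) := by gcongr
    nlinarith
  rcases le_total t M with ht | ht
  · rw [auxH_truncate_of_le hM hx ht]
    refine (hH x t M ht).trans ?_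
    gcongr
  · have h1 : auxH (truncate D M f) x t ≤ auxH (truncate D M f) x s := by
      rw [hsH, auxH_truncate_of_ge hf hD hM hx ht]
      have : 0 ≤ t := hM.le.trans ht
      gcongr
    -- At equal arguments the condition says `(θ - 1) * H(M) ≥ -C`, and this passes to `s ≥ M`. It
    -- is needed because `H` may be negative.
    have h2 := hH x M M le_rfl
    nlinarith

end Truncation

/-! ### Growth of the truncated nonlinearities. -/

section TruncationGrowth

variable {N : ℕ} {Ω D : Set (EuclideanSpace ℝ (Fin N))} {f : EuclideanSpace ℝ (Fin N) → ℝ → ℝ}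
  {M : ℝ}

/-- Polynomial growth and the Ambrosetti–Rabinowitz condition for truncated nonlinearities. -/
lemma exists_truncate_le (hf : IsNonlinearity f)
    (hc : ContinuousOn (fun z : EuclideanSpace ℝ (Fin N) × ℝ => f z.1 z.2) (D ×ˢ univ))
    (hD : IsCompact D) (hM : 1 ≤ M) :
    ∃ C, (∀ x t, truncate D M f x t ≤ C * (1 + |t| ^ (N + 1))) ∧
      ∀ x t, ((N : ℝ) + 1) * primF (truncate D M f) x t ≤ t * truncate D M f x t + C := by
  have hM0 : 0 < M := by linarith
  obtain ⟨B, hB⟩ := (hD.prod (isCompact_Icc (a := (0 : ℝ)) (b := M))).exists_bound_of_continuousOn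
    (hc.mono (prod_mono le_rfl (subset_univ _)))
  set B' := max B 0
  have hB0 : 0 ≤ B' := le_max_right _ _
  have hB' : ∀ x ∈ D, ∀ t ≤ M, f x t ≤ B' := fun x hx t ht => by
    rcases le_total t 0 with h | h
    · rw [hf.eq_zero x t h]; exact hB0
    · exact (le_abs_self _).trans ((hB (x, t) ⟨hx, h, ht⟩).trans (le_max_left _ _))
  refine ⟨B' + (N + 1) * (B' * M), fun x t => ?_, fun x t => ?_⟩
  · by_cases hx : x ∈ D
    swap
    · rw [truncate_of_notMem hx]; positivity
    rw [truncate, indicator_of_mem hx]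
    have h1 : (max t M / M) ^ (N + 1) ≤ 1 + |t| ^ (N + 1) := by
      rcases le_total t M with h | h
      · rw [max_eq_right h, div_self hM0.ne', one_pow]
        exact le_add_of_nonneg_right (by positivity)
      · have : t / M ≤ |t| := by
          rw [abs_of_nonneg (hM0.le.trans h)]
          exact div_le_self (hM0.le.trans h) hM
        rw [max_eq_left h]
        have h2 : (t / M) ^ (N + 1) ≤ |t| ^ (N + 1) :=
          pow_le_pow_left₀ (div_nonneg (hM0.le.trans h) hM0.le) this _
        linarith
    refine mul_le_mul ((hB' x hx _ (min_le_right _ _)).trans ?_) h1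
      (pow_nonneg (div_nonneg (hM0.le.trans (le_max_right _ _)) hM0.le) _) (by positivity)
    exact le_add_of_nonneg_right (by positivity)
  · have hg := hf.truncate (D := D) hD.measurableSet hM0
    by_cases hx : x ∈ D
    swap
    · rw [primF_truncate_of_notMem hx, truncate_of_notMem hx]
      simp only [mul_zero, zero_add]
      positivity
    have hFM : primF f x M ≤ B' * M := hf.primF_le_mul hM0.le fun s hs => hB' x hx s hs.2
    rcases le_total t M with ht | ht
    · rw [primF_truncate_of_le hM0 hx ht]
      have h1 := hg.self_mul_nonneg x t
      have h2 : ((N : ℝ) + 1) * primF f x t ≤ (N + 1) * (B' * M) := by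
        gcongr
        exact (hf.monotone_primF x ht).trans hFM
      linarith
    · rw [primF_truncate_of_ge hf hD.measurableSet hM0 hx ht, truncate_of_ge hx ht]
      set a := f x M / M ^ (N + 1)
      have ha : 0 ≤ a := by
        have := hf.nonneg x M
        positivity
      have h2 : ((N : ℝ) + 1) * primF f x M ≤ (N + 1) * (B' * M) := by gcongr
      -- The primitive of `t^(N+1)` carries the factor `1 / (N + 2)`, which leaves room for `μ = N +
      -- 1 > N`.
      have h3 : ((N : ℝ) + 1) * (a * ((t ^ (N + 2) - M ^ (N + 2)) / (N + 2))) ≤ a * t ^ (N + 2) := by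
        have h4 : a * ((t ^ (N + 2) - M ^ (N + 2)) / (N + 2)) * (N + 2) =
            a * (t ^ (N + 2) - M ^ (N + 2)) := by field_simp
        have h5 : 0 ≤ a * M ^ (N + 2) := by positivity
        have h6 : M ^ (N + 2) ≤ t ^ (N + 2) := by gcongr
        have h7 : 0 ≤ a * ((t ^ (N + 2) - M ^ (N + 2)) / (N + 2)) :=
          mul_nonneg ha (div_nonneg (by linarith) (by positivity))
        linarith
      have h8 : t * (a * t ^ (N + 1)) = a * t ^ (N + 2) := by ring
      rw [h8, mul_add]
      linarith

/-- Beyond `M` the product is `M f(x,M)` times `(t / M)^(N+2)`. For `M ≥ 1` each factor is absorbed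
by half of the exponent, with constants independent of `D` and `M`. -/
lemma exists_abs_mul_truncate_le_exp (hN : 2 ≤ N)
    (hexp : ∀ α : ℝ, 0 < α → ∃ B, 0 ≤ B ∧ ∀ x t,
      |t| * f x t ≤ B * Real.exp (α * |t| ^ ((N : ℝ) / (N - 1)))) {α : ℝ} (hα : 0 < α) :
    ∃ B, 0 ≤ B ∧ ∀ (D : Set (EuclideanSpace ℝ (Fin N))) (M : ℝ), 1 ≤ M → ∀ x t,
      |t| * truncate D M f x t ≤ B * Real.exp (α * |t| ^ ((N : ℝ) / (N - 1))) := by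
  have hq := one_le_div_pred hN
  set q := (N : ℝ) / (N - 1)
  obtain ⟨B, hB0, hB⟩ := hexp (α / 2) (half_pos hα)
  obtain ⟨c, hc, hpow⟩ := exists_pow_le_exp hq (half_pos hα) (N + 2)
  refine ⟨B + B * c, by positivity, fun D M hM x t => ?_⟩
  have hM0 : 0 < M := by linarith
  have hE2 : Real.exp (α * |t| ^ q) = Real.exp (α / 2 * |t| ^ q) * Real.exp (α / 2 * |t| ^ q) := by
    rw [← Real.exp_add]; congr 1; ring
  set E := Real.exp (α / 2 * |t| ^ q) with hE
  have hE1 : 1 ≤ E := Real.one_le_exp (by positivity)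
  have hEE : E ≤ E * E := le_mul_of_one_le_left (by positivity) hE1
  rw [hE2]
  by_cases hx : x ∈ D
  swap
  · rw [truncate_of_notMem hx, mul_zero]; positivity
  have k1 : 0 ≤ B * c * (E * E) := by positivity
  have k2 : B * E ≤ B * (E * E) := by gcongr
  have k3 : 0 ≤ B * (E * E) := by positivity
  rcases le_total t M with ht | ht
  · rw [truncate_of_le hM0 hx ht]
    linarith [hB x t]
  · have ht0 : 0 < t := hM0.trans_le ht
    rw [truncate_of_ge hx ht]
    have h1 := hB x M
    have h2 := hpow |t| (abs_nonneg t)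
    rw [abs_of_pos hM0] at h1
    have h3 : Real.exp (α / 2 * M ^ q) ≤ E := by
      rw [hE, abs_of_pos ht0]
      gcongr
    have h4 : M * f x M ≤ B * E := h1.trans (by gcongr)
    have h5 : |t| * (f x M / M ^ (N + 1) * t ^ (N + 1)) = M * f x M * (|t| / M) ^ (N + 2) := by
      rw [abs_of_pos ht0, div_pow, pow_succ M (N + 1), pow_succ t (N + 1)]
      field_simp
    have h6 : (|t| / M) ^ (N + 2) ≤ |t| ^ (N + 2) := by
      gcongr
      exact div_le_self (abs_nonneg t) hM
    rw [h5]
    have h7 : M * f x M * (|t| / M) ^ (N + 2) ≤ B * E * (c * E) :=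
      mul_le_mul h4 (h6.trans h2) (by positivity) (by positivity)
    linarith [show B * E * (c * E) = B * c * (E * E) by ring]

/-- Comparison with the argument zero gives `θ * H(s) ≥ -C`, and `θ ≥ 1`. -/
lemma neg_le_auxH_of_auxH_le {g : EuclideanSpace ℝ (Fin N) → ℝ → ℝ} {θ C : ℝ} (hθ : 1 ≤ θ)
    (hC : 0 ≤ C) (hH : ∀ x t s, t ≤ s → auxH g x t ≤ θ * auxH g x s + C)
    (x : EuclideanSpace ℝ (Fin N)) {s : ℝ} (hs : 0 ≤ s) : -C ≤ auxH g x s := by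
  have h := hH x 0 s hs
  have h0 : auxH g x 0 = 0 := by simp [auxH]
  rw [h0] at h
  by_contra hlt
  push Not at hlt
  nlinarith

/-- Beyond `M` the lower bound at `M` is propagated by monotonicity of the shifted quotient, which
follows from `H ≥ -C`; the actual form of the continuation plays no role. -/
lemma exists_le_primF_truncate (hN : N ≠ 0) (hf : IsNonlinearity f) {θ C : ℝ}
    (hθ : 1 ≤ θ) (hC : 0 ≤ C) (hH : ∀ x t s, t ≤ s → auxH f x t ≤ θ * auxH f x s + C)
    (hsuper : ∀ L : ℝ, ∃ B, 0 ≤ B ∧ ∀ x ∈ Ω, ∀ t, 0 ≤ t → L * t ^ N - B ≤ primF f x t) (L : ℝ) :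
    ∃ B M₀, 0 ≤ B ∧ ∀ D ⊆ Ω, MeasurableSet D → ∀ M, M₀ ≤ M → 1 ≤ M → ∀ x ∈ D, ∀ t, 0 ≤ t →
      L * t ^ N - B ≤ primF (truncate D M f) x t := by
  obtain ⟨B, hB0, hB⟩ := hsuper L
  obtain ⟨B₁, hB₁0, hB₁⟩ := hsuper (L + 1)
  -- For `M` above this threshold the spare `M ^ N` in the bound with slope `L + 1` absorbs both
  -- constants, since `M ≤ M ^ N`.
  refine ⟨B, B₁ + C / N, hB0, fun D hDΩ hD M hM hM1 x hx t ht => ?_⟩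
  have hM0 : 0 < M := by linarith
  rcases le_total t M with htM | htM
  · rw [primF_truncate_of_le hM0 hx htM]
    exact hB x (hDΩ hx) t ht
  · have h1 := (hf.truncate hD hM0).div_pow_mul_primF_le hN hM0 htM
      fun τ hτ => neg_le_auxH_of_auxH_le hθ hC
        (fun x t s hts => auxH_truncate_le hf hD hM0 hθ hC hH x hts) x hτ
    rw [primF_truncate_of_le hM0 hx le_rfl] at h1
    have h2 := hB₁ x (hDΩ hx) M hM0.le
    have h3 : M ≤ M ^ N := le_self_pow₀ hM1 hN
    have h4 : L * M ^ N ≤ primF f x M - C / N := by linarith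
    have h5 : (t / M) ^ N * (L * M ^ N) ≤ (t / M) ^ N * (primF f x M - C / N) := by gcongr
    have h6 : (t / M) ^ N * (L * M ^ N) = L * t ^ N := by
      rw [div_pow]; field_simp
    have h7 : 0 ≤ C / N := by positivity
    linarith

end TruncationGrowth

/-! ### Compact exhaustion of `Ω`. -/

section Exhaustion

variable {N : ℕ} {Ω : Set (EuclideanSpace ℝ (Fin N))}

/-- The points of `Ω` at distance at least `1 / (n + 1)` from the complement. -/
def innerSet (Ω : Set (EuclideanSpace ℝ (Fin N))) (n : ℕ) : Set (EuclideanSpace ℝ (Fin N)) :=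
  {x | 1 / ((n : ℝ) + 1) ≤ Metric.infDist x Ωᶜ}

lemma innerSet_subset (n : ℕ) : innerSet Ω n ⊆ Ω := by
  intro x hx
  by_contra hxΩ
  have h1 : Metric.infDist x Ωᶜ = 0 := Metric.infDist_zero_of_mem hxΩ
  have h2 : 1 / ((n : ℝ) + 1) ≤ Metric.infDist x Ωᶜ := hx
  have h3 : (0 : ℝ) < 1 / ((n : ℝ) + 1) := Nat.one_div_pos_of_nat
  linarith

lemma isCompact_innerSet (hΩ : Bornology.IsBounded Ω) (n : ℕ) : IsCompact (innerSet Ω n) :=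
  Metric.isCompact_of_isClosed_isBounded
    (isClosed_le continuous_const (Metric.continuous_infDist_pt _)) (hΩ.subset (innerSet_subset n))

lemma exists_forall_subset_innerSet (hN : 1 ≤ N) (hΩo : IsOpen Ω) (hΩ : Bornology.IsBounded Ω)
    {K : Set (EuclideanSpace ℝ (Fin N))} (hK : IsCompact K) (hKΩ : K ⊆ Ω) :
    ∃ n₀, ∀ n, n₀ ≤ n → K ⊆ innerSet Ω n := by
  have : Nonempty (Fin N) := ⟨⟨0, by omega⟩⟩
  -- The distance to an empty complement would be zero by convention; boundedness of `Ω` excludes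
  -- this.
  have hne : Ωᶜ.Nonempty := by
    rw [nonempty_compl]
    rintro rfl
    exact NormedSpace.unbounded_univ ℝ (EuclideanSpace ℝ (Fin N)) hΩ
  have hpos : ∀ x ∈ K, 0 < Metric.infDist x Ωᶜ := fun x hx =>
    (hΩo.isClosed_compl.notMem_iff_infDist_pos hne).1 fun h => h (hKΩ hx)
  obtain ⟨r, hr, hle⟩ : ∃ r > 0, ∀ x ∈ K, r ≤ Metric.infDist x Ωᶜ := by
    rcases K.eq_empty_or_nonempty with rfl | hKne
    · exact ⟨1, one_pos, by simp⟩
    obtain ⟨x₀, hx₀, hmin⟩ := hK.exists_isMinOn hKne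
      (Metric.continuous_infDist_pt (Ωᶜ)).continuousOn
    exact ⟨_, hpos x₀ hx₀, fun x hx => hmin hx⟩
  obtain ⟨n₀, hn₀⟩ := exists_nat_one_div_lt hr
  refine ⟨n₀, fun n hn x hx => ?_⟩
  have h1 : 1 / ((n : ℝ) + 1) ≤ 1 / ((n₀ : ℝ) + 1) := by gcongr
  exact (h1.trans hn₀.le).trans (hle x hx)

end Exhaustion

/-! ### Mountain pass geometry, uniformly along the family. -/

section UniformFamily

variable {N : ℕ} {Ω : Set (EuclideanSpace ℝ (Fin N))}

/-- A sequence of nonlinearities which satisfies the growth conditions of the mountain pass theorem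
uniformly; the superlinear growth is required on the sets `D n` only. -/
structure UniformFamily (D : ℕ → Set (EuclideanSpace ℝ (Fin N)))
    (g : ℕ → EuclideanSpace ℝ (Fin N) → ℝ → ℝ) (θ C c δ : ℝ) : Prop where
  isNonlinearity : ∀ n, IsNonlinearity (g n)
  one_le : 1 ≤ θ
  nonneg : 0 ≤ C
  slope_nonneg : 0 ≤ c
  delta_pos : 0 < δ
  exists_le_exp : ∀ α : ℝ, 0 < α → ∃ B, 0 ≤ B ∧ ∀ n x t,
    |t| * g n x t ≤ B * Real.exp (α * |t| ^ ((N : ℝ) / (N - 1)))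
  auxH_le : ∀ n x t s, t ≤ s → auxH (g n) x t ≤ θ * auxH (g n) x s + C
  primF_le : ∀ n x t, 0 ≤ t → t ≤ δ → N * primF (g n) x t ≤ c * t ^ N
  exists_le_primF : ∀ L : ℝ, ∃ B n₀, 0 ≤ B ∧ ∀ n, n₀ ≤ n → ∀ x ∈ D n, ∀ t, 0 ≤ t →
    L * t ^ N - B ≤ primF (g n) x t

lemma mul_primF_le_of_neg_le_auxH {g : EuclideanSpace ℝ (Fin N) → ℝ → ℝ}
    (hg : IsNonlinearity g) {C : ℝ} (hC : 0 ≤ C) {x : EuclideanSpace ℝ (Fin N)}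
    (hH : ∀ s, 0 ≤ s → -C ≤ auxH g x s) (t : ℝ) : N * primF g x t ≤ |t| * g x t + C := by
  rcases le_total t 0 with ht | ht
  · rw [hg.primF_of_nonpos x ht, mul_zero]
    have := hg.nonneg x t
    positivity
  · have := hH t ht
    rw [auxH] at this
    rw [abs_of_nonneg ht]
    linarith

namespace UniformFamily

variable {D : ℕ → Set (EuclideanSpace ℝ (Fin N))} {g : ℕ → EuclideanSpace ℝ (Fin N) → ℝ → ℝ}
  {θ C c δ : ℝ}

lemma comp (h : UniformFamily D g θ C c δ) {ns : ℕ → ℕ} (hns : StrictMono ns) :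
    UniformFamily (fun n => D (ns n)) (fun n => g (ns n)) θ C c δ where
  isNonlinearity n := h.isNonlinearity _
  one_le := h.one_le
  nonneg := h.nonneg
  slope_nonneg := h.slope_nonneg
  delta_pos := h.delta_pos
  exists_le_exp α hα := by
    obtain ⟨B, hB, hle⟩ := h.exists_le_exp α hα
    exact ⟨B, hB, fun n => hle _⟩
  auxH_le n := h.auxH_le _
  primF_le n := h.primF_le _
  exists_le_primF L := by
    obtain ⟨B, n₀, hB, hle⟩ := h.exists_le_primF L
    exact ⟨B, n₀, hB, fun n hn => hle _ (hn.trans (hns.id_le n))⟩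

lemma mul_primF_le (h : UniformFamily D g θ C c δ) (n : ℕ)
    (x : EuclideanSpace ℝ (Fin N)) (t : ℝ) : N * primF (g n) x t ≤ |t| * g n x t + C :=
  mul_primF_le_of_neg_le_auxH (h.isNonlinearity n) h.nonneg
    (fun _ hs => neg_le_auxH_of_auxH_le h.one_le h.nonneg (h.auxH_le n) x hs) t

lemma exists_primF_le_exp (hN : N ≠ 0) (h : UniformFamily D g θ C c δ) {α : ℝ} (hα : 0 < α) :
    ∃ B, 0 ≤ B ∧ ∀ n x t,
      primF (g n) x t ≤ B * Real.exp (α * |t| ^ ((N : ℝ) / (N - 1))) := by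
  obtain ⟨B, hB, hle⟩ := h.exists_le_exp α hα
  have hC := h.nonneg
  refine ⟨B + C, by positivity, fun n x t => ?_⟩
  set E := Real.exp (α * |t| ^ ((N : ℝ) / (N - 1))) with hE
  have hE1 : 1 ≤ E := Real.one_le_exp (by positivity)
  have h1 := h.mul_primF_le n x t
  have h2 := (h.isNonlinearity n).primF_nonneg x t
  have h3 : (1 : ℝ) ≤ N := by exact_mod_cast Nat.one_le_iff_ne_zero.2 hN
  have h4 := hle n x t
  nlinarith

lemma integrable_primF (hN : 2 ≤ N) (hΩ : volume Ω ≠ ⊤) (h : UniformFamily D g θ C c δ) (n : ℕ)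
    {u : EuclideanSpace ℝ (Fin N) → ℝ} {G : EuclideanSpace ℝ (Fin N) → EuclideanSpace ℝ (Fin N)}
    (hu : MemSobolevOneZero Ω (N : ℝ≥0∞) u G) :
    IntegrableOn (fun x => primF (g n) x (u x)) Ω := by
  obtain ⟨a, _, ha, -, hT⟩ := exists_integral_exp_le_of_energy_le hN hΩ (∫ x in Ω, ‖G x‖ ^ N)
  obtain ⟨B, -, hB⟩ := h.exists_primF_le_exp (by omega) ha
  exact integrable_of_abs_le_exp ((h.isNonlinearity n).aestronglyMeasurable_primF hu.memLp.1)
    (hT _ _ hu le_rfl).1 (ae_of_all _ fun x => by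
      rw [abs_of_nonneg ((h.isNonlinearity n).primF_nonneg _ _)]
      exact hB n x _)

/-- Up to `δ` the slope condition applies; beyond `δ` the factor `(|t| / δ)^(N+1) ≥ 1` can be
inserted into the exponential bound. -/
lemma exists_mul_primF_le (hN : 2 ≤ N) (h : UniformFamily D g θ C c δ) {α : ℝ} (hα : 0 < α) :
    ∃ B, 0 ≤ B ∧ ∀ n x t, N * primF (g n) x t ≤
      c * |t| ^ N + B * (|t| ^ (N + 1) * Real.exp (α * |t| ^ ((N : ℝ) / (N - 1)))) := by
  obtain ⟨B, hB0, hB⟩ := h.exists_primF_le_exp (by omega) hα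
  have hδ := h.delta_pos
  have hc := h.slope_nonneg
  refine ⟨N * B / δ ^ (N + 1), by positivity, fun n x t => ?_⟩
  rcases le_total t 0 with ht | ht
  · rw [(h.isNonlinearity n).primF_of_nonpos x ht, mul_zero]
    positivity
  rcases le_total t δ with htδ | htδ
  · have h1 := h.primF_le n x t ht htδ
    rw [abs_of_nonneg ht]
    have : 0 ≤ N * B / δ ^ (N + 1) * (t ^ (N + 1) * Real.exp (α * t ^ ((N : ℝ) / (N - 1)))) := by
      positivity
    linarith
  · have h1 := hB n x t
    have h2 : (1 : ℝ) ≤ |t| ^ (N + 1) / δ ^ (N + 1) := by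
      rw [one_le_div (by positivity), abs_of_nonneg ht]
      gcongr
    set E := Real.exp (α * |t| ^ ((N : ℝ) / (N - 1)))
    have h3 : 0 ≤ c * |t| ^ N := by positivity
    calc N * primF (g n) x t ≤ N * (B * E) * 1 := by rw [mul_one]; gcongr
      _ ≤ N * (B * E) * (|t| ^ (N + 1) / δ ^ (N + 1)) := by gcongr
      _ = N * B / δ ^ (N + 1) * (|t| ^ (N + 1) * E) := by ring
      _ ≤ _ := by linarith

/-- The energy is bounded below by a positive constant on a small sphere. -/
theorem exists_le_energy (hN : 2 ≤ N) (hΩ : volume Ω ≠ ⊤) (h : UniformFamily D g θ C c δ)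
    (hcl : c < firstEigenvalue Ω) :
    ∃ ρ a : ℝ, 0 < ρ ∧ 0 < a ∧ ∀ n u G, MemSobolevOneZero Ω (N : ℝ≥0∞) u G →
      ∫ x in Ω, ‖G x‖ ^ N = ρ ^ N → a ≤ energy Ω (g n) u G := by
  have hN0 : N ≠ 0 := by omega
  have hNpos : (0 : ℝ) < N := by positivity
  have hc := h.slope_nonneg
  obtain ⟨κ, CT, hκ, hCT, hT⟩ := exists_integral_exp_le hN hΩ
  obtain ⟨B, hB0, hB⟩ := h.exists_mul_primF_le hN (half_pos hκ)
  have hq := one_le_div_pred hN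
  obtain ⟨cp, hcp, hpow⟩ := exists_pow_le_exp hq (half_pos hκ) (N + 1)
  set q := (N : ℝ) / (N - 1)
  set lam := firstEigenvalue Ω
  have hlam : 0 < lam := hc.trans_lt hcl
  -- The spectral gap. The Poincaré inequality leaves the share `η` of the gradient energy, and `ρ`
  -- is so small that the remainder, of order `ρ ^ (N + 1)`, uses at most half of it.
  set η := 1 - c / lam with hη
  have hη0 : 0 < η := by
    rw [hη, sub_pos, div_lt_one hlam]; exact hcl
  set K := B * (cp * CT) with hK
  have hK0 : 0 ≤ K := by positivity
  set ρ := min 1 (η / (2 * (K + 1))) with hρ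
  have hρ0 : 0 < ρ := lt_min one_pos (by positivity)
  have hρ1 : ρ ≤ 1 := min_le_left _ _
  have hKρ : K * ρ ≤ η / 2 := by
    calc K * ρ ≤ (K + 1) * (η / (2 * (K + 1))) := by
          gcongr
          · linarith
          · exact min_le_right _ _
      _ = η / 2 := by field_simp
  refine ⟨ρ, (1 / N) * (ρ ^ N * (η / 2)), hρ0, by positivity, fun n u G hu hG => ?_⟩
  obtain ⟨hi, hle⟩ := hT u G hu ρ hρ0 hG.le
  -- One half of the Trudinger exponent carries the growth of the nonlinearity, the other absorbs
  -- the power `s ^ (N + 1)`; the factor `ρ ^ (N + 1)` is split off by scaling.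
  have hpt : ∀ x, N * primF (g n) x (u x) ≤
      c * |u x| ^ N + B * (ρ ^ (N + 1) * (cp * Real.exp (κ * (|u x| / ρ) ^ q))) := by
    intro x
    refine (hB n x (u x)).trans (add_le_add le_rfl (mul_le_mul_of_nonneg_left ?_ hB0))
    set s := |u x| / ρ with hs
    have hs0 : 0 ≤ s := by positivity
    have hus : |u x| = ρ * s := by rw [hs]; field_simp
    have hus' : |u x| ≤ s := by
      rw [hus]; exact mul_le_of_le_one_left hs0 hρ1
    have e1 : Real.exp (κ * s ^ q) = Real.exp (κ / 2 * s ^ q) * Real.exp (κ / 2 * s ^ q) := by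
      rw [← Real.exp_add]; congr 1; ring
    have e2 : Real.exp (κ / 2 * |u x| ^ q) ≤ Real.exp (κ / 2 * s ^ q) := by gcongr
    rw [e1]
    calc |u x| ^ (N + 1) * Real.exp (κ / 2 * |u x| ^ q)
        = ρ ^ (N + 1) * s ^ (N + 1) * Real.exp (κ / 2 * |u x| ^ q) := by rw [hus, mul_pow]
      _ ≤ ρ ^ (N + 1) * (cp * Real.exp (κ / 2 * s ^ q)) * Real.exp (κ / 2 * s ^ q) := by
          gcongr
          exact hpow s hs0
      _ = _ := by ring
  have i1 : IntegrableOn (fun x => c * |u x| ^ N) Ω := (hu.integrable_pow hN hΩ N).const_mul c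
  have i2 : IntegrableOn (fun x => B * (ρ ^ (N + 1) * (cp * Real.exp (κ * (|u x| / ρ) ^ q)))) Ω :=
    ((hi.const_mul cp).const_mul _).const_mul B
  have h1 := integral_mono ((h.integrable_primF hN hΩ n hu).const_mul (N : ℝ)) (i1.add i2) hpt
  simp only [Pi.add_apply] at h1
  rw [integral_add i1 i2] at h1
  simp only [integral_const_mul] at h1
  have h2 := firstEigenvalue_mul_le (by omega) hu
  rw [hG] at h2
  have h3 : c * ∫ x in Ω, |u x| ^ N ≤ c / lam * ρ ^ N := by
    rw [div_mul_eq_mul_div, le_div_iff₀ hlam]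
    have := mul_le_mul_of_nonneg_left h2 hc
    linarith
  have h4 : B * (ρ ^ (N + 1) * (cp * ∫ x in Ω, Real.exp (κ * (|u x| / ρ) ^ q))) ≤
      ρ ^ N * (η / 2) := by
    calc B * (ρ ^ (N + 1) * (cp * ∫ x in Ω, Real.exp (κ * (|u x| / ρ) ^ q)))
        ≤ B * (ρ ^ (N + 1) * (cp * CT)) := by gcongr
      _ = ρ ^ N * (K * ρ) := by rw [hK]; ring
      _ ≤ _ := by gcongr
  rw [energy, hG]
  have h5 : ∫ x in Ω, primF (g n) x (u x) ≤ (1 / N) * (c / lam * ρ ^ N + ρ ^ N * (η / 2)) := by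
    rw [one_div, ← div_eq_inv_mul, le_div_iff₀ hNpos]
    linarith
  have h6 : (1 / (N : ℝ)) * ρ ^ N - (1 / N) * (c / lam * ρ ^ N + ρ ^ N * (η / 2)) =
      (1 / N) * (ρ ^ N * (η / 2)) := by
    rw [hη]; ring
  linarith

/-- The energies are bounded above along a ray. -/
theorem exists_energy_le (hN : 2 ≤ N) (hΩ : volume Ω ≠ ⊤) (h : UniformFamily D g θ C c δ)
    {e : EuclideanSpace ℝ (Fin N) → ℝ} (he : IsTestFunction Ω e) (he0 : ∀ x, 0 ≤ e x)
    (hepos : 0 < ∫ x in Ω, e x ^ N) {n₀ : ℕ} (hsupp : ∀ n, n₀ ≤ n → tsupport e ⊆ D n) :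
    ∃ β n₁, ∀ n, n₁ ≤ n → ∀ t : ℝ, 0 ≤ t →
      energy Ω (g n) (t • e) (gradient (t • e)) ≤ β := by
  have hN0 : N ≠ 0 := by omega
  have hNpos : (0 : ℝ) < N := by positivity
  have : IsFiniteMeasure (volume.restrict Ω) := ⟨by simpa using hΩ.lt_top⟩
  set I := ∫ x in Ω, e x ^ N
  set A := ∫ x in Ω, ‖gradient e x‖ ^ N with hA
  -- With this slope the lower bound for `∫ F(x, t e)` cancels the gradient term exactly, for all
  -- `t` at once.
  obtain ⟨B, n₁, hB0, hB⟩ := h.exists_le_primF ((1 / N) * A / I)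
  refine ⟨B * volume.real Ω, max n₀ n₁, fun n hn t ht => ?_⟩
  have hte : ∀ x, ((1 / N) * A / I) * t ^ N * e x ^ N - B ≤ primF (g n) x ((t • e) x) := by
    intro x
    by_cases hx : x ∈ tsupport e
    · have := hB n ((le_max_right _ _).trans hn) x (hsupp n ((le_max_left _ _).trans hn) hx)
        (t * e x) (mul_nonneg ht (he0 x))
      rw [mul_pow] at this
      simp only [Pi.smul_apply, smul_eq_mul]
      linarith
    · rw [image_eq_zero_of_notMem_tsupport hx, zero_pow hN0, mul_zero]
      have := (h.isNonlinearity n).primF_nonneg x ((t • e) x)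
      linarith
  have hW := (he.smul t).memSobolevOneZero (p := (N : ℝ≥0∞))
  have i1 : IntegrableOn (fun x => e x ^ N) Ω := by
    have := (he.memSobolevOneZero (p := (N : ℝ≥0∞))).integrable_pow hN hΩ N
    simpa only [abs_of_nonneg (he0 _)] using this
  have i2 : IntegrableOn (fun x => ((1 / N) * A / I) * t ^ N * e x ^ N) Ω := i1.const_mul _
  have h1 := integral_mono (i2.sub (integrable_const B)) (h.integrable_primF hN hΩ n hW) hte
  simp only [Pi.sub_apply] at h1
  rw [integral_sub i2 (integrable_const B), integral_const_mul] at h1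
  simp only [integral_const, measureReal_restrict_apply_univ, smul_eq_mul] at h1
  have h2 : (1 / N) * A / I * t ^ N * I = (1 / N) * A * t ^ N := by field_simp
  have h3 : ∫ x in Ω, ‖gradient (t • e) x‖ ^ N = t ^ N * A := by
    simp only [he.gradient_smul, norm_smul, mul_pow, Real.norm_of_nonneg ht]
    rw [integral_const_mul]
  rw [energy, h3]
  linarith

/-- Comparison of the energy of a critical point with the energy of its contractions. -/
lemma energy_dilation_le (hN : 2 ≤ N) (hΩ : volume Ω ≠ ⊤) (h : UniformFamily D g θ C c δ) (n : ℕ)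
    {u : EuclideanSpace ℝ (Fin N) → ℝ} {G : EuclideanSpace ℝ (Fin N) → EuclideanSpace ℝ (Fin N)}
    (hu : MemSobolevOneZero Ω (N : ℝ≥0∞) u G) (hu0 : ∀ᵐ x ∂(volume.restrict Ω), 0 ≤ u x)
    (hgu : IntegrableOn (fun x => g n x (u x) * u x) Ω)
    (hcrit : ∫ x in Ω, ‖G x‖ ^ N = ∫ x in Ω, g n x (u x) * u x)
    (hE : 0 ≤ energy Ω (g n) u G) {t : ℝ} (ht : 0 < t) (ht1 : t ≤ 1) :
    (1 / N) * (t ^ N * ∫ x in Ω, ‖G x‖ ^ N) - ∫ x in Ω, primF (g n) x (t * u x) ≤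
      θ * energy Ω (g n) u G + C * volume.real Ω / N := by
  have hN0 : N ≠ 0 := by omega
  have hNpos : (0 : ℝ) < N := by positivity
  have : IsFiniteMeasure (volume.restrict Ω) := ⟨by simpa using hΩ.lt_top⟩
  have hN1 : (1 : ℝ≥0∞) ≤ N := by exact_mod_cast (by omega : 1 ≤ N)
  have i1 := h.integrable_primF hN hΩ n hu
  have i2 := h.integrable_primF hN hΩ n (hu.smul hN1 hΩ t)
  have i3 : IntegrableOn (fun x => (1 - t ^ N) / N *
      (θ * (g n x (u x) * u x - N * primF (g n) x (u x)) + C)) Ω :=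
    ((((hgu.sub (i1.const_mul (N : ℝ))).const_mul θ).add (integrable_const C)).const_mul _)
  have h1 : ∫ x in Ω, t ^ N * primF (g n) x (u x) ≤ ∫ x in Ω, (primF (g n) x (t * u x) +
      (1 - t ^ N) / N * (θ * (g n x (u x) * u x - N * primF (g n) x (u x)) + C)) := by
    refine integral_mono_ae (i1.const_mul _) (i2.add i3) ?_
    filter_upwards [hu0] with x hx
    -- The pointwise constant is `θ * H(x, u x) + C`, valid for all smaller arguments by (L3). For a
    -- critical point `∫ H(x, u)` is `N` times the energy.
    have := (h.isNonlinearity n).pow_mul_primF_le (x := x) hN0 hx ht ht1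
      fun τ hτ => h.auxH_le n x τ _ hτ
    refine this.trans (le_of_eq ?_)
    rw [auxH]
    ring
  have i4 : IntegrableOn (fun x => g n x (u x) * u x - N * primF (g n) x (u x)) Ω :=
    hgu.sub (i1.const_mul (N : ℝ))
  rw [integral_const_mul, integral_add i2 i3, integral_const_mul,
    integral_add (i4.const_mul θ) (integrable_const C), integral_const_mul,
    integral_sub hgu (i1.const_mul (N : ℝ)), integral_const_mul, ← hcrit] at h1
  simp only [integral_const, measureReal_restrict_apply_univ, smul_eq_mul] at h1
  set a := ∫ x in Ω, ‖G x‖ ^ N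
  set P := ∫ x in Ω, primF (g n) x (u x)
  have hEdef : energy Ω (g n) u G = (1 / N) * a - P := rfl
  set E := energy Ω (g n) u G
  have h2 : a - N * P = N * E := by rw [hEdef]; field_simp
  rw [h2] at h1
  have htN0 : 0 ≤ t ^ N := by positivity
  have htN1 : t ^ N ≤ 1 := pow_le_one₀ ht.le ht1
  have h3 : (1 - t ^ N) / N * (θ * (N * E) + volume.real Ω * C) =
      (1 - t ^ N) * (θ * E + C * volume.real Ω / N) := by field_simp
  rw [h3] at h1
  -- This absorbs the remaining term `t ^ N * E`, so the final bound does not depend on `t`; it uses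
  -- `E ≥ 0`.
  have h4 : E ≤ θ * E + C * volume.real Ω / N := by
    have : 0 ≤ C * volume.real Ω / N := by
      have := h.nonneg
      positivity
    nlinarith [h.one_le]
  have h5 : t ^ N * E ≤ t ^ N * (θ * E + C * volume.real Ω / N) := by gcongr
  have h6 : (1 / N) * (t ^ N * a) = t ^ N * E + t ^ N * P := by rw [hEdef]; ring
  rw [h6]
  linarith

end UniformFamily

end UniformFamily

/-! ### Boundedness of critical sequences. -/

section CriticalSequences

variable {N : ℕ} {Ω : Set (EuclideanSpace ℝ (Fin N))}

/-- `u`, with weak gradient `G`, is a nonnegative solution of `-div (|∇u|^{N-2} ∇u) = g(x,u)` with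
energy in `[a,β]`. -/
structure IsCriticalWithEnergy (Ω : Set (EuclideanSpace ℝ (Fin N)))
    (g : EuclideanSpace ℝ (Fin N) → ℝ → ℝ) (a β : ℝ) (u : EuclideanSpace ℝ (Fin N) → ℝ)
    (G : EuclideanSpace ℝ (Fin N) → EuclideanSpace ℝ (Fin N)) : Prop where
  isWeakSolution : IsWeakSolution Ω g u G
  nonneg : ∀ᵐ x ∂(volume.restrict Ω), 0 ≤ u x
  le_energy : a ≤ energy Ω g u G
  energy_le : energy Ω g u G ≤ β

lemma IsWeakSolution.integral_norm_pow_eq (hN : 2 ≤ N) {g : EuclideanSpace ℝ (Fin N) → ℝ → ℝ}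
    {u : EuclideanSpace ℝ (Fin N) → ℝ} {G : EuclideanSpace ℝ (Fin N) → EuclideanSpace ℝ (Fin N)}
    (h : IsWeakSolution Ω g u G) : ∫ x in Ω, ‖G x‖ ^ N = ∫ x in Ω, g x (u x) * u x := by
  rw [← h.integral_eq u G h.mem]
  refine integral_congr_ae (ae_of_all _ fun x => ?_)
  simp only [real_inner_self_eq_norm_sq]
  rw [← pow_add, Nat.sub_add_cancel hN]

namespace UniformFamily

variable {D : ℕ → Set (EuclideanSpace ℝ (Fin N))} {g : ℕ → EuclideanSpace ℝ (Fin N) → ℝ → ℝ}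
  {θ C c δ a β : ℝ} {u : ℕ → EuclideanSpace ℝ (Fin N) → ℝ}
  {G : ℕ → EuclideanSpace ℝ (Fin N) → EuclideanSpace ℝ (Fin N)}

/-- Normalised critical points with unbounded gradients tend to zero. -/
lemma integral_pow_eq_zero_of_normalized (hN : 2 ≤ N) (hΩo : IsOpen Ω) (hΩ : volume Ω ≠ ⊤)
    (h : UniformFamily D g θ C c δ) (hD : ∀ x ∈ Ω, ∀ᶠ n in atTop, x ∈ D n)
    (hDm : ∀ n, MeasurableSet (D n)) (ha : 0 ≤ a)
    (hu : ∀ n, IsCriticalWithEnergy Ω (g n) a β (u n) (G n)) {K : ℕ → ℝ} (hK0 : ∀ n, 0 < K n)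
    (hK : ∀ n, ∫ x in Ω, ‖G n x‖ ^ N = K n ^ N) (hKlim : Tendsto K atTop atTop)
    {w₀ : EuclideanSpace ℝ (Fin N) → ℝ}
    (hw : ∀ᵐ x ∂(volume.restrict Ω), Tendsto (fun n => (K n)⁻¹ * u n x) atTop (𝓝 (w₀ x))) :
    w₀ =ᵐ[volume.restrict Ω] 0 := by
  have hN0 : N ≠ 0 := by omega
  have hNpos : (0 : ℝ) < N := by positivity
  have : IsFiniteMeasure (volume.restrict Ω) := ⟨by simpa using hΩ.lt_top⟩
  have hN1 : (1 : ℝ≥0∞) ≤ N := by exact_mod_cast (by omega : 1 ≤ N)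
  have hW : ∀ n, MemSobolevOneZero Ω (N : ℝ≥0∞) (fun x => (K n)⁻¹ * u n x)
      (fun x => (K n)⁻¹ • G n x) := fun n => (hu n).isWeakSolution.mem.smul hN1 hΩ _
  have hWn : ∀ n, ∫ x in Ω, ‖(K n)⁻¹ • G n x‖ ^ N ≤ 1 := fun n => by
    simp only [norm_smul, mul_pow, norm_inv, Real.norm_of_nonneg (hK0 n).le]
    rw [integral_const_mul, hK, ← mul_pow, inv_mul_cancel₀ (hK0 n).ne', one_pow]
  obtain ⟨α, A, hα, -, hT⟩ := exists_integral_exp_le_of_energy_le hN hΩ 1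
  obtain ⟨B, hB0, hB⟩ := exists_pow_le_exp (one_le_div_pred hN) (half_pos hα) N
  -- The superlinear lower bound holds only on `D n`, hence the indicator; it disappears in the
  -- limit because each point of `Ω` eventually lies in `D n`.
  have hlim := tendsto_integral_of_exp_bound hΩ (C := B)
    (h := fun n => (D n).indicator fun x => |(K n)⁻¹ * u n x| ^ N) (h₀ := fun x => |w₀ x| ^ N)
    (fun n => ((hW n).memLp.1.norm.pow N).indicator (hDm n))
    (by
      filter_upwards [hw, ae_restrict_mem hΩo.measurableSet] with x hx hxΩ
      refine (hx.abs.pow N).congr' ?_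
      filter_upwards [hD x hxΩ] with n hn
      rw [indicator_of_mem hn])
    (fun n => (hT _ _ (hW n) (hWn n)).1) (fun n => (hT _ _ (hW n) (hWn n)).2)
    (fun n => ae_of_all _ fun x => by
      rw [abs_of_nonneg (indicator_nonneg (fun x _ => by positivity) x)]
      exact (indicator_le_self' (fun _ _ => by positivity) x).trans (hB _ (abs_nonneg _)))
  -- Nonnegative energy gives `∫ F(x, u n) ≤ K n ^ N / N`. Dividing the superlinear bound by `K n ^
  -- N` removes its constant in the limit; as `L` is arbitrary, `∫ |w₀|^N` must vanish.
  have hL : ∀ L : ℝ, 0 ≤ L → L * ∫ x in Ω, |w₀ x| ^ N ≤ 1 / N := by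
    intro L hL0
    obtain ⟨B₁, n₀, hB₁, hle⟩ := h.exists_le_primF L
    have hr : Tendsto (fun n => 1 / (N : ℝ) + B₁ * volume.real Ω / K n ^ N) atTop (𝓝 (1 / N)) := by
      have := (tendsto_const_nhds (x := B₁ * volume.real Ω)).div_atTop
        ((tendsto_pow_atTop hN0).comp hKlim)
      simpa using this.const_add (1 / (N : ℝ))
    refine le_of_tendsto_of_tendsto (hlim.2.2.const_mul L) hr ?_
    filter_upwards [eventually_ge_atTop n₀] with n hn
    have i1 := h.integrable_primF hN hΩ n (hu n).isWeakSolution.mem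
    have hKn := pow_pos (hK0 n) N
    have i2 : IntegrableOn (fun x => (K n ^ N)⁻¹ * (primF (g n) x (u n x) + B₁)) Ω :=
      (i1.add (integrable_const B₁)).const_mul _
    have i3 : IntegrableOn ((D n).indicator fun x => |(K n)⁻¹ * u n x| ^ N) Ω :=
      ((hW n).integrable_pow hN hΩ N).indicator (hDm n)
    rw [← integral_const_mul]
    refine (integral_mono_ae (i3.const_mul L) i2 ?_).trans ?_
    · filter_upwards [(hu n).nonneg] with x hx
      have hF := (h.isNonlinearity n).primF_nonneg x (u n x)
      by_cases hxD : x ∈ D n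
      · rw [indicator_of_mem hxD, abs_mul, mul_pow, abs_inv, abs_of_pos (hK0 n), abs_of_nonneg hx,
          inv_pow]
        have h1 := hle n hn x hxD (u n x) hx
        rw [mul_left_comm]
        gcongr
        linarith
      · rw [indicator_of_notMem hxD, mul_zero]
        positivity
    · rw [integral_const_mul, integral_add i1 (integrable_const B₁)]
      simp only [integral_const, measureReal_restrict_apply_univ, smul_eq_mul]
      have hE := ha.trans (hu n).le_energy
      rw [energy, hK] at hE
      rw [inv_mul_le_iff₀ hKn, mul_add, mul_div_cancel₀ _ hKn.ne']
      linarith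
  have h0 : ∫ x in Ω, |w₀ x| ^ N = 0 := by
    refine le_antisymm ?_ (integral_nonneg fun x => by positivity)
    by_contra hpos
    push Not at hpos
    have := hL (2 / (∫ x in Ω, |w₀ x| ^ N)) (by positivity)
    rw [div_mul_cancel₀ _ hpos.ne'] at this
    have h1 : (1 : ℝ) ≤ N := by exact_mod_cast (by omega : 1 ≤ N)
    have h2 : 1 / (N : ℝ) ≤ 1 := by rw [div_le_one hNpos]; exact h1
    linarith
  have h1 := (integral_eq_zero_iff_of_nonneg (fun x => by positivity) hlim.1).1 h0
  filter_upwards [h1] with x hx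
  exact abs_eq_zero.1 ((pow_eq_zero_iff hN0).1 hx)

/-- The functions `R * w_n` tend to zero almost everywhere, so their energies tend to `R ^ N / N`;
but they are contractions of `u n` once `K n ≥ R`, and contractions have energy at most `θ * β + C *
|Ω| / N`. -/
lemma false_of_normalized (hN : 2 ≤ N) (hΩo : IsOpen Ω) (hΩ : volume Ω ≠ ⊤)
    (h : UniformFamily D g θ C c δ) (hD : ∀ x ∈ Ω, ∀ᶠ n in atTop, x ∈ D n)
    (hDm : ∀ n, MeasurableSet (D n)) (ha : 0 ≤ a)
    (hu : ∀ n, IsCriticalWithEnergy Ω (g n) a β (u n) (G n)) {K : ℕ → ℝ} (hK0 : ∀ n, 0 < K n)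
    (hK : ∀ n, ∫ x in Ω, ‖G n x‖ ^ N = K n ^ N) (hKlim : Tendsto K atTop atTop)
    {w₀ : EuclideanSpace ℝ (Fin N) → ℝ}
    (hw : ∀ᵐ x ∂(volume.restrict Ω), Tendsto (fun n => (K n)⁻¹ * u n x) atTop (𝓝 (w₀ x))) :
    False := by
  have hN0 : N ≠ 0 := by omega
  have hNpos : (0 : ℝ) < N := by positivity
  have hN1 : (1 : ℝ≥0∞) ≤ N := by exact_mod_cast (by omega : 1 ≤ N)
  have hw0 := h.integral_pow_eq_zero_of_normalized hN hΩo hΩ hD hDm ha hu hK0 hK hKlim hw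
  set B₀ := θ * β + C * volume.real Ω / N
  -- Chosen with `R ≥ 1` and `R / N > B₀`, hence `R ^ N / N > B₀`.
  set R := N * (|B₀| + 1) with hR
  have hR1 : 1 ≤ R := by
    have : (1 : ℝ) ≤ N := by exact_mod_cast (by omega : 1 ≤ N)
    nlinarith [abs_nonneg B₀]
  have hR0 : 0 < R := by linarith
  have hRB : B₀ < (1 / N) * R ^ N := by
    have h1 : R ≤ R ^ N := le_self_pow₀ hR1 hN0
    have h2 : (1 / N) * R = |B₀| + 1 := by rw [hR]; field_simp
    have h3 : (1 / N) * R ≤ (1 / N) * R ^ N := by gcongr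
    linarith [le_abs_self B₀]
  have hW : ∀ n, MemSobolevOneZero Ω (N : ℝ≥0∞) (fun x => R / K n * u n x)
      (fun x => (R / K n) • G n x) := fun n => (hu n).isWeakSolution.mem.smul hN1 hΩ _
  have hWn : ∀ n, ∫ x in Ω, ‖(R / K n) • G n x‖ ^ N ≤ R ^ N := fun n => by
    simp only [norm_smul, mul_pow, norm_div, Real.norm_of_nonneg (hK0 n).le,
      Real.norm_of_nonneg hR0.le]
    rw [integral_const_mul, hK, ← mul_pow, div_mul_cancel₀ _ (hK0 n).ne']
  obtain ⟨α, A, hα, -, hT⟩ := exists_integral_exp_le_of_energy_le hN hΩ (R ^ N)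
  obtain ⟨B, hB0, hB⟩ := h.exists_primF_le_exp hN0 (half_pos hα)
  have hlim := tendsto_integral_of_exp_bound hΩ (C := B)
    (h := fun n x => primF (g n) x (R / K n * u n x)) (h₀ := fun _ => 0)
    (fun n => (h.isNonlinearity n).aestronglyMeasurable_primF (hW n).memLp.1)
    (by
      filter_upwards [hw, hw0, ae_all_iff.2 fun n => (hu n).nonneg] with x hx hx0 hxn
      have h1 : Tendsto (fun n => R / K n * u n x) atTop (𝓝 0) := by
        have := hx.const_mul R
        rw [hx0, Pi.zero_apply, mul_zero] at this
        refine this.congr fun n => ?_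
        ring
      have h2 : Tendsto (fun n => c * (R / K n * u n x) ^ N) atTop (𝓝 0) := by
        simpa [hN0] using (h1.pow N).const_mul c
      refine squeeze_zero' (Eventually.of_forall fun n => (h.isNonlinearity n).primF_nonneg _ _)
        ?_ h2
      filter_upwards [h1.eventually_le_const h.delta_pos] with n hn
      have h3 := h.primF_le n x _ (mul_nonneg (div_nonneg hR0.le (hK0 n).le) (hxn n)) hn
      have h4 := (h.isNonlinearity n).primF_nonneg x (R / K n * u n x)
      have h5 : (1 : ℝ) ≤ N := by exact_mod_cast (by omega : 1 ≤ N)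
      nlinarith)
    (fun n => (hT _ _ (hW n) (hWn n)).1) (fun n => (hT _ _ (hW n) (hWn n)).2)
    (fun n => ae_of_all _ fun x => by
      rw [abs_of_nonneg ((h.isNonlinearity n).primF_nonneg _ _)]
      exact hB n x _)
  have hlim2 : Tendsto (fun n => (1 / N) * R ^ N - ∫ x in Ω, primF (g n) x (R / K n * u n x)) atTop
      (𝓝 ((1 / N) * R ^ N)) := by
    have := hlim.2.2.const_sub ((1 / N) * R ^ N)
    simpa using this
  refine absurd (le_of_tendsto hlim2 ?_) (not_le.2 hRB)
  filter_upwards [hKlim.eventually_ge_atTop R] with n hn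
  have hs := (hu n).isWeakSolution
  have h1 := h.energy_dilation_le hN hΩ n hs.mem (hu n).nonneg (hs.integrableOn _ _ hs.mem)
    (hs.integral_norm_pow_eq hN) (ha.trans (hu n).le_energy) (div_pos hR0 (hK0 n))
    ((div_le_one (hK0 n)).2 hn)
  rw [hK, ← mul_pow, div_mul_cancel₀ _ (hK0 n).ne'] at h1
  refine h1.trans ?_
  have := mul_le_mul_of_nonneg_left (hu n).energy_le (by linarith [h.one_le] : 0 ≤ θ)
  linarith

/-- Critical points of bounded energy are bounded in `W_0^{1,N}`. -/
theorem exists_integral_norm_pow_le (hN : 2 ≤ N) (hΩo : IsOpen Ω) (hΩb : Bornology.IsBounded Ω)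
    (h : UniformFamily D g θ C c δ) (hD : ∀ x ∈ Ω, ∀ᶠ n in atTop, x ∈ D n)
    (hDm : ∀ n, MeasurableSet (D n)) (ha : 0 ≤ a)
    (hu : ∀ n, IsCriticalWithEnergy Ω (g n) a β (u n) (G n)) :
    ∃ A, ∀ n, ∫ x in Ω, ‖G n x‖ ^ N ≤ A := by
  have hΩ : volume Ω ≠ ⊤ := hΩb.measure_lt_top.ne
  have hN0 : N ≠ 0 := by omega
  have hNpos : (0 : ℝ) < N := by positivity
  have hN1 : (1 : ℝ≥0∞) ≤ N := by exact_mod_cast (by omega : 1 ≤ N)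
  by_contra hcon
  -- Every level is exceeded infinitely often, since a sequence that is eventually bounded is
  -- bounded; this allows a strictly increasing choice of indices.
  have hfreq : ∀ j : ℕ, ∃ᶠ n in atTop, ((j : ℝ) + 1) < ∫ x in Ω, ‖G n x‖ ^ N := by
    intro j
    rw [Filter.Frequently]
    intro hev
    have hbdd : BddAbove (range fun n => ∫ x in Ω, ‖G n x‖ ^ N) :=
      Filter.IsBoundedUnder.bddAbove_range ⟨(j : ℝ) + 1, by
        rw [eventually_map]
        filter_upwards [hev] with n hn
        exact not_lt.1 hn⟩
    obtain ⟨A, hA⟩ := hbdd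
    exact hcon ⟨A, fun n => hA ⟨n, rfl⟩⟩
  obtain ⟨ms, hms, hlarge⟩ := extraction_forall_of_frequently hfreq
  set K : ℕ → ℝ := fun n => (∫ x in Ω, ‖G (ms n) x‖ ^ N) ^ ((N : ℝ)⁻¹) with hKdef
  have hpos : ∀ n, 0 < ∫ x in Ω, ‖G (ms n) x‖ ^ N := fun n =>
    (by positivity : (0 : ℝ) < n + 1).trans (hlarge n)
  have hK0 : ∀ n, 0 < K n := fun n => Real.rpow_pos_of_pos (hpos n) _
  have hK : ∀ n, ∫ x in Ω, ‖G (ms n) x‖ ^ N = K n ^ N := fun n =>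
    (Real.rpow_inv_natCast_pow (hpos n).le hN0).symm
  have hKlim : Tendsto K atTop atTop := by
    refine (tendsto_rpow_atTop (by positivity : 0 < (N : ℝ)⁻¹)).comp ?_
    refine tendsto_atTop_mono (fun n => ?_) tendsto_natCast_atTop_atTop
    linarith [hlarge n]
  obtain ⟨ns, hns, w₀, hw₀⟩ := exists_subseq_tendsto_ae (by omega) hΩb (C := 1)
    (u := fun n x => (K n)⁻¹ * u (ms n) x) (G := fun n x => (K n)⁻¹ • G (ms n) x)
    (fun n => (hu (ms n)).isWeakSolution.mem.smul hN1 hΩ _) fun n => by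
      simp only [norm_smul, mul_pow, norm_inv, Real.norm_of_nonneg (hK0 n).le]
      rw [integral_const_mul, hK, ← mul_pow, inv_mul_cancel₀ (hK0 n).ne', one_pow]
  exact (h.comp (hms.comp hns)).false_of_normalized hN hΩo hΩ
    (fun x hx => (hms.comp hns).tendsto_atTop.eventually (hD x hx)) (fun n => hDm _) ha
    (fun n => hu _) (K := fun n => K (ns n)) (fun n => hK0 _) (fun n => hK _)
    (hKlim.comp hns.tendsto_atTop) hw₀

end UniformFamily

end CriticalSequences

/-! ### Passage to the limit in the truncated problems. -/

section LimitProblem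

variable {N : ℕ} {Ω : Set (EuclideanSpace ℝ (Fin N))}

/-- A sequence of critical points for a uniform family yields a solution of the limit problem. -/
theorem UniformFamily.exists_isWeakSolution (hN : 2 ≤ N) (hΩo : IsOpen Ω)
    (hΩb : Bornology.IsBounded Ω) {D : ℕ → Set (EuclideanSpace ℝ (Fin N))}
    {g : ℕ → EuclideanSpace ℝ (Fin N) → ℝ → ℝ} {θ C c δ a β : ℝ}
    {u : ℕ → EuclideanSpace ℝ (Fin N) → ℝ}
    {G : ℕ → EuclideanSpace ℝ (Fin N) → EuclideanSpace ℝ (Fin N)}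
    (h : UniformFamily D g θ C c δ) (hD : ∀ x ∈ Ω, ∀ᶠ n in atTop, x ∈ D n)
    (hDm : ∀ n, MeasurableSet (D n)) (ha : 0 < a)
    (hu : ∀ n, IsCriticalWithEnergy Ω (g n) a β (u n) (G n))
    {f : EuclideanSpace ℝ (Fin N) → ℝ → ℝ} (hfc : ∀ x ∈ Ω, Continuous (f x))
    (hf0 : ∀ x ∈ Ω, ∀ t, 0 ≤ f x t)
    (hconv : ∀ x ∈ Ω, ∀ R : ℝ, ∀ᶠ n in atTop, ∀ t ≤ R, g n x t = f x t)
    (hloc : ∀ K ⊆ Ω, IsCompact K → ∃ B : ℝ, 0 ≤ B ∧ ∀ n, ∀ x ∈ K, ∀ t,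
      g n x t ≤ B + |t| * g n x t) :
    ∃ u₀ G₀, IsWeakSolution Ω f u₀ G₀ ∧ (∀ᵐ x ∂(volume.restrict Ω), 0 ≤ u₀ x) ∧
      ¬ (u₀ =ᵐ[volume.restrict Ω] 0) := by
  have hΩ : volume Ω ≠ ⊤ := hΩb.measure_lt_top.ne
  have hN0 : N ≠ 0 := by omega
  have hNpos : (0 : ℝ) < N := by positivity
  have hN1 : (1 : ℝ≥0∞) ≤ N := by exact_mod_cast (by omega : 1 ≤ N)
  obtain ⟨A, hA⟩ := h.exists_integral_norm_pow_le hN hΩo hΩb hD hDm ha.le hu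
  have huW : ∀ n, MemSobolevOneZero Ω (N : ℝ≥0∞) (u n) (G n) := fun n => (hu n).isWeakSolution.mem
  obtain ⟨ns, hns, ⟨u₀, hu₀⟩, ℓ, hℓ⟩ := exists_subseq_tendsto_ae_and_energy (by omega) hΩb huW hA
  obtain ⟨α, A', hα, -, hT⟩ := exists_integral_exp_le_of_energy_le hN hΩ A
  obtain ⟨B, hB0, hB⟩ := h.exists_le_exp (α / 2) (half_pos hα)
  have hum : ∀ k, AEStronglyMeasurable (u k) (volume.restrict Ω) := fun k => (huW k).memLp.1
  have hgm : ∀ k, AEStronglyMeasurable (fun x => g k x (u k x)) (volume.restrict Ω) :=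
    fun k => (h.isNonlinearity k).aestronglyMeasurable_comp (hum k)
  have hpt : ∀ᵐ x ∂(volume.restrict Ω),
      Tendsto (fun k => g (ns k) x (u (ns k) x)) atTop (𝓝 (f x (u₀ x))) := by
    filter_upwards [hu₀, ae_restrict_mem hΩo.measurableSet] with x hx hxΩ
    refine (((hfc x hxΩ).tendsto _).comp hx).congr' ?_
    filter_upwards [hns.tendsto_atTop.eventually (hconv x hxΩ (u₀ x + 1)),
      hx.eventually_le_const (lt_add_one _)] with k hk1 hk2
    exact (hk1 _ hk2).symm
  have hfm : AEStronglyMeasurable (fun x => f x (u₀ x)) (volume.restrict Ω) :=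
    aestronglyMeasurable_of_tendsto_ae atTop (fun k => hgm (ns k)) hpt
  have hu₀nn : ∀ᵐ x ∂(volume.restrict Ω), 0 ≤ u₀ x := by
    filter_upwards [hu₀, ae_all_iff.2 fun n => (hu n).nonneg] with x hx hx2
    exact ge_of_tendsto' hx fun k => hx2 _
  -- Only the product `t * g(x,t)` is exponentially bounded uniformly in `x`, so convergence is
  -- available for this integral and not for `g` alone.
  have hlimS := tendsto_integral_of_exp_bound hΩ (C := B)
    (h := fun k x => g (ns k) x (u (ns k) x) * u (ns k) x) (h₀ := fun x => f x (u₀ x) * u₀ x)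
    (fun k => (hgm _).mul (hum _))
    (by filter_upwards [hpt, hu₀] with x hx hx2
        exact hx.mul hx2)
    (fun k => (hT _ _ (huW _) (hA _)).1) (fun k => (hT _ _ (huW _) (hA _)).2)
    (fun k => ae_of_all _ fun x => by
      rw [abs_mul, abs_of_nonneg ((h.isNonlinearity _).nonneg _ _), mul_comm]
      exact hB _ _ _)
  set S := ∫ x in Ω, f x (u₀ x) * u₀ x
  -- strong convergence of the gradients
  obtain ⟨G₀, hG₀, hGlim⟩ := exists_limit_of_monotonicity hN hΩ (fun k => huW (ns k))
    (fun k => hA (ns k)) hℓ hu₀ (by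
      by_contra hcon
      push Not at hcon
      obtain ⟨ε, hε, hcon⟩ := hcon
      choose l k hl hlk hgt using hcon
      have hltop : Tendsto l atTop atTop := tendsto_atTop_mono hl tendsto_id
      have hktop : Tendsto k atTop atTop :=
        tendsto_atTop_mono (fun i => (hl i).trans (hlk i)) tendsto_id
      -- If the monotonicity estimate failed, then `∫ g_k(u_k) u_l` would stay below `S - ε / 2` for
      -- large indices; by Fatou's lemma its lower limit is at least `S`.
      have hS := integrable_of_tendsto_of_integral_le (μ := volume.restrict Ω)
        (h := fun i x => g (ns (k i)) x (u (ns (k i)) x) * u (ns (l i)) x)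
        (h₀ := fun x => f x (u₀ x) * u₀ x) (C := S - ε / 2)
        (fun i => (hu (ns (k i))).isWeakSolution.integrableOn _ _ (huW _))
        (fun i => by
          filter_upwards [(hu (ns (l i))).nonneg] with x hx
          exact mul_nonneg ((h.isNonlinearity _).nonneg _ _) hx)
        (by filter_upwards [hpt, hu₀] with x hx hx2
            exact (hx.comp hktop).mul (hx2.comp hltop))
        (by
          filter_upwards [(hlimS.2.2.comp hktop).eventually_lt_const
            (by linarith : S < S + ε / 2)] with i hi
          have h1 := (hu (ns (k i))).isWeakSolution.integral_eq _ _
            ((huW (ns (k i))).sub hN1 hΩ (huW (ns (l i))))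
          have h2 := hgt i
          rw [h1] at h2
          simp only [mul_sub] at h2
          rw [integral_sub ((hu (ns (k i))).isWeakSolution.integrableOn _ _ (huW _))
            ((hu (ns (k i))).isWeakSolution.integrableOn _ _ (huW _))] at h2
          simp only [Function.comp] at hi
          linarith)
      linarith [hS.2])
  -- the limit equation
  have hφ : ∀ φ, IsTestFunction Ω φ → IntegrableOn (fun x => f x (u₀ x) * φ x) Ω ∧
      ∫ x in Ω, ‖G₀ x‖ ^ (N - 2) * inner ℝ (G₀ x) (gradient φ x) =
        ∫ x in Ω, f x (u₀ x) * φ x := by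
    intro φ hφ
    obtain ⟨b, hb⟩ := hφ.exists_bound
    have hb0 : 0 ≤ b := (abs_nonneg _).trans (hb 0)
    -- On the support of `φ` the nonlinearities are bounded by a constant plus `|t| * g`, so the
    -- exponential bound becomes available.
    obtain ⟨B', hB'0, hB'⟩ := hloc _ hφ.tsupport_subset hφ.hasCompactSupport
    have hl := tendsto_integral_of_exp_bound hΩ (C := (B' + B) * b)
      (h := fun k x => g (ns k) x (u (ns k) x) * φ x) (h₀ := fun x => f x (u₀ x) * φ x)
      (fun k => (hgm _).mul (hφ.memLp 1 Ω).1)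
      (by filter_upwards [hpt] with x hx
          exact hx.mul_const _)
      (fun k => (hT _ _ (huW _) (hA _)).1) (fun k => (hT _ _ (huW _) (hA _)).2)
      (fun k => ae_of_all _ fun x => by
        by_cases hx : x ∈ tsupport φ
        · rw [abs_mul, abs_of_nonneg ((h.isNonlinearity _).nonneg _ _), mul_right_comm]
          refine mul_le_mul ((hB' (ns k) x hx _).trans ?_) (hb x) (abs_nonneg _) (by positivity)
          have h1 := hB (ns k) x (u (ns k) x)
          have h2 : 1 ≤ Real.exp (α / 2 * |u (ns k) x| ^ ((N : ℝ) / (N - 1))) :=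
            Real.one_le_exp (by positivity)
          rw [add_mul]
          nlinarith
        · rw [image_eq_zero_of_notMem_tsupport hx, mul_zero, abs_zero]
          positivity)
    refine ⟨hl.1, tendsto_nhds_unique (tendsto_integral_pow_mul_inner hN
      (fun k => (huW (ns k)).memLp_grad) hG₀.memLp_grad (hφ.memLp_gradient N Ω) hGlim)
      (hl.2.2.congr fun k => ?_)⟩
    exact ((hu (ns k)).isWeakSolution.integral_eq _ _ hφ.memSobolevOneZero).symm
  have hweak := fun v V hv => weakForm_of_isTestFunction hN hG₀.memLp_grad hfm
    (by filter_upwards [ae_restrict_mem hΩo.measurableSet] with x hx using hf0 x hx _)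
    (fun φ h => (hφ φ h).1) (fun φ h => (hφ φ h).2) (v := v) (V := V) hv
  have hsol : IsWeakSolution Ω f u₀ G₀ :=
    ⟨hG₀, fun v V hv => (hweak v V hv).1, fun v V hv => (hweak v V hv).2⟩
  refine ⟨u₀, G₀, hsol, hu₀nn, fun hzero => ?_⟩
  have h1 : ∫ x in Ω, ‖G₀ x‖ ^ N = 0 := by
    rw [hsol.integral_norm_pow_eq hN]
    refine integral_eq_zero_of_ae ?_
    filter_upwards [hzero] with x hx
    rw [hx, Pi.zero_apply, mul_zero]
  -- The primitive is nonnegative, so the energy alone bounds the gradients from below; strong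
  -- convergence preserves this.
  have h2 : N * a ≤ ∫ x in Ω, ‖G₀ x‖ ^ N := by
    refine ge_of_tendsto' (tendsto_integral_norm_pow (by omega) (fun k => (huW (ns k)).memLp_grad)
      hG₀.memLp_grad hGlim) fun k => ?_
    have h3 := (hu (ns k)).le_energy
    have h4 : 0 ≤ ∫ x in Ω, primF (g (ns k)) x (u (ns k) x) :=
      integral_nonneg fun x => (h.isNonlinearity _).primF_nonneg _ _
    rw [energy] at h3
    have h5 : a ≤ (1 / N) * ∫ x in Ω, ‖G (ns k) x‖ ^ N := by linarith
    rw [one_div, ← div_eq_inv_mul, le_div_iff₀ hNpos] at h5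
    linarith
  have h3 : 0 < N * a := by positivity
  linarith

end LimitProblem

/-! ### Consequences of the growth conditions for `f`. -/

section GrowthConditions

variable {N : ℕ} {Ω : Set (EuclideanSpace ℝ (Fin N))} {f : EuclideanSpace ℝ (Fin N) → ℝ → ℝ}

/-- The extension of `f` by zero outside `Ω`. -/
noncomputable def zeroExtend (Ω : Set (EuclideanSpace ℝ (Fin N)))
    (f : EuclideanSpace ℝ (Fin N) → ℝ → ℝ) (x : EuclideanSpace ℝ (Fin N)) (t : ℝ) : ℝ :=
  Ω.indicator (fun y => f y t) x

lemma zeroExtend_of_mem {x : EuclideanSpace ℝ (Fin N)} (hx : x ∈ Ω) : zeroExtend Ω f x = f x :=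
  funext fun _ => indicator_of_mem hx _

lemma zeroExtend_of_notMem {x : EuclideanSpace ℝ (Fin N)} (hx : x ∉ Ω) :
    zeroExtend Ω f x = fun _ => 0 :=
  funext fun _ => indicator_of_notMem hx _

lemma primF_zeroExtend_of_mem {x : EuclideanSpace ℝ (Fin N)} (hx : x ∈ Ω) :
    primF (zeroExtend Ω f) x = primF f x := by
  ext t
  rw [primF, primF, zeroExtend_of_mem hx]

lemma primF_zeroExtend_of_notMem {x : EuclideanSpace ℝ (Fin N)} (hx : x ∉ Ω) (t : ℝ) :
    primF (zeroExtend Ω f) x t = 0 := by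
  simp [primF, zeroExtend_of_notMem hx]

lemma auxH_zeroExtend_of_mem {x : EuclideanSpace ℝ (Fin N)} (hx : x ∈ Ω) :
    auxH (zeroExtend Ω f) x = auxH f x := by
  ext t
  rw [auxH, auxH, zeroExtend_of_mem hx, primF_zeroExtend_of_mem hx]

lemma auxH_zeroExtend_of_notMem {x : EuclideanSpace ℝ (Fin N)} (hx : x ∉ Ω) (t : ℝ) :
    auxH (zeroExtend Ω f) x t = 0 := by
  simp [auxH, zeroExtend_of_notMem hx, primF_zeroExtend_of_notMem hx]

lemma CondL1.continuousOn_zeroExtend (h : CondL1 Ω f) :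
    ContinuousOn (fun z : EuclideanSpace ℝ (Fin N) × ℝ => zeroExtend Ω f z.1 z.2) (Ω ×ˢ univ) :=
  h.continuousOn.congr fun z hz => by rw [zeroExtend_of_mem hz.1]

lemma CondL1.continuous (h : CondL1 Ω f) {x : EuclideanSpace ℝ (Fin N)} (hx : x ∈ Ω) :
    Continuous (f x) :=
  h.continuousOn.comp_continuous (f := fun t => (x, t)) (by fun_prop) fun t => ⟨hx, mem_univ t⟩

lemma CondL1.isNonlinearity_zeroExtend (hΩ : IsOpen Ω) (h : CondL1 Ω f) :
    IsNonlinearity (zeroExtend Ω f) where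
  measurable := by
    classical
    have h1 := ContinuousOn.measurable_piecewise (g := fun _ => (0 : ℝ)) h.continuousOn
      continuousOn_const (hΩ.measurableSet.prod MeasurableSet.univ)
    convert h1 using 2 with z
    by_cases hz : z.1 ∈ Ω <;> simp [zeroExtend, piecewise, hz]
  continuous x := by
    by_cases hx : x ∈ Ω
    · rw [zeroExtend_of_mem hx]
      exact h.continuous hx
    · rw [zeroExtend_of_notMem hx]
      exact continuous_const
  nonneg x t := by
    refine indicator_nonneg (fun y hy => ?_) x
    rcases le_total t 0 with ht | ht
    · rw [h.eq_zero y hy t ht]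
    · exact h.nonneg y hy t ht
  eq_zero x t ht := by
    by_cases hx : x ∈ Ω
    · rw [zeroExtend_of_mem hx, h.eq_zero x hx t ht]
    · rw [zeroExtend_of_notMem hx]

lemma IsNonlinearity.auxH_of_nonpos (hf : IsNonlinearity f) (x : EuclideanSpace ℝ (Fin N)) {t : ℝ}
    (ht : t ≤ 0) : auxH f x t = 0 := by
  rw [auxH, hf.eq_zero x t ht, hf.primF_of_nonpos x ht, mul_zero, mul_zero, sub_zero]

/-- Extension of the condition on `H` to all real arguments. -/
lemma IsNonlinearity.auxH_le_of_lt (hf : IsNonlinearity f) {θ C : ℝ} (hθ : 1 ≤ θ) (hC : 0 ≤ C)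
    (hH : ∀ x t s, 0 < t → t < s → auxH f x t ≤ θ * auxH f x s + C)
    (x : EuclideanSpace ℝ (Fin N)) (t s : ℝ) (hts : t ≤ s) :
    auxH f x t ≤ θ * auxH f x s + C := by
  rcases le_or_gt s 0 with hs | hs
  · rw [hf.auxH_of_nonpos x hs, hf.auxH_of_nonpos x (hts.trans hs)]
    linarith
  -- The limit `t → 0+` of the hypothesis, since `H` is continuous and vanishes at zero.
  have h0 : 0 ≤ θ * auxH f x s + C := by
    have hcont : Continuous (auxH f x) := by
      have h1 := hf.continuous x
      have h2 := hf.continuous_primF x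
      unfold auxH
      fun_prop
    have h1 : Tendsto (auxH f x) (𝓝[>] 0) (𝓝 0) := by
      have := hcont.tendsto 0
      rw [hf.auxH_of_nonpos x le_rfl] at this
      exact this.mono_left nhdsWithin_le_nhds
    refine le_of_tendsto h1 ?_
    filter_upwards [Ioo_mem_nhdsGT hs] with r hr
    exact hH x r s hr.1 hr.2
  rcases le_or_gt t 0 with ht | ht
  · rwa [hf.auxH_of_nonpos x ht]
  rcases hts.eq_or_lt with rfl | hlt
  · rcases le_total 0 (auxH f x t) with h | h
    · nlinarith
    · linarith
  · exact hH x t s ht hlt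

/-- Subcritical growth is uniform in `x` only for large `t`. For `t ≤ T` the condition on `H`
compares with `T`: as `F` increases and `θ ≥ 1`, the primitives drop out and `t f(x,t) ≤ θ T f(x,T)
+ C`. -/
lemma IsNonlinearity.exists_abs_mul_le_exp (hN : 2 ≤ N) (hf : IsNonlinearity f) {θ C : ℝ}
    (hθ : 1 ≤ θ) (hC : 0 ≤ C) (hH : ∀ x t s, t ≤ s → auxH f x t ≤ θ * auxH f x s + C)
    (hsub : ∀ α : ℝ, 0 < α → ∀ᶠ t : ℝ in atTop, ∀ x,
      f x t ≤ Real.exp (α * |t| ^ ((N : ℝ) / (N - 1)))) {α : ℝ} (hα : 0 < α) :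
    ∃ B, 0 ≤ B ∧ ∀ x t, |t| * f x t ≤ B * Real.exp (α * |t| ^ ((N : ℝ) / (N - 1))) := by
  obtain ⟨T, hT⟩ := eventually_atTop.1 ((hsub _ (half_pos hα)).and (eventually_ge_atTop (0 : ℝ)))
  have hT0 : 0 ≤ T := (hT T le_rfl).2
  obtain ⟨c, hc, hpow⟩ := exists_pow_le_exp (one_le_div_pred hN) (half_pos hα) 1
  set q := (N : ℝ) / (N - 1)
  set B₁ := Real.exp (α / 2 * |T| ^ q)
  refine ⟨θ * (T * B₁) + C + c, by positivity, fun x t => ?_⟩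
  have hE : 1 ≤ Real.exp (α * |t| ^ q) := Real.one_le_exp (by positivity)
  rcases le_or_gt t 0 with ht | ht
  · rw [hf.eq_zero x t ht, mul_zero]
    positivity
  rw [abs_of_pos ht] at hE ⊢
  rcases le_total t T with htT | htT
  · have h1 := hH x t T htT
    have h2 := hf.monotone_primF x htT
    have h3 := hf.primF_nonneg x T
    rw [auxH, auxH] at h1
    have h4 : T * f x T ≤ T * B₁ := mul_le_mul_of_nonneg_left ((hT T le_rfl).1 x) hT0
    have h5 : (N : ℝ) * primF f x t ≤ N * primF f x T := by gcongr
    have h6 : 0 ≤ (θ - 1) * (N * primF f x T) :=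
      mul_nonneg (by linarith) (by positivity)
    have h7 : θ * (T * f x T) ≤ θ * (T * B₁) := by gcongr
    have h8 : t * f x t ≤ θ * (T * B₁) + C := by linarith
    have h9 : 0 ≤ θ * (T * B₁) + C := by positivity
    nlinarith
  · have h1 := (hT t htT).1 x
    have h2 := hpow t ht.le
    rw [abs_of_pos ht] at h1
    rw [pow_one] at h2
    have e1 : Real.exp (α * t ^ q) = Real.exp (α / 2 * t ^ q) * Real.exp (α / 2 * t ^ q) := by
      rw [← Real.exp_add]; congr 1; ring
    have h3 : t * f x t ≤ c * Real.exp (α * t ^ q) := by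
      rw [e1, ← mul_assoc]
      exact mul_le_mul h2 h1 (hf.nonneg _ _) (by positivity)
    have h4 : 0 ≤ (θ * (T * B₁) + C) * Real.exp (α * t ^ q) := by positivity
    linarith

lemma exists_le_primF_of_condL2 (hf : IsNonlinearity f) (hL2 : CondL2 Ω f) (L : ℝ) :
    ∃ B, 0 ≤ B ∧ ∀ x ∈ Ω, ∀ t, 0 ≤ t → L * t ^ N - B ≤ primF f x t := by
  obtain ⟨T, hT⟩ := eventually_atTop.1 ((hL2 L).and (eventually_gt_atTop (0 : ℝ)))
  have hT0 : 0 < T := (hT T le_rfl).2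
  refine ⟨|L| * T ^ N, by positivity, fun x hx t ht => ?_⟩
  rcases le_total t T with htT | htT
  · have h1 : L * t ^ N ≤ |L| * T ^ N :=
      mul_le_mul (le_abs_self L) (pow_le_pow_left₀ ht htT N) (by positivity) (abs_nonneg L)
    linarith [hf.primF_nonneg x t]
  · have h1 := (hT t htT).1 x hx
    have ht0 : 0 < t := hT0.trans_le htT
    rw [le_div_iff₀ (by positivity)] at h1
    have : 0 ≤ |L| * T ^ N := by positivity
    linarith

end GrowthConditions

/-! ### Verification of the uniform conditions and conclusion. -/

section MainTheorem

variable {N : ℕ} {Ω : Set (EuclideanSpace ℝ (Fin N))} {f : EuclideanSpace ℝ (Fin N) → ℝ → ℝ}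

/-- The truncations of `f` to an exhaustion of `Ω` form a uniform family. -/
lemma uniformFamily_truncate (hN : 2 ≤ N) (hΩb : Bornology.IsBounded Ω)
    (hf : IsNonlinearity f) {θ C c δ : ℝ} (hθ : 1 ≤ θ) (hC : 0 ≤ C) (hc : 0 ≤ c) (hδ : 0 < δ)
    (hδ1 : δ ≤ 1) (hH : ∀ x t s, t ≤ s → auxH f x t ≤ θ * auxH f x s + C)
    (hexp : ∀ α : ℝ, 0 < α → ∃ B, 0 ≤ B ∧ ∀ x t,
      |t| * f x t ≤ B * Real.exp (α * |t| ^ ((N : ℝ) / (N - 1))))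
    (hsuper : ∀ L : ℝ, ∃ B, 0 ≤ B ∧ ∀ x ∈ Ω, ∀ t, 0 ≤ t → L * t ^ N - B ≤ primF f x t)
    (hsmall : ∀ x t, 0 ≤ t → t ≤ δ → N * primF f x t ≤ c * t ^ N) :
    UniformFamily (innerSet Ω) (fun n => truncate (innerSet Ω n) (n + 1) f) θ C c δ where
  isNonlinearity n := hf.truncate (isCompact_innerSet hΩb n).measurableSet (by positivity)
  one_le := hθ
  nonneg := hC
  slope_nonneg := hc
  delta_pos := hδ
  exists_le_exp α hα := by
    obtain ⟨B, hB, hle⟩ := exists_abs_mul_truncate_le_exp hN hexp hα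
    exact ⟨B, hB, fun n => hle _ _ (by linarith [(Nat.cast_nonneg n : (0 : ℝ) ≤ n)])⟩
  auxH_le n x t s hts := auxH_truncate_le hf (isCompact_innerSet hΩb n).measurableSet
    (by positivity) hθ hC hH x hts
  primF_le n x t ht htδ := by
    by_cases hx : x ∈ innerSet Ω n
    · rw [primF_truncate_of_le (by positivity) hx
        ((htδ.trans hδ1).trans (by linarith [(Nat.cast_nonneg n : (0 : ℝ) ≤ n)]))]
      exact hsmall x t ht htδ
    · rw [primF_truncate_of_notMem hx, mul_zero]
      positivity
  exists_le_primF L := by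
    obtain ⟨B, M₀, hB, hle⟩ := exists_le_primF_truncate (by omega) hf hθ hC hH hsuper L
    obtain ⟨n₀, hn₀⟩ := exists_nat_ge M₀
    refine ⟨B, n₀, hB, fun n hn => hle _ (innerSet_subset n)
      (isCompact_innerSet hΩb n).measurableSet _ ?_ ?_⟩
    · have : (n₀ : ℝ) ≤ n := by exact_mod_cast hn
      linarith
    · linarith [(Nat.cast_nonneg n : (0 : ℝ) ≤ n)]

lemma exists_bump (hN : N ≠ 0) (hΩo : IsOpen Ω) (hΩne : Ω.Nonempty) :
    ∃ e, IsTestFunction Ω e ∧ (∀ x, 0 ≤ e x) ∧ e ≠ 0 ∧ 0 < ∫ x in Ω, e x ^ N := by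
  obtain ⟨x₀, hx₀⟩ := hΩne
  obtain ⟨e, h1, h2, h3, h4, h5⟩ := exists_contDiff_tsupport_subset (n := ⊤) (hΩo.mem_nhds hx₀)
  have he : IsTestFunction Ω e := ⟨h3, h2, h1⟩
  have he0 : ∀ x, 0 ≤ e x := fun x => (h4 ⟨x, rfl⟩).1
  refine ⟨e, he, he0, fun h => by simp [h] at h5, ?_⟩
  rw [setIntegral_eq_integral_of_forall_compl_eq_zero fun x hx => by
    rw [he.eq_zero_of_notMem hx, zero_pow hN]]
  refine (he.continuous.pow N).integral_pos_of_hasCompactSupport_nonneg_nonzero (x := x₀) ?_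
    (fun x => pow_nonneg (he0 x) N) (by simp [h5])
  exact h2.comp_left (g := fun s : ℝ => s ^ N) (zero_pow hN)

/-- The slope is automatically nonnegative, because `F ≥ 0` and `Ω` is not empty. The bound `δ ≤ 1`
keeps the interval below every truncation level. -/
lemma CondL4.exists_bound (hN : N ≠ 0) (hΩne : Ω.Nonempty) (hf : IsNonlinearity (zeroExtend Ω f))
    (hL4 : CondL4 Ω f) :
    ∃ c δ : ℝ, 0 ≤ c ∧ c < firstEigenvalue Ω ∧ 0 < δ ∧ δ ≤ 1 ∧
      ∀ x t, 0 ≤ t → t ≤ δ → N * primF (zeroExtend Ω f) x t ≤ c * t ^ N := by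
  obtain ⟨c, hcl, hev⟩ := hL4
  obtain ⟨r, hr, hle⟩ := mem_nhdsGT_iff_exists_Ioo_subset.1 hev
  have hr0 : (0 : ℝ) < r := hr
  have hle' : ∀ x ∈ Ω, ∀ t, 0 < t → t < r → N * primF (zeroExtend Ω f) x t ≤ c * t ^ N :=
    fun x hx t ht htr => by
      have h1 := hle ⟨ht, htr⟩ x hx
      rw [abs_of_pos ht, div_le_iff₀ (by positivity)] at h1
      rwa [primF_zeroExtend_of_mem hx]
  have hc : 0 ≤ c := by
    obtain ⟨x₀, hx₀⟩ := hΩne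
    have h1 := hle' x₀ hx₀ (r / 2) (by positivity) (by linarith)
    have h2 := hf.primF_nonneg x₀ (r / 2)
    exact nonneg_of_mul_nonneg_left ((by positivity : 0 ≤ N * primF (zeroExtend Ω f) x₀ (r / 2)).trans
      h1) (by positivity)
  refine ⟨c, min (r / 2) 1, hc, hcl, by positivity, min_le_right _ _, fun x t ht htδ => ?_⟩
  by_cases hx : x ∈ Ω
  · rcases ht.eq_or_lt with rfl | ht0
    · simp [hN]
    · exact hle' x hx t ht0 (by linarith [htδ.trans (min_le_left _ _)])
  · rw [primF_zeroExtend_of_notMem hx, mul_zero]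
    positivity

end MainTheorem

theorem theorem2 {N : ℕ} (hN : 2 ≤ N) (Ω : Set (EuclideanSpace ℝ (Fin N)))
    (hΩ_open : IsOpen Ω) (hΩ_conn : IsConnected Ω) (hΩ_bdd : Bornology.IsBounded Ω)
    (f : EuclideanSpace ℝ (Fin N) → ℝ → ℝ)
    (hSCE : SubcriticalExpGrowth Ω f)
    (hL1 : CondL1 Ω f) (hL2 : CondL2 Ω f) (hL3 : CondL3 Ω f) (hL4 : CondL4 Ω f) :
    ∃ (u : EuclideanSpace ℝ (Fin N) → ℝ)
      (G : EuclideanSpace ℝ (Fin N) → EuclideanSpace ℝ (Fin N)),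
      IsWeakSolution Ω f u G ∧
      (∀ᵐ x ∂(volume.restrict Ω), 0 ≤ u x) ∧
      ¬ (u =ᵐ[volume.restrict Ω] 0) := by
  have hΩ : volume Ω ≠ ⊤ := hΩ_bdd.measure_lt_top.ne
  have hN0 : N ≠ 0 := by omega
  have hf := hL1.isNonlinearity_zeroExtend hΩ_open
  obtain ⟨c, δ, hc, hcl, hδ, hδ1, hsmall⟩ := hL4.exists_bound hN0 hΩ_conn.nonempty hf
  obtain ⟨C, θ, hC, hθ, hL3⟩ := hL3
  have hH := hf.auxH_le_of_lt hθ hC fun x t s ht hts => by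
    by_cases hx : x ∈ Ω
    · rw [auxH_zeroExtend_of_mem hx]
      exact hL3 x hx t s ht hts
    · rw [auxH_zeroExtend_of_notMem hx, auxH_zeroExtend_of_notMem hx]
      linarith
  have hexp : ∀ α : ℝ, 0 < α → ∃ B, 0 ≤ B ∧ ∀ x t,
      |t| * zeroExtend Ω f x t ≤ B * Real.exp (α * |t| ^ ((N : ℝ) / (N - 1))) := fun α hα => by
    refine hf.exists_abs_mul_le_exp hN hθ hC hH (fun α hα => ?_) hα
    filter_upwards [hSCE α hα 1 one_pos] with t ht x
    by_cases hx : x ∈ Ω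
    · have h1 := ht x hx
      rw [div_le_one (Real.exp_pos _)] at h1
      rw [zeroExtend_of_mem hx]
      exact (le_abs_self _).trans h1
    · rw [zeroExtend_of_notMem hx]
      positivity
  have hsuper := exists_le_primF_of_condL2 (Ω := Ω) hf (fun M => by
    filter_upwards [hL2 M] with t ht x hx
    rw [primF_zeroExtend_of_mem hx]
    exact ht x hx)
  have hfam := uniformFamily_truncate hN hΩ_bdd hf hθ hC hc hδ hδ1 hH hexp hsuper hsmall
  obtain ⟨ρ, a, hρ, ha, hring⟩ := hfam.exists_le_energy hN hΩ hcl
  obtain ⟨e, he, he0, hene, hepos⟩ := exists_bump hN0 hΩ_open hΩ_conn.nonempty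
  obtain ⟨n₀, hn₀⟩ := exists_forall_subset_innerSet (by omega) hΩ_open hΩ_bdd he.hasCompactSupport
    he.tsupport_subset
  obtain ⟨β, n₁, hpath⟩ := hfam.exists_energy_le hN hΩ he he0 hepos hn₀
  -- Indices start at `n₁`, from where the energies along the ray through `e` are bounded by `β`.
  have hsol : ∀ n, ∃ u G, IsCriticalWithEnergy Ω
      (truncate (innerSet Ω (n + n₁)) ((n + n₁ : ℕ) + 1) (zeroExtend Ω f)) (a / 2) β u G := by
    intro n
    have hM : (1 : ℝ) ≤ (n + n₁ : ℕ) + 1 := by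
      linarith [(Nat.cast_nonneg (n + n₁) : (0 : ℝ) ≤ (n + n₁ : ℕ))]
    obtain ⟨C', hgrow, hAR⟩ := exists_truncate_le hf
      (hL1.continuousOn_zeroExtend.mono (prod_mono (innerSet_subset (n + n₁)) le_rfl))
      (isCompact_innerSet hΩ_bdd (n + n₁)) hM
    obtain ⟨u, G, h1, h2, h3, h4, h5⟩ := exists_mountainPass_solution hN hΩ_bdd
      (hfam.isNonlinearity (n + n₁)) hgrow (μ := N + 1) (by linarith) hAR hρ.le ha
      (fun φ hφ => hring _ _ _ hφ.memSobolevOneZero) he hene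
      (hpath (n + n₁) (Nat.le_add_left _ _))
    exact ⟨u, G, ⟨h1, fun v V hv => (h5 v V hv).1, fun v V hv => (h5 v V hv).2⟩, h2, h3, h4⟩
  choose u G hu using hsol
  have hshift : StrictMono fun n => n + n₁ := fun m n hmn => Nat.add_lt_add_right hmn n₁
  have hDev : ∀ x ∈ Ω, ∀ᶠ n in atTop, x ∈ innerSet Ω (n + n₁) := fun x hx => by
    obtain ⟨m, hm⟩ := exists_forall_subset_innerSet (by omega) hΩ_open hΩ_bdd
      (isCompact_singleton (x := x)) (singleton_subset_iff.2 hx)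
    filter_upwards [eventually_ge_atTop m] with n hn
    exact hm _ (hn.trans (Nat.le_add_right _ _)) rfl
  refine (hfam.comp hshift).exists_isWeakSolution hN hΩ_open hΩ_bdd hDev
    (fun n => (isCompact_innerSet hΩ_bdd _).measurableSet) (half_pos ha) hu
    (fun x hx => hL1.continuous hx) (fun x hx t => ?_) (fun x hx R => ?_) fun K hKΩ hK => ?_
  · have := hf.nonneg x t
    rwa [zeroExtend_of_mem hx] at this
  · obtain ⟨m, hm⟩ := exists_nat_ge R
    filter_upwards [hDev x hx, eventually_ge_atTop m] with n hn hmn t ht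
    have h1 : (m : ℝ) ≤ n := by exact_mod_cast hmn
    rw [truncate_of_le (by positivity) hn, zeroExtend_of_mem hx]
    push_cast
    linarith [(Nat.cast_nonneg n₁ : (0 : ℝ) ≤ n₁)]
  -- For `t ≥ 1` the weight `|t|` alone suffices; for `t ≤ 1` no truncation in size is active and
  -- `f` is bounded on the compact set.
  · obtain ⟨B, hB⟩ := (hK.prod (isCompact_Icc (a := (0 : ℝ)) (b := 1))).exists_bound_of_continuousOn
      (hL1.continuousOn_zeroExtend.mono (prod_mono hKΩ (subset_univ _)))
    refine ⟨max B 0, le_max_right _ _, fun n x hx t => ?_⟩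
    have hnn := (hfam.isNonlinearity (n + n₁)).nonneg x t
    rcases le_total t 1 with ht | ht
    · have h1 : truncate (innerSet Ω (n + n₁)) ((n + n₁ : ℕ) + 1) (zeroExtend Ω f) x t ≤ max B 0 := by
        by_cases hxD : x ∈ innerSet Ω (n + n₁)
        · rw [truncate_of_le (by positivity) hxD
            (ht.trans (by linarith [(Nat.cast_nonneg (n + n₁) : (0 : ℝ) ≤ (n + n₁ : ℕ))]))]
          rcases le_total t 0 with ht0 | ht0
          · rw [hf.eq_zero x t ht0]
            exact le_max_right _ _
          · exact (le_abs_self _).trans ((hB (x, t) ⟨hx, ht0, ht⟩).trans (le_max_left _ _))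
        · rw [truncate_of_notMem hxD]
          exact le_max_right _ _
      have h2 := mul_nonneg (abs_nonneg t) hnn
      linarith
    · rw [abs_of_nonneg (by linarith)]
      have h1 := le_mul_of_one_le_left hnn ht
      linarith [le_max_right B 0]
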